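/- Let $X$ be a closed Riemannian manifold of dimension $n$ with Levi-Civita connection $\nabla$, let $\Omega$ be its curvature, a 2-form with values in $\mathrm{End}(TX)$, and put $\mathcal R=-\Omega$. All bundles and forms are complexified, so that functions on $\mathbb R_{>0}\times\pi TX$ are families, smooth in $r>0$, of differential forms in $\Omega^\bullet(X;\mathbb C)$. **Operators.** For $r>0$ and $x\in X$ let $A_x=\Lambda^{\mathrm{ev}}T_x^*X\otimes\mathbb C$, a commutative algebra, and let $C^\infty_0(\mathbb R/r\mathbb Z)$ be the smooth complex functions on the circle of circumference $r$ that are orthogonal to the constants. On $(T_xX\otimes A_x)\otimes C^\infty_0(\mathbb R/r\mathbb Z)$ consider the $A_x$-linear operators $$\Delta_{\mathrm{bos}}=-\mathrm{Id}\otimes\frac{d^2}{dt^2}+i\,\mathcal R\otimes\frac{d}{dt},\qquad \Delta_{\mathrm{fer}}=-i\,\mathrm{Id}\otimes\frac{d}{dt}.$$ The family $\Delta^{1|1}_X$ acts by $\Delta_{\mathrm{bos}}$ on even and by $\Delta_{\mathrm{fer}}$ on odd sections. The family $\Delta^{1|1}_n$ is defined in the same way with the trivial bundle of rank $n$ in place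 of $TX$ and $0$ in place of $\mathcal R$. **Super determinants.** For such an operator $T$ and a set $S$ of numerical eigenvalues let $\zeta_{T,S}(s)=\sum_{\mu\in S}\mathrm{Tr}(T^{-s}|_{E_\mu})$ for $\mathrm{Re}\,s$ large. Here $E_\mu$ is the generalized eigenspace of $\mu$; on it $T=\mu(1+N)$ with $N$ nilpotent, and $T^{-s}=\mu^{-s}\sum_j\binom{-s}{j}N^j$ is a finite sum. The function $\zeta_{T,S}$ takes values in $A_x$; it has to converge for $\mathrm{Re}\,s$ large and to continue meromorphically to $\mathbb C$ with no pole at $0$. Put $$\det\nolimits_\zeta(T)^{1/2}=e^{-\zeta_T'(0)/2}\ (\text{all eigenvalues}),\qquad \mathrm{pf}_\zeta(T)=e^{-\zeta_{T,+}'(0)}\ (\text{eigenvalues with } \mathrm{Re}\,\mu>0),\qquad \mathrm{sdet}_\zeta(\Delta)=\frac{\mathrm{pf}_\zeta(\Delta_{\mathrm{fer}})}{\det_\zeta(\Delta_{\mathrm{bos}})^{1/2}}.$$ **Supersymmetric functions.** A supersymmetric function on $\Phi^{1|1}_0(X)$ is the restriction to $\rho=0$ of a smooth function of $(r,\rho,x,\psi)\in\mathbb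 R^{1|1}_{>0}\times\pi TX$ that is invariant under the action of $\mathbb R^{1|1}\rtimes\mathbb Z/2$ for which $(u,\nu)\in\mathbb R^{1|1}$ acts by $$(r,\rho,x,\psi)\mapsto\Bigl(r+2i\nu\rho,\ \rho,\ x-\nu\psi+\tfrac{u}{r}\rho\psi,\ \psi-\tfrac{i}{r}\nu\rho\psi\Bigr)$$ and the generator of $\mathbb Z/2$ acts by $(r,\rho,x,\psi)\mapsto(r,-\rho,x,-\psi)$. Such a function of the form $\sum_k r^{k/2}\otimes\alpha_k$, with $\alpha_k$ a closed $k$-form and $k$ even, represents the class of $\sum_k\alpha_k/(2\pi)^{k/2}$ in $\mathrm H^{\mathrm{ev}}_{\mathrm{dR}}(X;\mathbb C)$. **Statement.** For all $r>0$ and $x\in X$ the super determinants $\mathrm{sdet}_\zeta(\Delta^{1|1}_X)$ and $\mathrm{sdet}_\zeta(\Delta^{1|1}_n)$ exist and the latter is invertible. Their quotient, the relative super determinant $$f=\frac{\mathrm{sdet}_\zeta(\Delta^{1|1}_X)}{\mathrm{sdet}_\zeta(\Delta^{1|1}_n)},$$ is a supersymmetric function on $\Phi^{1|1}_0(X)$.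 Let $\hat A=\sum_k\hat A_k$, with $\hat A_k$ of form degree $k$, be the $\hat A$-form of $X$, that is, the polynomial in the Pontryagin forms of $\nabla$ with characteristic series $\frac{x/2}{\sinh(x/2)}$. Then $$f=\sum_k(2\pi r)^{k/2}\,\hat A_k ,$$ the form $\hat A$ is closed and even, and $f$ represents the $\hat A$-class $[\hat A]\in\mathrm H^{\mathrm{ev}}_{\mathrm{dR}}(X;\mathbb C)$. -/

import Mathlib

open scoped Manifold ContDiff Bundle TensorProduct Topology
open Bundle

noncomputable section

namespace ClassicalVacua

/-! ### Grassmann algebras -/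

section Grassmann

variable (V : Type*) [AddCommGroup V] [Module ℂ V]

/-- The even part of the complex Grassmann algebra on `V`: the subalgebra generated by the products
of two odd generators. -/
def evenPart : Subalgebra ℂ (ExteriorAlgebra ℂ V) :=
  Algebra.adjoin ℂ {z | ∃ a b : V, z = ExteriorAlgebra.ι ℂ a * ExteriorAlgebra.ι ℂ b}

theorem ι_mul_ι_anticomm (a b : V) :
    ExteriorAlgebra.ι ℂ a * ExteriorAlgebra.ι ℂ b
      = -(ExteriorAlgebra.ι ℂ b * ExteriorAlgebra.ι ℂ a) :=
  eq_neg_of_add_eq_zero_left (ExteriorAlgebra.ι_add_mul_swap a b)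

theorem evenPart_gen_comm :
    ∀ y ∈ {z : ExteriorAlgebra ℂ V | ∃ a b : V,
        z = ExteriorAlgebra.ι ℂ a * ExteriorAlgebra.ι ℂ b},
      ∀ z ∈ {z : ExteriorAlgebra ℂ V | ∃ a b : V,
        z = ExteriorAlgebra.ι ℂ a * ExteriorAlgebra.ι ℂ b}, y * z = z * y := by
  rintro _ ⟨a, b, rfl⟩ _ ⟨c, e, rfl⟩
  have move : ∀ p q t : V, ExteriorAlgebra.ι ℂ p * ExteriorAlgebra.ι ℂ q * ExteriorAlgebra.ι ℂ t
      = ExteriorAlgebra.ι ℂ t * (ExteriorAlgebra.ι ℂ p * ExteriorAlgebra.ι ℂ q) := by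
    intro p q t
    rw [mul_assoc, ι_mul_ι_anticomm V q t, mul_neg, ← mul_assoc, ι_mul_ι_anticomm V p t, neg_mul,
      neg_neg, mul_assoc]
  rw [← mul_assoc, move, mul_assoc, move, ← mul_assoc]

theorem evenPart_mul_comm (a b : evenPart V) : a * b = b * a :=
  have := Algebra.isMulCommutative_adjoin ℂ (evenPart_gen_comm V)
  this.is_comm.comm a b

instance evenPart.instCommRing : CommRing (evenPart V) :=
  { Subalgebra.toRing (evenPart V) with mul_comm := evenPart_mul_comm V }

instance evenPart.instAlgebra : Algebra ℂ (evenPart V) :=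
  { Subalgebra.algebra (evenPart V) with }

/-- The body (numerical part) of an even element. -/
def body (a : evenPart V) : ℂ := ExteriorAlgebra.algebraMapInv (a : ExteriorAlgebra ℂ V)

/-- The exponential of an even element `c + N`, `c` a number and `N` nilpotent:
`e ^ c * ∑ k, N ^ k / k!` (a finite sum). -/
def gexp (a : evenPart V) : evenPart V :=
  Complex.exp (body V a) •
    ∑ᶠ k : ℕ, ((k.factorial : ℂ)⁻¹) • (a - algebraMap ℂ (evenPart V) (body V a)) ^ k

/-- The algebra map multiplying the degree `k` part of the Grassmann algebra by `c ^ k`. -/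
def degScale (c : ℂ) : ExteriorAlgebra ℂ V →ₐ[ℂ] ExteriorAlgebra ℂ V :=
  ExteriorAlgebra.map (c • LinearMap.id)

end Grassmann

/-! ### Functions on the circle of circumference `r`, orthogonal to the constants -/

/-- Smooth complex functions on the circle `ℝ / r ℤ` that are `L²`-orthogonal to the constants. -/
def circleFun (r : ℝ) : Submodule ℂ (ℝ → ℂ) where
  carrier := {f | ContDiff ℝ ∞ f ∧ Function.Periodic f r ∧ ∫ t in (0 : ℝ)..r, f t = 0}
  zero_mem' := ⟨contDiff_const, fun _ => rfl, by simp⟩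
  add_mem' := by
    rintro f g ⟨hf, hf', hf''⟩ ⟨hg, hg', hg''⟩
    refine ⟨hf.add hg, hf'.add hg', ?_⟩
    have := intervalIntegral.integral_add (μ := MeasureTheory.volume)
      (hf.continuous.intervalIntegrable 0 r) (hg.continuous.intervalIntegrable 0 r)
    simpa [hf'', hg''] using this
  smul_mem' := by
    rintro c f ⟨hf, hf', hf''⟩
    refine ⟨contDiff_const.smul hf, fun t => ?_, ?_⟩
    · simp [hf' t]
    · have := intervalIntegral.integral_smul (μ := MeasureTheory.volume) (a := 0) (b := r) c f
      simp [hf'']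

theorem deriv_mem_circleFun {r : ℝ} {f : ℝ → ℂ} (h : f ∈ circleFun r) :
    deriv f ∈ circleFun r := by
  obtain ⟨hf, hf', -⟩ := h
  have hd : ContDiff ℝ ∞ (deriv f) := (contDiff_infty_iff_deriv.1 hf).2
  refine ⟨hd, fun t => ?_, ?_⟩
  · have : (fun x => f (x + r)) = f := funext hf'
    rw [← deriv_comp_add_const, this]
  · rw [intervalIntegral.integral_deriv_eq_sub
      (fun x _ => (hf.differentiable (by simp)).differentiableAt)
      (hd.continuous.intervalIntegrable 0 r)]
    have := hf' 0
    rw [zero_add] at this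
    rw [this, sub_self]

/-- The operator `d/dt` on functions on the circle. -/
def ddt (r : ℝ) : circleFun r →ₗ[ℂ] circleFun r where
  toFun f := ⟨deriv f, deriv_mem_circleFun f.2⟩
  map_add' f g := by
    ext t
    exact deriv_add ((f.2.1.differentiable (by simp)) t) ((g.2.1.differentiable (by simp)) t)
  map_smul' c f := by
    ext t
    exact deriv_const_smul c ((f.2.1.differentiable (by simp)) t)

/-! ### Zeta regularized determinants over a commutative `ℂ`-algebra of nilpotent parameters -/

section Zeta

variable {A : Type*} [CommRing A] [Algebra ℂ A] {M : Type*} [AddCommGroup M] [Module A M]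

/-- The generalized eigenspace of `T` for the numerical eigenvalue `μ`: the vectors killed by a
power of `T - μ`.  There `T = μ (1 + N)` with `N` nilpotent. -/
def eigen (T : Module.End A M) (μ : ℂ) : Submodule A M :=
  T.maxGenEigenspace (algebraMap ℂ A μ)

theorem mapsTo_eigen (T : Module.End A M) (μ : ℂ) :
    ∀ m ∈ eigen T μ, (algebraMap ℂ A μ⁻¹ • T - 1 : Module.End A M) m ∈ eigen T μ := by
  apply Module.End.mapsTo_maxGenEigenspace_of_comm
  exact ((Commute.refl T).smul_right _).sub_right (Commute.one_right T)

/-- The operator `N = μ⁻¹ T - 1` on the generalized eigenspace of `μ`. -/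
def eigenNil (T : Module.End A M) (μ : ℂ) : Module.End A (eigen T μ) :=
  (algebraMap ℂ A μ⁻¹ • T - 1 : Module.End A M).restrict (mapsTo_eigen T μ)

/-- The trace of `T ^ (-s) = μ ^ (-s) ∑ j, choose (-s) j N ^ j` on the generalized eigenspace of
`μ`; the sum is finite. -/
def zetaTerm (T : Module.End A M) (s μ : ℂ) : A :=
  (μ ^ (-s)) • ∑ᶠ j : ℕ, (Ring.choose (-s) j) • LinearMap.trace A (eigen T μ) (eigenNil T μ ^ j)

/-- `z` is the derivative at `0` of the zeta function of `T` formed with the eigenvalues in `S`: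
the zeta function is `∑ μ ∈ S, Tr (T ^ (-s))` for `Re s` large, it has a meromorphic continuation
to `ℂ` which is regular at `0`, and the derivative there is `z`.  Convergence, meromorphy and
derivatives of functions with values in the finite dimensional algebra `A` are taken
coefficientwise. -/
def HasZetaDeriv (T : Module.End A M) (S : Set ℂ) (z : A) : Prop :=
  ∃ Z : ℂ → A,
    (∃ σ : ℝ, ∀ s : ℂ, σ < s.re → ∀ l : A →ₗ[ℂ] ℂ,
      HasSum (fun μ : S => l (zetaTerm T s μ)) (l (Z s))) ∧
    ∀ l : A →ₗ[ℂ] ℂ, (∀ s, MeromorphicAt (fun w => l (Z w)) s) ∧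
      AnalyticAt ℂ (fun w => l (Z w)) 0 ∧ deriv (fun w => l (Z w)) 0 = l z

end Zeta

section SuperDet

variable {V : Type*} [AddCommGroup V] [Module ℂ V]
  {M : Type*} [AddCommGroup M] [Module (evenPart V) M]
  {M' : Type*} [AddCommGroup M'] [Module (evenPart V) M']

/-- `d` is the square root `exp (-ζ'(0) / 2)` of the zeta determinant `exp (-ζ'(0))` of `T`. -/
def IsZetaDetSqrt (T : Module.End (evenPart V) M) (d : evenPart V) : Prop :=
  ∃ z, HasZetaDeriv T Set.univ z ∧ d = gexp V (-((1 / 2 : ℂ) • z))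

/-- `d` is the zeta pfaffian of `T`: every pair `±μ` of eigenvalues contributes once, through
the eigenvalue with positive real part. -/
def IsZetaPf (T : Module.End (evenPart V) M) (d : evenPart V) : Prop :=
  ∃ z, HasZetaDeriv T {μ | 0 < μ.re} z ∧ d = gexp V (-z)

/-- `d` is the zeta super determinant `pf (fer) / det (bos) ^ (1/2)` of the pair of operators
`bos`, `fer` on even and odd sections. -/
def IsZetaSdet (bos : Module.End (evenPart V) M) (fer : Module.End (evenPart V) M')
    (d : evenPart V) : Prop :=
  ∃ p q, IsZetaPf fer p ∧ IsZetaDetSqrt bos q ∧ IsUnit q ∧ d * q = p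

end SuperDet

/-! ### Kinetic operators -/

section Kinetic

variable {A : Type*} [CommRing A] [Algebra ℂ A] (n : ℕ) (r : ℝ)

/-- Sections over the circle of circumference `r` of the trivial bundle with fibre a free module of
rank `n` over the algebra `A` of parameters, orthogonal to the constant sections. -/
abbrev NormalSections (A : Type*) [CommRing A] [Algebra ℂ A] : Type _ :=
  (Fin n → A) ⊗[ℂ] circleFun r

/-- The operator `P ⊗ L`. -/
def opTensor (P : (Fin n → A) →ₗ[A] (Fin n → A)) (L : circleFun r →ₗ[ℂ] circleFun r) :
    Module.End A (NormalSections n r A) :=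
  TensorProduct.AlgebraTensorModule.map P L

/-- The bosonic operator `- Id ⊗ d²/dt² + i curv ⊗ d/dt`. -/
def kineticBos (curv : Matrix (Fin n) (Fin n) A) : Module.End A (NormalSections n r A) :=
  -opTensor n r (LinearMap.id : (Fin n → A) →ₗ[A] (Fin n → A)) (ddt r ∘ₗ ddt r)
    + algebraMap ℂ A Complex.I • opTensor n r curv.mulVecLin (ddt r)

/-- The bosonic operator `- Id ⊗ d²/dt²` of the trivial bundle of rank `n`. -/
def kineticBosTrivial : Module.End A (NormalSections n r A) :=
  -opTensor n r (LinearMap.id : (Fin n → A) →ₗ[A] (Fin n → A)) (ddt r ∘ₗ ddt r)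

/-- The fermionic operator `- i Id ⊗ d/dt`. -/
def kineticFer : Module.End A (NormalSections n r A) :=
  -(algebraMap ℂ A Complex.I • opTensor n r (LinearMap.id : (Fin n → A) →ₗ[A] (Fin n → A)) (ddt r))

end Kinetic

/-! ### Differential forms, closed forms and even de Rham cohomology -/

section Forms

variable (n : ℕ) {X : Type*} [TopologicalSpace X] [ChartedSpace (EuclideanSpace ℝ (Fin n)) X]

/-- The complexified cotangent space. -/
abbrev CoT (x : X) : Type := TangentSpace (𝓡 n) x →L[ℝ] ℂ

/-- Complex-valued differential forms of mixed degree (with no smoothness condition). -/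
abbrev Form (X : Type*) [TopologicalSpace X] [ChartedSpace (EuclideanSpace ℝ (Fin n)) X] : Type _ :=
  (x : X) → ExteriorAlgebra ℂ (CoT n x)

/-- The differential at `y` of a complex function, as an element of the Grassmann algebra. -/
def dAt (g : X → ℂ) (y : X) : ExteriorAlgebra ℂ (CoT n y) :=
  ExteriorAlgebra.ι ℂ (mvfderiv (𝓡 n) g y)

/-- The data of an expression `f dg₁ ⋯ dgₖ`. -/
structure FormTerm (X : Type*) where
  coeff : X → ℂ
  diffs : List (X → ℂ)

/-- All the functions in the expression are smooth on `U`. -/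
def FormTerm.SmoothOn (t : FormTerm X) (U : Set X) : Prop :=
  ContMDiffOn (𝓡 n) 𝓘(ℝ, ℂ) ∞ t.coeff U ∧ ∀ g ∈ t.diffs, ContMDiffOn (𝓡 n) 𝓘(ℝ, ℂ) ∞ g U

/-- The value of `f dg₁ ⋯ dgₖ`. -/
def FormTerm.eval (t : FormTerm X) (y : X) : ExteriorAlgebra ℂ (CoT n y) :=
  t.coeff y • (t.diffs.map fun g => dAt n g y).prod

/-- The value of `df dg₁ ⋯ dgₖ`. -/
def FormTerm.evalD (t : FormTerm X) (y : X) : ExteriorAlgebra ℂ (CoT n y) :=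
  dAt n t.coeff y * (t.diffs.map fun g => dAt n g y).prod

/-- `w` is a smooth form and `v = dw`: locally `w = ∑ f dg₁ ⋯ dgₖ` and `v = ∑ df dg₁ ⋯ dgₖ` with
smooth functions. -/
def IsExtDeriv (w v : Form n X) : Prop :=
  ∀ x₀ : X, ∃ U : Set X, IsOpen U ∧ x₀ ∈ U ∧ ∃ ts : List (FormTerm X),
    (∀ t ∈ ts, t.SmoothOn n U) ∧
    ∀ y ∈ U, w y = (ts.map fun t => t.eval n y).sum ∧ v y = (ts.map fun t => t.evalD n y).sum

variable {n}

theorem IsExtDeriv.zero : IsExtDeriv n (0 : Form n X) 0 :=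
  fun x₀ => ⟨Set.univ, isOpen_univ, Set.mem_univ x₀, [], by simp, by simp⟩

theorem IsExtDeriv.add {w v w' v' : Form n X} (h : IsExtDeriv n w v) (h' : IsExtDeriv n w' v') :
    IsExtDeriv n (w + w') (v + v') := by
  intro x₀
  obtain ⟨U, hU, hx, ts, hs, he⟩ := h x₀
  obtain ⟨U', hU', hx', ts', hs', he'⟩ := h' x₀
  refine ⟨U ∩ U', hU.inter hU', ⟨hx, hx'⟩, ts ++ ts', fun t ht => ?_, fun y hy => ?_⟩
  · rcases List.mem_append.1 ht with ht | ht
    · exact ⟨(hs t ht).1.mono Set.inter_subset_left,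
        fun g hg => ((hs t ht).2 g hg).mono Set.inter_subset_left⟩
    · exact ⟨(hs' t ht).1.mono Set.inter_subset_right,
        fun g hg => ((hs' t ht).2 g hg).mono Set.inter_subset_right⟩
  · simp [he y hy.1, he' y hy.2]

theorem dAt_const_smul (c : ℂ) {f : X → ℂ} {y : X} (hf : MDifferentiableAt (𝓡 n) 𝓘(ℝ, ℂ) f y) :
    dAt n (fun x => c * f x) y = c • dAt n f y := by
  have hL : HasMFDerivAt 𝓘(ℝ, ℂ) 𝓘(ℝ, ℂ) (fun z : ℂ => c * z) (f y)
      (ContinuousLinearMap.mul ℝ ℂ c) :=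
    (ContinuousLinearMap.hasFDerivAt (ContinuousLinearMap.mul ℝ ℂ c)).hasMFDerivAt
  have h := (hL.comp y hf.hasMFDerivAt).mfderiv
  unfold dAt
  rw [← map_smul]
  congr 1

theorem IsExtDeriv.smul (c : ℂ) {w v : Form n X} (h : IsExtDeriv n w v) :
    IsExtDeriv n (c • w) (c • v) := by
  intro x₀
  obtain ⟨U, hU, hx, ts, hs, he⟩ := h x₀
  refine ⟨U, hU, hx, ts.map fun t => ⟨fun x => c * t.coeff x, t.diffs⟩, ?_, fun y hy => ?_⟩
  · intro t ht
    obtain ⟨t', ht', rfl⟩ := List.mem_map.1 ht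
    exact ⟨(ContinuousLinearMap.mul ℝ ℂ c).contMDiff.comp_contMDiffOn (hs t' ht').1, (hs t' ht').2⟩
  · have key : ∀ t ∈ ts, dAt n (fun x => c * t.coeff x) y = c • dAt n t.coeff y := by
      intro t ht
      exact dAt_const_smul c (((hs t ht).1.contMDiffAt (hU.mem_nhds hy)).mdifferentiableAt (by simp))
    constructor
    · rw [Pi.smul_apply, (he y hy).1, List.smul_sum, List.map_map, List.map_map]
      congr 1
      refine List.map_congr_left fun t _ => ?_
      simp [FormTerm.eval, mul_smul]
    · rw [Pi.smul_apply, (he y hy).2, List.smul_sum, List.map_map, List.map_map]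
      congr 1
      refine List.map_congr_left fun t ht => ?_
      simp [FormTerm.evalD, key t ht]

variable (n X)

/-- Closed even forms. -/
def closedEvenForms : Submodule ℂ (Form n X) where
  carrier := {w | IsExtDeriv n w 0 ∧ ∀ x, w x ∈ evenPart (CoT n x)}
  zero_mem' := ⟨IsExtDeriv.zero, fun _ => zero_mem _⟩
  add_mem' h h' := ⟨by simpa using h.1.add h'.1, fun x => add_mem (h.2 x) (h'.2 x)⟩
  smul_mem' c _ h := ⟨by simpa using h.1.smul c, fun x => Subalgebra.smul_mem _ (h.2 x) c⟩

/-- Exact forms. -/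
def exactForms : Submodule ℂ (Form n X) where
  carrier := {v | ∃ w, IsExtDeriv n w v}
  zero_mem' := ⟨0, IsExtDeriv.zero⟩
  add_mem' := fun ⟨w, h⟩ ⟨w', h'⟩ => ⟨w + w', h.add h'⟩
  smul_mem' c _ := fun ⟨w, h⟩ => ⟨c • w, h.smul c⟩

/-- Even de Rham cohomology with complex coefficients. -/
abbrev EvenDeRham : Type _ :=
  closedEvenForms n X ⧸ (exactForms n X).comap (closedEvenForms n X).subtype

end Forms

/-! ### Supersymmetric functions on the stack of classical vacua

The stack of super circles `R = (r, ρ)` with a map to `X` factoring through the odd line is presented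
by the action of the super Euclidean group `ℝ^{1|1} ⋊ ℤ/2` on `ℝ^{1|1}_{>0} × πTX`.  In terms of
`S`-points `(u, ν)` of `ℝ^{1|1}` and `(r, ρ, x, ψ)` of `ℝ^{1|1}_{>0} × πTX`, translations and the
reflection act by

* `(r, ρ, x, ψ) ↦ (r + 2iνρ, ρ, x - νψ + (u/r) ρψ, ψ - (i/r) νρψ)`,
* `(r, ρ, x, ψ) ↦ (r, -ρ, x, -ψ)`.

Functions on the stack are the invariant functions. -/

section Susy

variable (n : ℕ) {X : Type*} [TopologicalSpace X] [ChartedSpace (EuclideanSpace ℝ (Fin n)) X]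

/-- The Grassmann algebra of the odd coordinates on `ℝ^{1|1} × ℝ^{1|1}_{>0} × πTX` over a point:
the cotangent directions of `X`, the coordinate `ν` of the group, and the coordinate `ρ`. -/
abbrev Odd (y : X) : Type _ := ExteriorAlgebra ℂ (CoT n y × ℂ × ℂ)

/-- The odd coordinate `ν`. -/
def nu (y : X) : Odd n y := ExteriorAlgebra.ι ℂ (0, 1, 0)

/-- The odd coordinate `ρ`. -/
def rho (y : X) : Odd n y := ExteriorAlgebra.ι ℂ (0, 0, 1)

/-- The function on `πTX` given by the differential of `g`; on `S`-points, `(x, ψ) ↦ ψ(g)`. -/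
def dOdd (g : X → ℂ) (y : X) : Odd n y := ExteriorAlgebra.ι ℂ (mvfderiv (𝓡 n) g y, 0, 0)

/-- The data of an expression `f(r, x) ρ^e dg₁ ⋯ dgₖ`. -/
structure SuperTerm (X : Type*) where
  coeff : ℝ → X → ℂ
  rhoPow : ℕ
  diffs : List (X → ℂ)

/-- All the functions in the expression are smooth on `J × U`. -/
def SuperTerm.SmoothOn (t : SuperTerm X) (J : Set ℝ) (U : Set X) : Prop :=
  ContMDiffOn (𝓘(ℝ, ℝ).prod (𝓡 n)) 𝓘(ℝ, ℂ) ∞ (fun p : ℝ × X => t.coeff p.1 p.2) (J ×ˢ U) ∧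
    ∀ g ∈ t.diffs, ContMDiffOn (𝓡 n) 𝓘(ℝ, ℂ) ∞ g U

/-- The value of `f(r, x) ρ^e dg₁ ⋯ dgₖ`. -/
def SuperTerm.eval (t : SuperTerm X) (r : ℝ) (y : X) : Odd n y :=
  t.coeff r y • (rho n y ^ t.rhoPow * (t.diffs.map fun g => dOdd n g y).prod)

/-- The odd parameter `ξ = -ν + (u/r) ρ` by which translations move `x` to `x + ξψ`. -/
def xi (u r : ℝ) (y : X) : Odd n y := -nu n y + ((u / r : ℝ) : ℂ) • rho n y

/-- The even factor `1 - (i/r) νρ` by which translations scale `ψ`. -/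
def psiFactor (r : ℝ) (y : X) : Odd n y :=
  1 - (Complex.I / (r : ℂ)) • (nu n y * rho n y)

/-- The result of substituting `r + 2iνρ`, `ρ`, `x + ξψ`, `(1 - (i/r)νρ) ψ` for `r`, `ρ`, `x`, `ψ`
in `f(r, x) ρ^e dg₁ ⋯ dgₖ`.  Since `ξ`, `νρ` have square zero and `ξνρ = 0`, the Taylor expansion
of the coefficient is `f + 2i νρ ∂f/∂r + ξ df`. -/
def SuperTerm.translate (t : SuperTerm X) (u r : ℝ) (y : X) : Odd n y :=
  (algebraMap ℂ (Odd n y) (t.coeff r y)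
      + (2 * Complex.I * deriv (fun r' => t.coeff r' y) r) • (nu n y * rho n y)
      + xi n u r y * dOdd n (t.coeff r) y)
    * (rho n y ^ t.rhoPow * (t.diffs.map fun g => psiFactor n r y * dOdd n g y).prod)

/-- The result of substituting `-ρ`, `-ψ` for `ρ`, `ψ` in `f(r, x) ρ^e dg₁ ⋯ dgₖ`. -/
def SuperTerm.reflect (t : SuperTerm X) (r : ℝ) (y : X) : Odd n y :=
  t.coeff r y • ((-rho n y) ^ t.rhoPow * (t.diffs.map fun g => -dOdd n g y).prod)

/-- `F` is a smooth function on `ℝ^{1|1}_{>0} × πTX` that is invariant under `ℝ^{1|1} ⋊ ℤ/2`. -/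
def IsInvariantFun (F : ℝ → (y : X) → Odd n y) : Prop :=
  ∀ r₀ : ℝ, 0 < r₀ → ∀ x₀ : X, ∃ (J : Set ℝ) (U : Set X), IsOpen J ∧ r₀ ∈ J ∧ IsOpen U ∧ x₀ ∈ U ∧
    ∃ ts : List (SuperTerm X), (∀ t ∈ ts, t.SmoothOn n J U) ∧
      ∀ r ∈ J, ∀ y ∈ U, F r y = (ts.map fun t => t.eval n r y).sum ∧
        (∀ u : ℝ, (ts.map fun t => t.translate n u r y).sum = F r y) ∧
        (ts.map fun t => t.reflect n r y).sum = F r y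

/-- Restriction to `ρ = 0`. -/
def restrictRho (y : X) : Odd n y →ₐ[ℂ] ExteriorAlgebra ℂ (CoT n y) :=
  ExteriorAlgebra.map (LinearMap.fst ℂ (CoT n y) (ℂ × ℂ))

/-- A function `f` on `ℝ_{>0} × πTX` (a family of forms depending on `r > 0`; values at `r ≤ 0` are
irrelevant) is a supersymmetric function on the stack of classical vacua: it is the restriction to
`ρ = 0` of an invariant function on `ℝ^{1|1}_{>0} × πTX`. -/
def IsSupersymmetric (f : ℝ → Form n X) : Prop :=
  ∃ F : ℝ → (y : X) → Odd n y, IsInvariantFun n F ∧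
    ∀ r : ℝ, 0 < r → ∀ y, restrictRho n y (F r y) = f r y

/-- The function `f` on classical vacua represents the class `c` under the identification of
functions on vacua with cocycles which sends `r ^ (k/2) ⊗ α` to `α / (2π) ^ (k/2)` for a closed
form `α` of degree `k`. -/
def Represents (f : ℝ → Form n X) (c : EvenDeRham n X) : Prop :=
  ∃ α β : closedEvenForms n X,
    (∀ r : ℝ, 0 < r → ∀ x, f r x = degScale (CoT n x) ((Real.sqrt r : ℝ) : ℂ) (α.1 x)) ∧
    (∀ x, β.1 x = degScale (CoT n x) (((Real.sqrt (2 * Real.pi))⁻¹ : ℝ) : ℂ) (α.1 x)) ∧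
    Submodule.Quotient.mk β = c

end Susy

/-! ### Riemannian geometry: curvature, Pontryagin forms and the `Â`-form -/

section Riemannian

variable {n : ℕ} {X : Type*} [TopologicalSpace X] [ChartedSpace (EuclideanSpace ℝ (Fin n)) X]
  [IsManifold (𝓡 n) ∞ X]

/-- `cov` is the Levi-Civita connection: smooth, torsion free and metric. -/
structure IsLeviCivita [RiemannianBundle (fun x : X => TangentSpace (𝓡 n) x)]
    [IsContMDiffRiemannianBundle (𝓡 n) ∞ (EuclideanSpace ℝ (Fin n))
      (fun x : X => TangentSpace (𝓡 n) x)]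
    (cov : CovariantDerivative (𝓡 n) (EuclideanSpace ℝ (Fin n))
      (fun x : X => TangentSpace (𝓡 n) x)) : Prop where
  smooth : cov.ContMDiffCovariantDerivative ∞
  torsion_eq_zero : cov.torsion = 0
  metric :
    haveI : IsContMDiffRiemannianBundle (𝓡 n) 1 (EuclideanSpace ℝ (Fin n))
        (fun x : X => TangentSpace (𝓡 n) x) :=
      IsContMDiffRiemannianBundle.of_le (n := ∞) (by simp)
    cov.IsMetricCompatible

variable (cov : CovariantDerivative (𝓡 n) (EuclideanSpace ℝ (Fin n))
      (fun x : X => TangentSpace (𝓡 n) x))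

/-- The curvature `R(u, v) w = ∇_U ∇_V W - ∇_V ∇_U W - ∇_{[U, V]} W` at `x`, where `U`, `V`, `W`
extend `u`, `v`, `w` to vector fields that are smooth near `x`. -/
def curvature (x : X) (u v w : TangentSpace (𝓡 n) x) : TangentSpace (𝓡 n) x :=
  let ext (z : TangentSpace (𝓡 n) x) : (y : X) → TangentSpace (𝓡 n) y :=
    FiberBundle.extend (EuclideanSpace ℝ (Fin n)) z
  cov (fun y => cov (ext w) y (ext v y)) x u - cov (fun y => cov (ext w) y (ext u y)) x v
    - cov (ext w) x (VectorField.mlieBracket (𝓡 n) (ext u) (ext v) x)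

/-- The `i`-th vector of the standard basis of the tangent space at `x`. -/
def tbasis (x : X) (i : Fin n) : TangentSpace (𝓡 n) x :=
  (EuclideanSpace.basisFun (Fin n) ℝ i : EuclideanSpace ℝ (Fin n))

/-- The `i`-th coordinate of a tangent vector at `x` in the standard basis. -/
def tcoord (x : X) (i : Fin n) : TangentSpace (𝓡 n) x →L[ℝ] ℝ :=
  (EuclideanSpace.proj i : EuclideanSpace ℝ (Fin n) →L[ℝ] ℝ)

/-- The dual basis of the complexified cotangent space. -/
def dx (x : X) (i : Fin n) : CoT n x := Complex.ofRealCLM.comp (tcoord x i)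

/-- The even element `dxᵏ ∧ dxˡ`. -/
def dxdx (x : X) (k l : Fin n) : evenPart (CoT n x) :=
  ⟨ExteriorAlgebra.ι ℂ (dx x k) * ExteriorAlgebra.ι ℂ (dx x l),
    Algebra.subset_adjoin ⟨_, _, rfl⟩⟩

/-- The matrix of curvature two-forms, `Ωⁱⱼ = ½ ∑ₖₗ R(eₖ, eₗ)ⁱⱼ dxᵏ ∧ dxˡ`. -/
def curvatureForm (x : X) : Matrix (Fin n) (Fin n) (evenPart (CoT n x)) :=
  Matrix.of fun i j => (1 / 2 : ℂ) • ∑ k, ∑ l,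
    (tcoord x i (curvature cov x (tbasis x k) (tbasis x l) (tbasis x j)) : ℂ) • dxdx x k l

/-- The Pontryagin form `p_k` at `x`: the coefficient of `t ^ (2k)` in `det (1 + t Ω / 2π)`. -/
def pontryaginForm (x : X) (k : ℕ) : evenPart (CoT n x) :=
  (Matrix.det (1 + (Polynomial.X : Polynomial (evenPart (CoT n x))) •
    (((1 / (2 * Real.pi) : ℂ) • curvatureForm cov x).map Polynomial.C))).coeff (2 * k)

/-- The characteristic power series `Q(t)` with `Q(x²) = (x/2) / sinh (x/2)`. -/
def aHatSeries : PowerSeries ℂ :=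
  (PowerSeries.mk fun j => ((4 : ℂ) ^ j * ((2 * j + 1).factorial : ℂ))⁻¹)⁻¹

/-- The symmetric polynomial `∏ Q(xᵢ)`, with `Q` truncated after degree `n`, in `n` variables. -/
def aHatSymm (n : ℕ) : MvPolynomial.symmetricSubalgebra (Fin n) ℂ :=
  ⟨∏ i : Fin n, Polynomial.aeval (MvPolynomial.X i) (aHatSeries.trunc (n + 1)), by
    intro e
    rw [map_prod]
    simp only [← Polynomial.aeval_algHom_apply, MvPolynomial.rename_X]
    exact Equiv.prod_comp e fun i : Fin n =>
      Polynomial.aeval (MvPolynomial.X i : MvPolynomial (Fin n) ℂ) (aHatSeries.trunc (n + 1))⟩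

/-- The polynomial `∏ Q(xᵢ)` expressed through the elementary symmetric polynomials. -/
def aHatPoly (n : ℕ) : MvPolynomial (Fin n) ℂ :=
  (MvPolynomial.esymmAlgEquiv (σ := Fin n) (R := ℂ) (n := n) (by simp)).symm (aHatSymm n)

/-- The `Â`-form: the polynomial in the Pontryagin forms with characteristic series
`(x/2) / sinh (x/2)`.  (The terms lost in the truncation have form degree larger than `n`.) -/
def aHatForm (x : X) : evenPart (CoT n x) :=
  MvPolynomial.aeval (fun i : Fin n => pontryaginForm cov x (i + 1)) (aHatPoly n)

/-- `d` is the zeta super determinant of the kinetic operator `Δ_X` relative to `Δ_n`, at the point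
`(r, x)`.  The endomorphism-valued two-form in `Δ_X` is minus the curvature, since
the pullback connection along the universal map is `∂_θ + θ Ω = ∂_θ - θ (-Ω)`. -/
def IsRelativeSdet (r : ℝ) (x : X) (d : evenPart (CoT n x)) : Prop :=
  ∃ dX dn : evenPart (CoT n x),
    IsZetaSdet (kineticBos n r (-curvatureForm cov x))
      (kineticFer n r : Module.End (evenPart (CoT n x)) _) dX ∧
    IsZetaSdet (kineticBosTrivial n r : Module.End (evenPart (CoT n x)) _)
      (kineticFer n r : Module.End (evenPart (CoT n x)) _) dn ∧
    IsUnit dn ∧ d * dn = dX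

end Riemannian

end ClassicalVacua

end

open ClassicalVacua

open scoped Manifold ContDiff Bundle TensorProduct Topology
open Bundle

noncomputable section

/-! On the Fourier mode of frequency `a = 2πm/r` the bosonic operator is `a² - aR = a² (1 - R/a)`,
where `R = -Ω` is nilpotent. The modes `m` and `-m` share the eigenvalue `a²`, so odd powers of `R`
cancel in the traces. The zeta function is a finite sum over even `j` of `2 choose(-s, j)
(2π/r)^(-2s-j) ζ(2s+j) Tr R^j`. The cancelled terms include `j = 1`, the only one that meets the
pole of `ζ` at `s = 0`. For `j ≥ 2` the binomial vanishes at `0` with derivative `(-1)^j / j`, so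
only the value `ζ(j)` enters. The `j = 0` term and the pfaffian are the same for both operators and
drop out of the quotient. Hence `f = exp (∑ ζ(2k)/(2k) (r/2π)^(2k) Tr Ω^(2k))`, summed over `k ≥ 1`
(`trace_eigenNil_pow`, `hasZetaDeriv_of_spectrum`, `half_sub_zetaDeriv`). The identity theorem makes
the zeta derivative unique (`HasZetaDeriv.unique`), so this is the only relative super determinant.

On the geometric side the curvature is antisymmetric for the metric, so `det (1 + tΩ/2π)` is even in
`t`. Its coefficients are the Pontryagin forms, read as elementary symmetric functions of formal
roots. Comparing logarithmic derivatives gives Newton's identities: the power sums are multiples of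
`Tr Ω^(2k)` (`symHom_symPsum`). The logarithmic derivative of `(x/2)/sinh(x/2)` has Bernoulli
numbers as coefficients, and Euler's formula turns these into the values `ζ(2k)`
(`derivative_aHatSeries`). So `Â = exp (∑ ζ(2k)/(2k) (2π)^(-4k) Tr Ω^(2k))` (`aHatForm_eq_expSum`),
and scaling degree `4k` by `(2πr)^(2k)` yields `f`.

Closedness comes from the Bianchi identity `dW = Wθ - θW` in a coordinate frame, which makes the
traces of powers closed. For a closed even form weighted by `r^(k/2)` in degree `k`, a translation
changes `r` and `ψ` in ways that cancel, and the change of `x` contributes a multiple of the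
exterior derivative. The reflection acts by parity. This gives supersymmetry
(`scaledTerm_translate`, `isSupersymmetric_of_closed`). -/

namespace ClassicalVacua

/-! ### Commuting coordinate frames by globally smooth vector fields -/

section Frames

variable {n : ℕ} {X : Type*} [TopologicalSpace X] [ChartedSpace (EuclideanSpace ℝ (Fin n)) X]

/-- The partial derivative of a real function along a vector field. -/
def partialD (v : (y : X) → TangentSpace (𝓡 n) y) (f : X → ℝ) (y : X) : ℝ :=
  mvfderiv (𝓡 n) f y (v y)

variable [IsManifold (𝓡 n) ∞ X]

/-- A commuting frame, dual to coordinate differentials on an open neighbourhood of a point, made of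
globally smooth vector fields. -/
structure CoordFrame (x₀ : X) where
  U : Set X
  isOpen : IsOpen U
  mem : x₀ ∈ U
  ξ : Fin n → X → ℝ
  e : Fin n → (y : X) → TangentSpace (𝓡 n) y
  ξ_smooth : ∀ i, ContMDiffOn (𝓡 n) 𝓘(ℝ, ℝ) ∞ (ξ i) U
  e_smooth : ∀ i, ContMDiff (𝓡 n) (𝓡 n).tangent ∞
    (fun y => (⟨y, e i y⟩ : TangentBundle (𝓡 n) X))
  dual : ∀ i j, ∀ y ∈ U, partialD (e j) (ξ i) y = if i = j then 1 else 0
  expand : ∀ y ∈ U, ∀ v : TangentSpace (𝓡 n) y, v = ∑ i, mvfderiv (𝓡 n) (ξ i) y v • e i y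
  bracket : ∀ i j, ∀ y ∈ U, VectorField.mlieBracket (𝓡 n) (e i) (e j) y = 0
  hess : ∀ (V : Set X) (f : X → ℝ), IsOpen V → V ⊆ U → ContMDiffOn (𝓡 n) 𝓘(ℝ, ℝ) ∞ f V →
    ∀ i j, ∀ y ∈ V, partialD (e i) (partialD (e j) f) y = partialD (e j) (partialD (e i) f) y

variable (x₀ : X)

/-- The constant vector field with the value of the `i`-th standard basis vector. -/
def constField (n : ℕ) (i : Fin n) (z : EuclideanSpace ℝ (Fin n)) : TangentSpace (𝓡 n) z :=
  (EuclideanSpace.basisFun (Fin n) ℝ i : EuclideanSpace ℝ (Fin n))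

theorem contMDiff_constField (i : Fin n) {m : ℕ∞ω} (z : EuclideanSpace ℝ (Fin n)) :
    ContMDiffAt (𝓡 n) (𝓡 n).tangent m
      (fun y => (⟨y, constField n i y⟩ : TangentBundle (𝓡 n) (EuclideanSpace ℝ (Fin n)))) z :=
  contMDiffAt_vectorSpace_iff_contDiffAt.2 contDiffAt_const

/-- The coordinate vector fields of the chart at `x₀`. -/
def chartField (i : Fin n) : (y : X) → TangentSpace (𝓡 n) y :=
  VectorField.mpullback (𝓡 n) 𝓘(ℝ, EuclideanSpace ℝ (Fin n)) (extChartAt (𝓡 n) x₀) (constField n i)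

theorem mfderiv_chart_chartField (i : Fin n) {y : X} (hy : y ∈ (extChartAt (𝓡 n) x₀).source) :
    mfderiv (𝓡 n) 𝓘(ℝ, EuclideanSpace ℝ (Fin n)) (extChartAt (𝓡 n) x₀) y (chartField x₀ i y)
      = constField n i (extChartAt (𝓡 n) x₀ y) := by
  have h := isInvertible_mfderiv_extChartAt (I := 𝓡 n) hy
  rw [chartField, VectorField.mpullback_apply]
  exact h.self_apply_inverse _

theorem contMDiffOn_chartField (i : Fin n) :
    ContMDiffOn (𝓡 n) (𝓡 n).tangent ∞
      (fun y => (⟨y, chartField x₀ i y⟩ : TangentBundle (𝓡 n) X)) (extChartAt (𝓡 n) x₀).source := by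
  intro y hy
  apply ContMDiffAt.contMDiffWithinAt
  apply ContMDiffAt.mpullback_vectorField_preimage (n := ∞)
  · exact contMDiff_constField i _
  · apply contMDiffAt_extChartAt'
    simpa using hy
  · exact isInvertible_mfderiv_extChartAt hy
  · simp

/-- Constant fields on the model space commute, and pullback along the chart respects Lie brackets.
-/
theorem bracket_chartField (i j : Fin n) {y : X} (hy : y ∈ (extChartAt (𝓡 n) x₀).source) :
    VectorField.mlieBracket (𝓡 n) (chartField x₀ i) (chartField x₀ j) y = 0 := by
  have : IsManifold (𝓡 n) (minSmoothness ℝ 3) X :=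
    IsManifold.of_le (n := ∞) (by
      simp only [minSmoothness_of_isRCLikeNormedField]
      exact WithTop.coe_le_coe.2 le_top)
  have hb : VectorField.mlieBracket (𝓡 n) (constField n i) (constField n j)
      (extChartAt (𝓡 n) x₀ y) = 0 := by
    rw [← VectorField.mlieBracketWithin_univ,
      VectorField.mlieBracketWithin_eq_lieBracketWithin]
    unfold constField
    have h : ∀ i : Fin n, fderivWithin ℝ (constField n i : EuclideanSpace ℝ (Fin n) →
        EuclideanSpace ℝ (Fin n)) Set.univ (extChartAt (𝓡 n) x₀ y) = 0 := fun i => by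
      unfold constField; simp
    unfold VectorField.lieBracketWithin
    erw [h, h]
    exact sub_self _
  have := VectorField.mpullback_mlieBracket (n := ∞) (I := 𝓡 n) (I' := 𝓡 n)
    (f := extChartAt (𝓡 n) x₀) (x₀ := y)
    ((contMDiff_constField i (m := 1) _).mdifferentiableAt (by simp))
    ((contMDiff_constField j (m := 1) _).mdifferentiableAt (by simp))
    (contMDiffAt_extChartAt' (by simpa using hy))
    (by
      simp only [minSmoothness_of_isRCLikeNormedField]
      exact WithTop.coe_le_coe.2 le_top)
  unfold chartField
  rw [← this, VectorField.mpullback_apply, hb, map_zero]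

theorem partialD_chartField (i : Fin n) {f : X → ℝ} {y : X} (hy : y ∈ (extChartAt (𝓡 n) x₀).source)
    (hf : MDifferentiableAt (𝓡 n) 𝓘(ℝ, ℝ) f y) :
    partialD (chartField x₀ i) f y = fderiv ℝ (f ∘ (extChartAt (𝓡 n) x₀).symm)
      (extChartAt (𝓡 n) x₀ y) (EuclideanSpace.basisFun (Fin n) ℝ i) := by
  have hφ : MDifferentiableAt (𝓡 n) (𝓡 n) (extChartAt (𝓡 n) x₀) y :=
    (contMDiffAt_extChartAt' (n := 1) (by simpa using hy)).mdifferentiableAt (by simp)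
  have hs : MDifferentiableAt (𝓡 n) (𝓡 n) (extChartAt (𝓡 n) x₀).symm (extChartAt (𝓡 n) x₀ y) := by
    have h := (contMDiffOn_extChartAt_symm (I := 𝓡 n) (n := 1) x₀).contMDiffAt
      ((isOpen_extChartAt_target x₀).mem_nhds ((extChartAt (𝓡 n) x₀).map_source hy))
    exact h.mdifferentiableAt (by simp)
  have hg : MDifferentiableAt (𝓡 n) 𝓘(ℝ, ℝ) (f ∘ (extChartAt (𝓡 n) x₀).symm)
      (extChartAt (𝓡 n) x₀ y) := by
    refine MDifferentiableAt.comp _ ?_ hs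
    rwa [(extChartAt (𝓡 n) x₀).left_inv hy]
  have heq : f =ᶠ[𝓝 y] (f ∘ (extChartAt (𝓡 n) x₀).symm) ∘ (extChartAt (𝓡 n) x₀) := by
    filter_upwards [(isOpen_extChartAt_source (I := 𝓡 n) x₀).mem_nhds hy] with z hz
    rw [Function.comp_apply, Function.comp_apply, (extChartAt (𝓡 n) x₀).left_inv hz]
  have h1 : mfderiv (𝓡 n) 𝓘(ℝ, ℝ) f y = (mfderiv (𝓡 n) 𝓘(ℝ, ℝ) (f ∘ (extChartAt (𝓡 n) x₀).symm)
      (extChartAt (𝓡 n) x₀ y)).comp (mfderiv (𝓡 n) (𝓡 n) (extChartAt (𝓡 n) x₀) y) := by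
    rw [← mfderiv_comp y hg hφ]
    exact heq.mfderiv_eq
  have h2 := congrArg (fun L => L (chartField x₀ i y)) h1
  have h3 := mfderiv_chart_chartField x₀ i hy
  rw [partialD]
  refine h2.trans ?_
  refine (congrArg (mfderiv (𝓡 n) 𝓘(ℝ, ℝ) (f ∘ (extChartAt (𝓡 n) x₀).symm)
      (extChartAt (𝓡 n) x₀ y)) h3).trans ?_
  rw [mfderiv_eq_fderiv]
  rfl

omit [IsManifold (𝓡 n) ∞ X] in
theorem partialD_congr {f g : X → ℝ} {y : X} (h : f =ᶠ[𝓝 y] g)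
    (v : (y : X) → TangentSpace (𝓡 n) y) : partialD v f y = partialD v g y := by
  have h1 := h.mfderiv_eq (I := 𝓡 n) (I' := 𝓘(ℝ, ℝ))
  exact congrArg (fun L => L (v y)) h1

theorem contMDiffOn_partialD {V : Set X} (hV : IsOpen V) {f : X → ℝ}
    (hf : ContMDiffOn (𝓡 n) 𝓘(ℝ, ℝ) ∞ f V) {v : (y : X) → TangentSpace (𝓡 n) y}
    (hv : ContMDiffOn (𝓡 n) (𝓡 n).tangent ∞ (fun y => (⟨y, v y⟩ : TangentBundle (𝓡 n) X)) V) :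
    ContMDiffOn (𝓡 n) 𝓘(ℝ, ℝ) ∞ (partialD v f) V := by
  intro y hy
  have h1 := (hf.contMDiffAt (hV.mem_nhds hy)).mfderiv_const (m := ∞) (by simp)
  have h2 := ContMDiffAt.clm_apply_of_inCoordinates h1 (hv.contMDiffAt (hV.mem_nhds hy))
    (hf.contMDiffAt (hV.mem_nhds hy))
  exact ((contMDiff_snd_tangentBundle_modelSpace ℝ 𝓘(ℝ, ℝ)).contMDiffAt.comp y
    h2).contMDiffWithinAt

/-- Turns an iterated partial derivative into a second Fréchet derivative in the chart, where
Schwarz's theorem applies. -/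
theorem chart_second_partial (i j : Fin n) {V : Set X} (hV : IsOpen V)
    (hVU : V ⊆ (extChartAt (𝓡 n) x₀).source) {f : X → ℝ} (hf : ContMDiffOn (𝓡 n) 𝓘(ℝ, ℝ) ∞ f V)
    {y : X} (hy : y ∈ V) :
    partialD (chartField x₀ i) (partialD (chartField x₀ j) f) y
      = fderiv ℝ (fderiv ℝ (f ∘ (extChartAt (𝓡 n) x₀).symm)) (extChartAt (𝓡 n) x₀ y)
        (EuclideanSpace.basisFun (Fin n) ℝ i) (EuclideanSpace.basisFun (Fin n) ℝ j) := by
  have hs := (contMDiffOn_extChartAt_symm (I := 𝓡 n) (n := ∞) (M := X) x₀)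
  have hg : ∀ z ∈ V, ContDiffAt ℝ ∞ (f ∘ (extChartAt (𝓡 n) x₀).symm)
      (extChartAt (𝓡 n) x₀ z) := by
    intro z hz
    refine ContMDiffAt.contDiffAt (ContMDiffAt.comp _ ?_ (hs.contMDiffAt
      ((isOpen_extChartAt_target x₀).mem_nhds ((extChartAt (𝓡 n) x₀).map_source (hVU hz)))))
    rw [(extChartAt (𝓡 n) x₀).left_inv (hVU hz)]
    exact hf.contMDiffAt (hV.mem_nhds hz)
  have hP := contMDiffOn_partialD hV hf ((contMDiffOn_chartField x₀ j).mono hVU)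
  rw [partialD_chartField x₀ i (hVU hy)
    ((hP.contMDiffAt (hV.mem_nhds hy)).mdifferentiableAt (by simp))]
  have hcont : ContinuousAt (extChartAt (𝓡 n) x₀).symm (extChartAt (𝓡 n) x₀ y) :=
    continuousAt_extChartAt_symm' (hVU hy)
  have heq : partialD (chartField x₀ j) f ∘ (extChartAt (𝓡 n) x₀).symm
      =ᶠ[𝓝 (extChartAt (𝓡 n) x₀ y)] fun z => fderiv ℝ (f ∘ (extChartAt (𝓡 n) x₀).symm) z
        (EuclideanSpace.basisFun (Fin n) ℝ j) := by
    have hV' : V ∈ 𝓝 ((extChartAt (𝓡 n) x₀).symm (extChartAt (𝓡 n) x₀ y)) := by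
      rw [(extChartAt (𝓡 n) x₀).left_inv (hVU hy)]; exact hV.mem_nhds hy
    filter_upwards [hcont hV', (isOpen_extChartAt_target (I := 𝓡 n) x₀).mem_nhds
      ((extChartAt (𝓡 n) x₀).map_source (hVU hy))] with z hz hz'
    rw [Function.comp_apply, partialD_chartField x₀ j (hVU hz)
      ((hf.contMDiffAt (hV.mem_nhds hz)).mdifferentiableAt (by simp)),
      (extChartAt (𝓡 n) x₀).right_inv hz']
  rw [heq.fderiv_eq, fderiv_clm_apply]
  · simp
  · exact ((hg y hy).fderiv_right (m := 1) (by exact WithTop.coe_le_coe.2 le_top)).differentiableAt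
      (by simp)
  · exact differentiableAt_const _

theorem chart_hess (i j : Fin n) {V : Set X} (hV : IsOpen V)
    (hVU : V ⊆ (extChartAt (𝓡 n) x₀).source) {f : X → ℝ} (hf : ContMDiffOn (𝓡 n) 𝓘(ℝ, ℝ) ∞ f V)
    {y : X} (hy : y ∈ V) :
    partialD (chartField x₀ i) (partialD (chartField x₀ j) f) y
      = partialD (chartField x₀ j) (partialD (chartField x₀ i) f) y := by
  rw [chart_second_partial x₀ i j hV hVU hf hy, chart_second_partial x₀ j i hV hVU hf hy]
  have hs := (contMDiffOn_extChartAt_symm (I := 𝓡 n) (n := ∞) (M := X) x₀).contMDiffAt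
      ((isOpen_extChartAt_target x₀).mem_nhds ((extChartAt (𝓡 n) x₀).map_source (hVU hy)))
  have hg : ContMDiffAt (𝓡 n) 𝓘(ℝ, ℝ) ∞ (f ∘ (extChartAt (𝓡 n) x₀).symm)
      (extChartAt (𝓡 n) x₀ y) := by
    refine ContMDiffAt.comp _ ?_ hs
    rw [(extChartAt (𝓡 n) x₀).left_inv (hVU hy)]
    exact hf.contMDiffAt (hV.mem_nhds hy)
  exact (hg.contDiffAt.isSymmSndFDerivAt (by
    simp only [minSmoothness_of_isRCLikeNormedField]
    exact WithTop.coe_le_coe.2 le_top)) _ _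

/-- The coordinates of the chart at `x₀`. -/
def chartCoord (i : Fin n) (y : X) : ℝ :=
  (EuclideanSpace.proj i : EuclideanSpace ℝ (Fin n) →L[ℝ] ℝ) (extChartAt (𝓡 n) x₀ y)

theorem contMDiffOn_chartCoord (i : Fin n) :
    ContMDiffOn (𝓡 n) 𝓘(ℝ, ℝ) ∞ (chartCoord x₀ i) (extChartAt (𝓡 n) x₀).source := by
  refine (EuclideanSpace.proj i : EuclideanSpace ℝ (Fin n) →L[ℝ] ℝ).contMDiff.comp_contMDiffOn ?_
  rw [extChartAt_source]
  exact contMDiffOn_extChartAt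

theorem mvfderiv_chartCoord (i : Fin n) {y : X} (hy : y ∈ (extChartAt (𝓡 n) x₀).source)
    (v : TangentSpace (𝓡 n) y) :
    mvfderiv (𝓡 n) (chartCoord x₀ i) y v
      = (EuclideanSpace.proj i : EuclideanSpace ℝ (Fin n) →L[ℝ] ℝ)
        (mfderiv (𝓡 n) (𝓡 n) (extChartAt (𝓡 n) x₀) y v : EuclideanSpace ℝ (Fin n)) := by
  have hφ : MDifferentiableAt (𝓡 n) (𝓡 n) (extChartAt (𝓡 n) x₀) y :=
    (contMDiffAt_extChartAt' (n := 1) (by simpa using hy)).mdifferentiableAt (by simp)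
  have hL : HasMFDerivAt (𝓡 n) 𝓘(ℝ, ℝ) (EuclideanSpace.proj i : EuclideanSpace ℝ (Fin n) →L[ℝ] ℝ)
      (extChartAt (𝓡 n) x₀ y) (EuclideanSpace.proj i : EuclideanSpace ℝ (Fin n) →L[ℝ] ℝ) :=
    (ContinuousLinearMap.hasFDerivAt _).hasMFDerivAt
  have h := (hL.comp y hφ.hasMFDerivAt).mfderiv
  exact congrArg (fun L => L v) h

/-- Chart fields are controlled only on the chart domain. Multiplied by a bump function they become
globally smooth, and on the open set where the bump function is `1` all the local identities
survive. -/
theorem exists_coordFrame [T2Space X] : Nonempty (CoordFrame (n := n) x₀) := by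
  obtain ⟨χ⟩ : Nonempty (SmoothBumpFunction (𝓡 n) x₀) := inferInstance
  obtain ⟨U, hU, hUo, hx⟩ := eventually_nhds_iff.1
    (χ.eventuallyEq_one.and ((isOpen_extChartAt_source (I := 𝓡 n) x₀).mem_nhds
      (mem_extChartAt_source (I := 𝓡 n) x₀)))
  have hUs : U ⊆ (extChartAt (𝓡 n) x₀).source := fun y hy => (hU y hy).2
  have heq : ∀ y ∈ U, ∀ i : Fin n, χ y • chartField x₀ i y = chartField x₀ i y := by
    intro y hy i
    rw [(hU y hy).1]; exact one_smul _ _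
  have hp : ∀ i : Fin n, ∀ y ∈ U, ∀ f : X → ℝ, partialD (fun z => χ z • chartField x₀ i z) f y
      = partialD (chartField x₀ i) f y := by
    intro i y hy f
    simp only [partialD, heq y hy]
  refine ⟨⟨U, hUo, hx, chartCoord x₀, fun i y => χ y • chartField x₀ i y, ?_, ?_, ?_, ?_, ?_, ?_⟩⟩
  · exact fun i => (contMDiffOn_chartCoord x₀ i).mono hUs
  · intro i
    apply ContMDiffOn.smul_section_of_tsupport (u := (extChartAt (𝓡 n) x₀).source)
    · exact χ.contMDiff.contMDiffOn
    · exact isOpen_extChartAt_source x₀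
    · exact χ.tsupport_subset_extChartAt_source
    · exact contMDiffOn_chartField x₀ i
  · intro i j y hy
    rw [hp j y hy, partialD, mvfderiv_chartCoord _ _ (hUs hy), mfderiv_chart_chartField _ _ (hUs hy)]
    simp [constField]
  · intro y hy v
    have h := isInvertible_mfderiv_extChartAt (I := 𝓡 n) (hUs hy)
    apply h.injective
    rw [map_sum]
    simp only [map_smul, heq y hy, mfderiv_chart_chartField _ _ (hUs hy),
      mvfderiv_chartCoord x₀ _ (hUs hy)]
    exact ((EuclideanSpace.basisFun (Fin n) ℝ).sum_repr
      (mfderiv (𝓡 n) (𝓡 n) (extChartAt (𝓡 n) x₀) y v : EuclideanSpace ℝ (Fin n))).symm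
  · intro i j y hy
    rw [← bracket_chartField x₀ i j (hUs hy)]
    apply Filter.EventuallyEq.mlieBracket_vectorField_eq
    · filter_upwards [hUo.mem_nhds hy] with z hz using heq z hz i
    · filter_upwards [hUo.mem_nhds hy] with z hz using heq z hz j
  · intro V f hV hVU hf i j y hy
    have hc : ∀ i j : Fin n, partialD (fun z => χ z • chartField x₀ i z)
        (partialD (fun z => χ z • chartField x₀ j z) f) y
        = partialD (chartField x₀ i) (partialD (chartField x₀ j) f) y := by
      intro i j
      rw [hp i y (hVU hy)]
      apply partialD_congr
      filter_upwards [hV.mem_nhds hy] with z hz using hp j z (hVU hz) f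
    rw [hc, hc]
    exact chart_hess x₀ i j hV (hVU.trans hUs) hf hy

end Frames

/-! ### Rules for directional derivatives -/

section PartialD

variable {n : ℕ} {X : Type*} [TopologicalSpace X] [ChartedSpace (EuclideanSpace ℝ (Fin n)) X]
  (v : (y : X) → TangentSpace (𝓡 n) y) {f g : X → ℝ} {y : X}

theorem partialD_add (hf : MDifferentiableAt (𝓡 n) 𝓘(ℝ, ℝ) f y)
    (hg : MDifferentiableAt (𝓡 n) 𝓘(ℝ, ℝ) g y) :
    partialD v (fun z => f z + g z) y = partialD v f y + partialD v g y := by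
  simp only [partialD]
  rw [mvfderiv_fun_add hf hg]; rfl

theorem partialD_mul (hf : MDifferentiableAt (𝓡 n) 𝓘(ℝ, ℝ) f y)
    (hg : MDifferentiableAt (𝓡 n) 𝓘(ℝ, ℝ) g y) :
    partialD v (fun z => f z * g z) y = partialD v f y * g y + f y * partialD v g y := by
  simp only [partialD]
  rw [mvfderiv_fun_mul hf hg]
  simp [mul_comm, add_comm]

theorem partialD_const (c : ℝ) : partialD v (fun _ => c) y = 0 := by
  simp only [partialD]
  rw [mvfderiv_const]; rfl

theorem mdifferentiableAt_sum {ι : Type*} (s : Finset ι) {F : ι → X → ℝ}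
    (hF : ∀ i ∈ s, MDifferentiableAt (𝓡 n) 𝓘(ℝ, ℝ) (F i) y) :
    MDifferentiableAt (𝓡 n) 𝓘(ℝ, ℝ) (fun z => ∑ i ∈ s, F i z) y := by
  classical
  induction s using Finset.induction_on with
  | empty => simpa using mdifferentiableAt_const
  | insert a s ha ih =>
    simp only [Finset.sum_insert ha]
    exact (hF a (Finset.mem_insert_self _ _)).add
      (ih fun i hi => hF i (Finset.mem_insert_of_mem hi))

theorem partialD_sum {ι : Type*} (s : Finset ι) {F : ι → X → ℝ}
    (hF : ∀ i ∈ s, MDifferentiableAt (𝓡 n) 𝓘(ℝ, ℝ) (F i) y) :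
    partialD v (fun z => ∑ i ∈ s, F i z) y = ∑ i ∈ s, partialD v (F i) y := by
  classical
  induction s using Finset.induction_on with
  | empty => simpa using partialD_const v 0
  | insert a s ha ih =>
    simp only [Finset.sum_insert ha]
    rw [partialD_add v (hF a (Finset.mem_insert_self _ _))
      (mdifferentiableAt_sum s fun i hi => hF i (Finset.mem_insert_of_mem hi)),
      ih fun i hi => hF i (Finset.mem_insert_of_mem hi)]

end PartialD

/-! ### The connection in components -/

section Connection

variable {n : ℕ} {X : Type*} [TopologicalSpace X] [ChartedSpace (EuclideanSpace ℝ (Fin n)) X]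
  [IsManifold (𝓡 n) ∞ X] {x₀ : X}

namespace CoordFrame

variable (F : CoordFrame (n := n) x₀)

/-- The vector field with given components. -/
def comb (c : Fin n → X → ℝ) (y : X) : TangentSpace (𝓡 n) y := ∑ j, c j y • F.e j y

/-- The components of a vector field. -/
def comp (v : (y : X) → TangentSpace (𝓡 n) y) (i : Fin n) (y : X) : ℝ := partialD v (F.ξ i) y

theorem comb_comp (v : (y : X) → TangentSpace (𝓡 n) y) {y : X} (hy : y ∈ F.U) :
    F.comb (F.comp v) y = v y := (F.expand y hy (v y)).symm

theorem comp_smooth {v : (y : X) → TangentSpace (𝓡 n) y} {V : Set X} (hV : IsOpen V) (hVU : V ⊆ F.U)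
    (hv : ContMDiffOn (𝓡 n) (𝓡 n).tangent ∞ (fun y => (⟨y, v y⟩ : TangentBundle (𝓡 n) X)) V)
    (i : Fin n) : ContMDiffOn (𝓡 n) 𝓘(ℝ, ℝ) ∞ (F.comp v i) V :=
  contMDiffOn_partialD hV ((F.ξ_smooth i).mono hVU) hv

theorem comb_mdiff {c : Fin n → X → ℝ} {y : X}
    (hc : ∀ i, MDifferentiableAt (𝓡 n) 𝓘(ℝ, ℝ) (c i) y) :
    MDifferentiableAt (𝓡 n) (𝓡 n).tangent
      (fun y => (⟨y, F.comb c y⟩ : TangentBundle (𝓡 n) X)) y := by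
  apply MDifferentiableAt.sum_section
  intro i _
  exact MDifferentiableAt.smul_section (hc i) ((F.e_smooth i).mdifferentiableAt (by simp))

theorem comp_add_eq {y : X} (hy : y ∈ F.U) (c : Fin n → ℝ) (i : Fin n) :
    mvfderiv (𝓡 n) (F.ξ i) y (∑ j, c j • F.e j y) = c i := by
  rw [map_sum]
  simp only [map_smul]
  have : ∀ j, mvfderiv (𝓡 n) (F.ξ i) y (F.e j y) = if i = j then 1 else 0 := fun j => F.dual i j y hy
  simp [this]

variable (cov : CovariantDerivative (𝓡 n) (EuclideanSpace ℝ (Fin n))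
      (fun x : X => TangentSpace (𝓡 n) x))

/-- The Christoffel symbols: `∇_{e_l} e_j = ∑ i, Γ l i j e_i`. -/
def Γ (l i j : Fin n) : X → ℝ := partialD (fun y => cov (F.e j) y (F.e l y)) (F.ξ i)

/-- The covariant derivative in components. -/
def covD (l : Fin n) (c : Fin n → X → ℝ) (i : Fin n) (y : X) : ℝ :=
  partialD (F.e l) (c i) y + ∑ j, F.Γ cov l i j y * c j y

theorem cov_e {y : X} (hy : y ∈ F.U) (j l : Fin n) :
    cov (F.e j) y (F.e l y) = ∑ i, F.Γ cov l i j y • F.e i y := F.expand y hy _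

theorem cov_sum {y : X} (s : Finset (Fin n)) (σ : Fin n → (y : X) → TangentSpace (𝓡 n) y)
    (h : ∀ i, MDifferentiableAt (𝓡 n) (𝓡 n).tangent
      (fun y => (⟨y, σ i y⟩ : TangentBundle (𝓡 n) X)) y) :
    cov (fun z => ∑ i ∈ s, σ i z) y = ∑ i ∈ s, cov (σ i) y := by
  classical
  induction s using Finset.induction_on with
  | empty =>
    simp only [Finset.sum_empty]
    exact congrFun cov.zero y
  | insert a s ha ih =>
    simp only [Finset.sum_insert ha]
    rw [← ih]
    exact cov.isCovariantDerivativeOnUniv.add (h a) (MDifferentiableAt.sum_section fun i _ => h i)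

theorem cov_comb {y : X} (hy : y ∈ F.U) {c : Fin n → X → ℝ}
    (hc : ∀ i, MDifferentiableAt (𝓡 n) 𝓘(ℝ, ℝ) (c i) y) (l : Fin n) :
    cov (F.comb c) y (F.e l y) = ∑ i, F.covD cov l c i y • F.e i y := by
  have h1 : cov (F.comb c) y = ∑ j, cov (c j • F.e j) y :=
    cov_sum cov Finset.univ (fun j => c j • F.e j) fun j =>
      MDifferentiableAt.smul_section (hc j) ((F.e_smooth j).mdifferentiableAt (by simp))
  have h2 : ∀ j, cov (c j • F.e j) y (F.e l y)
      = c j y • (∑ i, F.Γ cov l i j y • F.e i y) + partialD (F.e l) (c j) y • F.e j y := by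
    intro j
    rw [cov.isCovariantDerivativeOnUniv.leibniz ((F.e_smooth j).mdifferentiableAt (by simp)) (hc j),
      ← F.cov_e cov hy]
    rfl
  rw [h1, sum_apply]
  simp only [h2, covD, Finset.sum_add_distrib, add_smul, Finset.smul_sum, smul_smul, Finset.sum_smul]
  rw [add_comm, Finset.sum_comm]
  congr 1
  refine Finset.sum_congr rfl fun i _ => Finset.sum_congr rfl fun j _ => ?_
  rw [mul_comm]

theorem cov_comb_apply {y : X} (hy : y ∈ F.U) {c : Fin n → X → ℝ}
    (hc : ∀ i, MDifferentiableAt (𝓡 n) 𝓘(ℝ, ℝ) (c i) y) (b : Fin n → ℝ) :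
    cov (F.comb c) y (∑ l, b l • F.e l y) = ∑ i, (∑ l, b l * F.covD cov l c i y) • F.e i y := by
  rw [map_sum]
  simp only [map_smul, F.cov_comb cov hy hc, Finset.smul_sum, smul_smul, Finset.sum_smul]
  exact Finset.sum_comm

end CoordFrame

end Connection

/-! ### Christoffel symbols and the curvature tensor in components -/

section Connection

variable {n : ℕ} {X : Type*} [TopologicalSpace X] [ChartedSpace (EuclideanSpace ℝ (Fin n)) X]
  [IsManifold (𝓡 n) ∞ X] {x₀ : X}

namespace CoordFrame

variable (F : CoordFrame (n := n) x₀)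

variable {cov : CovariantDerivative (𝓡 n) (EuclideanSpace ℝ (Fin n))
      (fun x : X => TangentSpace (𝓡 n) x)}

theorem Γ_smooth (hs : cov.ContMDiffCovariantDerivative ∞) (l i j : Fin n) :
    ContMDiffOn (𝓡 n) 𝓘(ℝ, ℝ) ∞ (F.Γ cov l i j) F.U := by
  apply F.comp_smooth F.isOpen subset_rfl
  have h1 := hs.contMDiff.contMDiff (σ := F.e j) ((F.e_smooth j).contMDiffOn)
  exact ((contMDiffOn_univ.1 h1).clm_bundle_apply (F.e_smooth l)).contMDiffOn

/-- For a commuting frame, vanishing torsion reads `∇_{e_l} e_j = ∇_{e_j} e_l`. -/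
theorem Γ_symm (ht : cov.torsion = 0) {y : X} (hy : y ∈ F.U) (l i j : Fin n) :
    F.Γ cov l i j y = F.Γ cov j i l y := by
  have h := cov.torsion_eq_zero_iff.1 ht (X := F.e l) (Y := F.e j) (x := y)
    ((F.e_smooth l).mdifferentiableAt (by simp)) ((F.e_smooth j).mdifferentiableAt (by simp))
  rw [F.bracket l j y hy, sub_eq_zero] at h
  exact congrArg (mvfderiv (𝓡 n) (F.ξ i) y) h

variable (cov) in
/-- The components of the curvature. -/
def Riem (k l i j : Fin n) (y : X) : ℝ :=
  partialD (F.e k) (F.Γ cov l i j) y - partialD (F.e l) (F.Γ cov k i j) y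
    + ∑ m, (F.Γ cov k i m y * F.Γ cov l m j y - F.Γ cov l i m y * F.Γ cov k m j y)

theorem covD_smooth (hs : cov.ContMDiffCovariantDerivative ∞) {V : Set X} (hV : IsOpen V)
    (hVU : V ⊆ F.U) {c : Fin n → X → ℝ} (hc : ∀ i, ContMDiffOn (𝓡 n) 𝓘(ℝ, ℝ) ∞ (c i) V)
    (l i : Fin n) : ContMDiffOn (𝓡 n) 𝓘(ℝ, ℝ) ∞ (F.covD cov l c i) V := by
  apply ContMDiffOn.add
  · exact contMDiffOn_partialD hV (hc i) (F.e_smooth l).contMDiffOn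
  · apply contMDiffOn_finsetSum
    intro j _
    exact ((F.Γ_smooth hs l i j).mono hVU).mul (hc j)

/-- The Ricci identity. The derivatives of the components cancel in the commutator, so only a zeroth
order operator remains, and it is the curvature. -/
theorem covD_comm (hs : cov.ContMDiffCovariantDerivative ∞) {V : Set X} (hV : IsOpen V)
    (hVU : V ⊆ F.U) {c : Fin n → X → ℝ} (hc : ∀ i, ContMDiffOn (𝓡 n) 𝓘(ℝ, ℝ) ∞ (c i) V)
    {y : X} (hy : y ∈ V) (k l i : Fin n) :
    F.covD cov k (F.covD cov l c) i y - F.covD cov l (F.covD cov k c) i y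
      = ∑ j, F.Riem cov k l i j y * c j y := by
  have hd : ∀ {f : X → ℝ}, ContMDiffOn (𝓡 n) 𝓘(ℝ, ℝ) ∞ f V → MDifferentiableAt (𝓡 n) 𝓘(ℝ, ℝ) f y :=
    fun hf => (hf.contMDiffAt (hV.mem_nhds hy)).mdifferentiableAt (by simp)
  have hΓ : ∀ l i j, MDifferentiableAt (𝓡 n) 𝓘(ℝ, ℝ) (F.Γ cov l i j) y :=
    fun l i j => hd ((F.Γ_smooth hs l i j).mono hVU)
  -- Exchanging `k` and `l` fixes the second derivative and swaps the third and fourth groups, so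
  -- only the second and fifth contribute to the commutator.
  have key : ∀ k l, F.covD cov k (F.covD cov l c) i y = partialD (F.e k) (partialD (F.e l) (c i)) y
      + ∑ j, partialD (F.e k) (F.Γ cov l i j) y * c j y
      + ∑ j, F.Γ cov l i j y * partialD (F.e k) (c j) y
      + ∑ m, F.Γ cov k i m y * partialD (F.e l) (c m) y
      + ∑ j, (∑ m, F.Γ cov k i m y * F.Γ cov l m j y) * c j y := by
    intro k l
    have h1 : partialD (F.e k) (F.covD cov l c i) y = partialD (F.e k) (partialD (F.e l) (c i)) y
      + ∑ j, (partialD (F.e k) (F.Γ cov l i j) y * c j y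
        + F.Γ cov l i j y * partialD (F.e k) (c j) y) := by
      have e1 := partialD_add (F.e k) (y := y) (f := partialD (F.e l) (c i))
        (g := fun z => ∑ j, F.Γ cov l i j z * c j z)
        (hd (contMDiffOn_partialD hV (hc i) (F.e_smooth l).contMDiffOn))
        (mdifferentiableAt_sum _ fun j _ => (hΓ l i j).mul (hd (hc j)))
      refine e1.trans ?_
      rw [partialD_sum (F.e k) Finset.univ (F := fun j z => F.Γ cov l i j z * c j z)
        fun j _ => (hΓ l i j).mul (hd (hc j))]
      congr 1
      exact Finset.sum_congr rfl fun j _ => partialD_mul _ (hΓ l i j) (hd (hc j))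
    rw [covD, h1]
    simp only [covD, mul_add, Finset.sum_add_distrib, Finset.mul_sum, Finset.sum_mul]
    rw [Finset.sum_comm (f := fun m j => F.Γ cov k i m y * (F.Γ cov l m j y * c j y))]
    simp only [mul_assoc]
    ring
  rw [key, key, F.hess V (c i) hV hVU (hc i) k l y hy]
  simp only [Riem, add_mul, sub_mul, Finset.sum_add_distrib, Finset.sum_sub_distrib]
  ring

/-- Torsion freeness gives `[A, B] = ∇_A B - ∇_B A`; the Christoffel terms then cancel by their
symmetry. -/
theorem mlieBracket_comb (ht : cov.torsion = 0) {y : X} (hy : y ∈ F.U) {a b : Fin n → X → ℝ}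
    (ha : ∀ i, MDifferentiableAt (𝓡 n) 𝓘(ℝ, ℝ) (a i) y)
    (hb : ∀ i, MDifferentiableAt (𝓡 n) 𝓘(ℝ, ℝ) (b i) y) :
    VectorField.mlieBracket (𝓡 n) (F.comb a) (F.comb b) y
      = ∑ i, (∑ k, (a k y * partialD (F.e k) (b i) y - b k y * partialD (F.e k) (a i) y)) • F.e i y := by
  rw [← cov.torsion_eq_zero_iff.1 ht (F.comb_mdiff ha) (F.comb_mdiff hb)]
  have h1 := F.cov_comb_apply cov hy hb fun k => a k y
  have h2 := F.cov_comb_apply cov hy ha fun k => b k y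
  refine (congrArg₂ (· - ·) h1 h2).trans ?_
  rw [← Finset.sum_sub_distrib]
  refine Finset.sum_congr rfl fun i _ => ?_
  rw [← sub_smul]
  congr 1
  simp only [covD, mul_add, Finset.sum_add_distrib, Finset.sum_sub_distrib, Finset.mul_sum]
  rw [Finset.sum_comm (f := fun k j => b k y * (F.Γ cov k i j y * a j y))]
  have : ∀ k j, b j y * (F.Γ cov j i k y * a k y) = a k y * (F.Γ cov k i j y * b j y) := by
    intro k j
    rw [F.Γ_symm ht hy j i k]; ring
  simp only [this]
  ring

/-- In the trivialization at `y` the extension is constant. -/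
theorem contMDiffOn_fiber_extend {y : X} (v : TangentSpace (𝓡 n) y) :
    ContMDiffOn (𝓡 n) (𝓡 n).tangent ∞ (fun z => (⟨z, FiberBundle.extend
      (EuclideanSpace ℝ (Fin n)) v z⟩ : TangentBundle (𝓡 n) X))
      (trivializationAt (EuclideanSpace ℝ (Fin n)) (TangentSpace (𝓡 n)) y).baseSet := by
  rw [Trivialization.contMDiffOn_section_baseSet_iff]
  refine contMDiffOn_const (c := (trivializationAt (EuclideanSpace ℝ (Fin n))
    (TangentSpace (𝓡 n)) y ⟨y, v⟩).2) |>.congr ?_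
  intro z hz
  simp [FiberBundle.extend, Trivialization.apply_mk_symm _ hz]

theorem cov_congr {y : X} {σ σ' : (y : X) → TangentSpace (𝓡 n) y} (h : σ =ᶠ[𝓝 y] σ')
    (hσ : MDifferentiableAt (𝓡 n) (𝓡 n).tangent
      (fun y => (⟨y, σ' y⟩ : TangentBundle (𝓡 n) X)) y) : cov σ y = cov σ' y := by
  refine cov.isCovariantDerivativeOnUniv.congr_of_eventuallyEq ?_ hσ Filter.univ_mem h
  refine hσ.congr_of_eventuallyEq ?_
  filter_upwards [h] with z hz
  rw [hz]

/-- Tensoriality of the curvature: `curvature` is defined through one particular choice of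
extensions, and the formula shows that only the values at `y` matter. The derivatives of the
components of the first two extensions are compensated by the bracket term. -/
theorem curvature_eq (hs : cov.ContMDiffCovariantDerivative ∞) (ht : cov.torsion = 0) {y : X}
    (hy : y ∈ F.U) (u v w : TangentSpace (𝓡 n) y) :
    curvature cov y u v w = ∑ i, (∑ k, ∑ l, ∑ j, mvfderiv (𝓡 n) (F.ξ k) y u *
      mvfderiv (𝓡 n) (F.ξ l) y v * mvfderiv (𝓡 n) (F.ξ j) y w * F.Riem cov k l i j y) • F.e i y := by
  set V : Set X := F.U ∩
    (trivializationAt (EuclideanSpace ℝ (Fin n)) (TangentSpace (𝓡 n)) y).baseSet with hVdef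
  have hV : IsOpen V := F.isOpen.inter (Trivialization.open_baseSet _)
  have hyV : y ∈ V := ⟨hy, FiberBundle.mem_baseSet_trivializationAt' y⟩
  have hVU : V ⊆ F.U := Set.inter_subset_left
  set ext : TangentSpace (𝓡 n) y → (z : X) → TangentSpace (𝓡 n) z := fun t =>
    FiberBundle.extend (EuclideanSpace ℝ (Fin n)) t with hext
  have hexts : ∀ t i, ContMDiffOn (𝓡 n) 𝓘(ℝ, ℝ) ∞ (F.comp (ext t) i) V := fun t i =>
    F.comp_smooth hV hVU ((contMDiffOn_fiber_extend t).mono Set.inter_subset_right) i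
  have hd : ∀ {f : X → ℝ}, ContMDiffOn (𝓡 n) 𝓘(ℝ, ℝ) ∞ f V → ∀ z ∈ V,
      MDifferentiableAt (𝓡 n) 𝓘(ℝ, ℝ) f z :=
    fun hf z hz => (hf.contMDiffAt (hV.mem_nhds hz)).mdifferentiableAt (by simp)
  have heq : ∀ t, ∀ z ∈ V, ext t z = F.comb (F.comp (ext t)) z := fun t z hz =>
    (F.comb_comp _ (hVU hz)).symm
  have heq' : ∀ t, ∀ z ∈ V, ext t =ᶠ[𝓝 z] F.comb (F.comp (ext t)) := fun t z hz => by
    filter_upwards [hV.mem_nhds hz] with z' hz' using heq t z' hz'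
  have hself : ∀ t i, F.comp (ext t) i y = mvfderiv (𝓡 n) (F.ξ i) y t := fun t i => by
    simp only [comp, partialD, hext, FiberBundle.extend_apply_self]
  -- first covariant derivatives of the extensions
  have h1 : ∀ t s, ∀ z ∈ V, cov (ext t) z (ext s z)
      = F.comb (fun i z => ∑ l, F.comp (ext s) l z * F.covD cov l (F.comp (ext t)) i z) z := by
    intro t s z hz
    rw [cov_congr (heq' t z hz) (F.comb_mdiff fun i => hd (hexts t i) z hz), heq s z hz]
    exact F.cov_comb_apply cov (hVU hz) (fun i => hd (hexts t i) z hz) fun l => F.comp (ext s) l z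
  have h2s : ∀ t s i, ContMDiffOn (𝓡 n) 𝓘(ℝ, ℝ) ∞
      (fun z => ∑ l, F.comp (ext s) l z * F.covD cov l (F.comp (ext t)) i z) V := fun t s i =>
    contMDiffOn_finsetSum fun l _ => (hexts s l).mul (F.covD_smooth hs hV hVU (hexts t) l i)
  have h2 : ∀ t s r, cov (fun z => cov (ext t) z (ext s z)) y r
      = ∑ i, (∑ k, mvfderiv (𝓡 n) (F.ξ k) y r * F.covD cov k (fun i z => ∑ l, F.comp (ext s) l z *
        F.covD cov l (F.comp (ext t)) i z) i y) • F.e i y := by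
    intro t s r
    have e : (fun z => cov (ext t) z (ext s z)) =ᶠ[𝓝 y]
        F.comb (fun i z => ∑ l, F.comp (ext s) l z * F.covD cov l (F.comp (ext t)) i z) := by
      filter_upwards [hV.mem_nhds hyV] with z hz using h1 t s z hz
    rw [cov_congr e (F.comb_mdiff fun i => hd (h2s t s i) y hyV)]
    conv_lhs => rw [F.expand y hy r]
    exact F.cov_comb_apply cov hy (fun i => hd (h2s t s i) y hyV) _
  -- The product rule separates the derivative of the components of `ext s` from the second
  -- covariant derivative of `ext t`.
  have h3 : ∀ s t, ∀ k i, F.covD cov k (fun i z => ∑ l, F.comp (ext s) l z *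
        F.covD cov l (F.comp (ext t)) i z) i y
      = ∑ l, partialD (F.e k) (F.comp (ext s) l) y * F.covD cov l (F.comp (ext t)) i y
        + ∑ l, F.comp (ext s) l y * F.covD cov k (F.covD cov l (F.comp (ext t))) i y := by
    intro s t k i
    have hDd : ∀ l i, MDifferentiableAt (𝓡 n) 𝓘(ℝ, ℝ) (F.covD cov l (F.comp (ext t)) i) y :=
      fun l i => hd (F.covD_smooth hs hV hVU (hexts t) l i) y hyV
    rw [covD, partialD_sum (F.e k) Finset.univ
      (F := fun l z => F.comp (ext s) l z * F.covD cov l (F.comp (ext t)) i z)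
      fun l _ => (hd (hexts s l) y hyV).mul (hDd l i)]
    have : ∀ l, partialD (F.e k) (fun z => F.comp (ext s) l z * F.covD cov l (F.comp (ext t)) i z) y
        = _ := fun l => partialD_mul (F.e k) (hd (hexts s l) y hyV) (hDd l i)
    simp only [this, Finset.sum_add_distrib, Finset.mul_sum]
    rw [add_assoc]
    congr 1
    rw [Finset.sum_comm, ← Finset.sum_add_distrib]
    refine Finset.sum_congr rfl fun l _ => ?_
    conv_rhs => rw [covD, mul_add, Finset.mul_sum]
    congr 1
    exact Finset.sum_congr rfl fun m _ => by ring
  have h4 : cov (ext w) y (VectorField.mlieBracket (𝓡 n) (ext u) (ext v) y)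
      = ∑ i, (∑ l, (∑ k, (F.comp (ext u) k y * partialD (F.e k) (F.comp (ext v) l) y
        - F.comp (ext v) k y * partialD (F.e k) (F.comp (ext u) l) y)) *
        F.covD cov l (F.comp (ext w)) i y) • F.e i y := by
    rw [cov_congr (heq' w y hyV) (F.comb_mdiff fun i => hd (hexts w i) y hyV),
      Filter.EventuallyEq.mlieBracket_vectorField_eq (heq' u y hyV) (heq' v y hyV),
      F.mlieBracket_comb ht hy (fun i => hd (hexts u i) y hyV) (fun i => hd (hexts v i) y hyV)]
    exact F.cov_comb_apply cov hy (fun i => hd (hexts w i) y hyV) _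
  change cov (fun z => cov (ext w) z (ext v z)) y u - cov (fun z => cov (ext w) z (ext u z)) y v
    - cov (ext w) y (VectorField.mlieBracket (𝓡 n) (ext u) (ext v) y) = _
  rw [h2, h2, h4, ← Finset.sum_sub_distrib, ← Finset.sum_sub_distrib]
  refine Finset.sum_congr rfl fun i _ => ?_
  rw [← sub_smul, ← sub_smul]
  congr 1
  simp only [h3, ← hself]
  have h5 : ∀ k l, ∑ j, F.comp (ext u) k y * F.comp (ext v) l y * F.comp (ext w) j y
      * F.Riem cov k l i j y = F.comp (ext u) k y * F.comp (ext v) l y *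
      (F.covD cov k (F.covD cov l (F.comp (ext w))) i y
        - F.covD cov l (F.covD cov k (F.comp (ext w))) i y) := by
    intro k l
    rw [F.covD_comm hs hV hVU (hexts w) hyV k l i, Finset.mul_sum]
    exact Finset.sum_congr rfl fun j _ => by ring
  -- After expansion, the derivatives of the components of `ext u` and `ext v` match those in the
  -- bracket term, and the commutators of `h5` are left.
  simp only [h5, mul_add, mul_sub, sub_mul, Finset.mul_sum, Finset.sum_add_distrib,
    Finset.sum_sub_distrib, Finset.sum_mul]
  rw [Finset.sum_comm (f := fun l k => F.comp (ext u) k y * partialD (F.e k) (F.comp (ext v) l) y *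
        F.covD cov l (F.comp (ext w)) i y),
    Finset.sum_comm (f := fun l k => F.comp (ext v) k y * partialD (F.e k) (F.comp (ext u) l) y *
        F.covD cov l (F.comp (ext w)) i y),
    Finset.sum_comm (f := fun k l => F.comp (ext v) k y * (F.comp (ext u) l y *
        F.covD cov k (F.covD cov l (F.comp (ext w))) i y))]
  have h6 : ∀ k l, F.comp (ext v) l y * (F.comp (ext u) k y *
      F.covD cov l (F.covD cov k (F.comp (ext w))) i y) = F.comp (ext u) k y * F.comp (ext v) l y *
      F.covD cov l (F.covD cov k (F.comp (ext w))) i y := fun k l => by ring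
  simp only [h6, ← mul_assoc]
  ring

end CoordFrame

end Connection

/-! ### Antisymmetry of the curvature for the metric, in components -/

section Metric

variable {n : ℕ} {X : Type*} [TopologicalSpace X] [ChartedSpace (EuclideanSpace ℝ (Fin n)) X]
  [IsManifold (𝓡 n) ∞ X] {x₀ : X}
  [RiemannianBundle (fun x : X => TangentSpace (𝓡 n) x)]
  [IsContMDiffRiemannianBundle (𝓡 n) ∞ (EuclideanSpace ℝ (Fin n))
      (fun x : X => TangentSpace (𝓡 n) x)]

namespace CoordFrame

variable (F : CoordFrame (n := n) x₀)
  {cov : CovariantDerivative (𝓡 n) (EuclideanSpace ℝ (Fin n))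
      (fun x : X => TangentSpace (𝓡 n) x)}

/-- The components of the metric. -/
def gram (i j : Fin n) (y : X) : ℝ := inner ℝ (F.e i y) (F.e j y)

theorem gram_smooth (i j : Fin n) : ContMDiff (𝓡 n) 𝓘(ℝ, ℝ) ∞ (F.gram i j) :=
  ContMDiff.inner_bundle (F.e_smooth i) (F.e_smooth j)

theorem partialD_gram (hcov : IsLeviCivita cov) {y : X} (hy : y ∈ F.U) (k i j : Fin n) :
    partialD (F.e k) (F.gram i j) y
      = ∑ m, (F.Γ cov k m i y * F.gram m j y + F.gram i m y * F.Γ cov k m j y) := by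
  have : IsContMDiffRiemannianBundle (𝓡 n) 1 (EuclideanSpace ℝ (Fin n))
        (fun x : X => TangentSpace (𝓡 n) x) :=
      IsContMDiffRiemannianBundle.of_le (n := ∞) (by simp)
  have h := hcov.metric.mvfderiv_inner_eq (x := y) (F.e k) (σ := F.e i) (τ := F.e j)
    ((F.e_smooth i).mdifferentiableAt (by simp)) ((F.e_smooth j).mdifferentiableAt (by simp))
  refine h.trans ?_
  simp only [F.cov_e cov hy, sum_inner, inner_sum, inner_smul_left, inner_smul_right,
    Finset.sum_add_distrib]
  congr 1
  exact Finset.sum_congr rfl fun m _ => mul_comm _ _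

/-- Metric compatibility says `∂_k g = G_kᵀ g + g G_k`. Differentiating once more and
antisymmetrizing in the two directions kills the second derivatives of `g`, and what remains is `Rᵀ
g + g R = 0`. -/
theorem Riem_gram (hcov : IsLeviCivita cov) {y : X} (hy : y ∈ F.U) (k l : Fin n) :
    (Matrix.of fun i j => F.Riem cov k l i j y).transpose * Matrix.of (fun i j => F.gram i j y)
      = - (Matrix.of (fun i j => F.gram i j y) * Matrix.of fun i j => F.Riem cov k l i j y) := by
  have hs := hcov.smooth
  have hd : ∀ {f : X → ℝ}, ContMDiffOn (𝓡 n) 𝓘(ℝ, ℝ) ∞ f F.U →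
      MDifferentiableAt (𝓡 n) 𝓘(ℝ, ℝ) f y :=
    fun hf => (hf.contMDiffAt (F.isOpen.mem_nhds hy)).mdifferentiableAt (by simp)
  have hΓ : ∀ l i j, MDifferentiableAt (𝓡 n) 𝓘(ℝ, ℝ) (F.Γ cov l i j) y :=
    fun l i j => hd (F.Γ_smooth hs l i j)
  have hg : ∀ i j, MDifferentiableAt (𝓡 n) 𝓘(ℝ, ℝ) (F.gram i j) y :=
    fun i j => hd (F.gram_smooth i j).contMDiffOn
  set g : Matrix (Fin n) (Fin n) ℝ := Matrix.of fun i j => F.gram i j y with hgdef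
  set G : Fin n → Matrix (Fin n) (Fin n) ℝ := fun k => Matrix.of fun i j => F.Γ cov k i j y with hG
  set dG : Fin n → Fin n → Matrix (Fin n) (Fin n) ℝ := fun k l =>
    Matrix.of fun i j => partialD (F.e k) (F.Γ cov l i j) y with hdG
  have hR : ∀ k l, (Matrix.of fun i j => F.Riem cov k l i j y)
      = dG k l - dG l k + (G k * G l - G l * G k) := by
    intro k l; ext i j
    simp [Riem, hG, hdG, Matrix.mul_apply]
  have h1 : ∀ k, Matrix.of (fun i j => partialD (F.e k) (F.gram i j) y)
      = (G k).transpose * g + g * G k := by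
    intro k; ext i j
    simp [F.partialD_gram hcov hy, hG, hgdef, Matrix.mul_apply, Finset.sum_add_distrib]
  have h2 : ∀ l k, Matrix.of (fun i j => partialD (F.e l) (partialD (F.e k) (F.gram i j)) y)
      = (dG l k).transpose * g + (G k).transpose * ((G l).transpose * g + g * G l)
        + ((G l).transpose * g + g * G l) * G k + g * dG l k := by
    intro l k
    rw [← h1 l]
    ext i j
    have e : partialD (F.e k) (F.gram i j) =ᶠ[𝓝 y] fun z =>
        ∑ m, (F.Γ cov k m i z * F.gram m j z + F.gram i m z * F.Γ cov k m j z) := by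
      filter_upwards [F.isOpen.mem_nhds hy] with z hz using F.partialD_gram hcov hz k i j
    have e2 : ∀ m, partialD (F.e l) (fun z => F.Γ cov k m i z * F.gram m j z
        + F.gram i m z * F.Γ cov k m j z) y = _ := fun m =>
      (partialD_add (F.e l) ((hΓ k m i).mul (hg m j)) ((hg i m).mul (hΓ k m j))).trans
        (congrArg₂ (· + ·) (partialD_mul (F.e l) (hΓ k m i) (hg m j))
          (partialD_mul (F.e l) (hg i m) (hΓ k m j)))
    simp only [Matrix.of_apply]
    rw [partialD_congr e, partialD_sum (F.e l) Finset.univ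
      (F := fun m z => F.Γ cov k m i z * F.gram m j z + F.gram i m z * F.Γ cov k m j z)
      fun m _ => ((hΓ k m i).mul (hg m j)).add ((hg i m).mul (hΓ k m j))]
    simp only [e2, hG, hdG, hgdef, Matrix.add_apply, Matrix.mul_apply, Matrix.of_apply,
      Matrix.transpose_apply, Finset.sum_add_distrib]
    ring
  have h3 : Matrix.of (fun i j => partialD (F.e l) (partialD (F.e k) (F.gram i j)) y)
      = Matrix.of (fun i j => partialD (F.e k) (partialD (F.e l) (F.gram i j)) y) := by
    ext i j
    exact F.hess F.U _ F.isOpen subset_rfl (F.gram_smooth i j).contMDiffOn l k y hy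
  rw [h2, h2] at h3
  rw [hR, eq_neg_iff_add_eq_zero, ← sub_eq_zero.2 h3.symm]
  simp only [Matrix.transpose_add, Matrix.transpose_sub, Matrix.transpose_mul]
  noncomm_ring

-- A vector in the kernel of the Gram matrix gives a combination of the frame of norm zero, and the
-- frame is linearly independent.
omit [IsContMDiffRiemannianBundle (𝓡 n) ∞ (EuclideanSpace ℝ (Fin n))
      (fun x : X => TangentSpace (𝓡 n) x)] in
theorem gram_det_ne_zero {y : X} (hy : y ∈ F.U) :
    (Matrix.of (fun i j => F.gram i j y)).det ≠ 0 := by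
  intro h0
  obtain ⟨c, hc, hc0⟩ := Matrix.exists_mulVec_eq_zero_iff.2 h0
  apply hc
  have h1 : inner ℝ (∑ i, c i • F.e i y) (∑ i, c i • F.e i y) = (0 : ℝ) := by
    rw [sum_inner]
    refine Finset.sum_eq_zero fun i _ => ?_
    have := congrFun hc0 i
    rw [inner_smul_left, inner_sum]
    simp only [inner_smul_right]
    simp only [Matrix.mulVec, dotProduct, Matrix.of_apply, gram, Pi.zero_apply] at this
    simp only [mul_comm (c _), this, mul_zero]
  have h2 : ∑ i, c i • F.e i y = 0 := inner_self_eq_zero.1 h1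
  funext i
  rw [← F.comp_add_eq hy c i, h2, map_zero]
  rfl

end CoordFrame

end Metric

/-! ### The grading involution of the exterior algebra -/

section GradedInvolution

variable {V : Type*} [AddCommGroup V] [Module ℂ V]

/-- Odd elements anticommute, even elements commute. -/
theorem ι_mul_eq (a : V) (z : ExteriorAlgebra ℂ V) :
    ExteriorAlgebra.ι ℂ a * z = degScale V (-1) z * ExteriorAlgebra.ι ℂ a := by
  induction z using ExteriorAlgebra.induction with
  | algebraMap r => rw [AlgHom.commutes]; exact (Algebra.commutes r _).symm
  | ι b =>
    rw [degScale, ExteriorAlgebra.map_apply_ι, ι_mul_ι_anticomm]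
    simp
  | mul x y hx hy => rw [← mul_assoc, hx, mul_assoc, hy, ← mul_assoc, map_mul]
  | add x y hx hy => rw [mul_add, hx, hy, map_add, add_mul]

theorem degScale_ι (c : ℂ) (a : V) :
    degScale V c (ExteriorAlgebra.ι ℂ a) = c • ExteriorAlgebra.ι ℂ a := by
  rw [degScale, ExteriorAlgebra.map_apply_ι]; simp

/-- Elements fixed by the involution are central, which lets traces of even matrices be permuted
even against odd entries. -/
theorem commute_of_degScale_neg_one {z : ExteriorAlgebra ℂ V} (hz : degScale V (-1) z = z)
    (w : ExteriorAlgebra ℂ V) : w * z = z * w := by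
  induction w using ExteriorAlgebra.induction with
  | algebraMap r => exact Algebra.commutes r _
  | ι b => rw [ι_mul_eq, hz]
  | mul x y hx hy => rw [mul_assoc, hy, ← mul_assoc, hx, mul_assoc]
  | add x y hx hy => rw [add_mul, hx, hy, mul_add]

end GradedInvolution

/-! ### Exterior derivatives of local expressions and the graded Leibniz rule -/

section Calculus

variable {n : ℕ} {X : Type*} [TopologicalSpace X] [ChartedSpace (EuclideanSpace ℝ (Fin n)) X]

/-- Near `x₀`, the form `w` is smooth with exterior derivative `v`. -/
def HasExtDerivAt (w v : Form n X) (x₀ : X) : Prop :=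
  ∃ U : Set X, IsOpen U ∧ x₀ ∈ U ∧ ∃ ts : List (FormTerm X),
    (∀ t ∈ ts, t.SmoothOn n U) ∧
    ∀ y ∈ U, w y = (ts.map fun t => t.eval n y).sum ∧ v y = (ts.map fun t => t.evalD n y).sum

theorem FormTerm.SmoothOn.mono {t : FormTerm X} {U V : Set X} (h : t.SmoothOn n U) (hV : V ⊆ U) :
    t.SmoothOn n V := ⟨h.1.mono hV, fun g hg => (h.2 g hg).mono hV⟩

/-- The graded involution on forms. -/
def formInv : Form n X →+* Form n X :=
  RingHom.pi fun x => (degScale (CoT n x) (-1) : _ →+* _).comp (Pi.evalRingHom _ x)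

theorem formInv_apply (w : Form n X) (x : X) : formInv w x = degScale (CoT n x) (-1) (w x) := rfl

namespace HasExtDerivAt

variable {w v w' v' : Form n X} {x₀ : X}

theorem congr (h : HasExtDerivAt w v x₀) {V : Set X} (hV : IsOpen V) (hx : x₀ ∈ V)
    (hw : ∀ y ∈ V, w' y = w y) (hv : ∀ y ∈ V, v' y = v y) : HasExtDerivAt w' v' x₀ := by
  obtain ⟨U, hU, hx', ts, hs, he⟩ := h
  refine ⟨U ∩ V, hU.inter hV, ⟨hx', hx⟩, ts, fun t ht => (hs t ht).mono Set.inter_subset_left,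
    fun y hy => ?_⟩
  rw [hw y hy.2, hv y hy.2]
  exact he y hy.1

theorem zero : HasExtDerivAt (0 : Form n X) 0 x₀ :=
  ⟨Set.univ, isOpen_univ, Set.mem_univ x₀, [], by simp, by simp⟩

theorem add (h : HasExtDerivAt w v x₀) (h' : HasExtDerivAt w' v' x₀) :
    HasExtDerivAt (w + w') (v + v') x₀ := by
  obtain ⟨U, hU, hx, ts, hs, he⟩ := h
  obtain ⟨U', hU', hx', ts', hs', he'⟩ := h'
  refine ⟨U ∩ U', hU.inter hU', ⟨hx, hx'⟩, ts ++ ts', fun t ht => ?_, fun y hy => ?_⟩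
  · rcases List.mem_append.1 ht with ht | ht
    · exact (hs t ht).mono Set.inter_subset_left
    · exact (hs' t ht).mono Set.inter_subset_right
  · simp [he y hy.1, he' y hy.2]

theorem sum {ι : Type*} (s : Finset ι) {w v : ι → Form n X}
    (h : ∀ i ∈ s, HasExtDerivAt (w i) (v i) x₀) :
    HasExtDerivAt (∑ i ∈ s, w i) (∑ i ∈ s, v i) x₀ := by
  classical
  induction s using Finset.induction_on with
  | empty => simpa using zero
  | insert a s ha ih =>
    simp only [Finset.sum_insert ha]
    exact (h a (Finset.mem_insert_self _ _)).add (ih fun i hi => h i (Finset.mem_insert_of_mem hi))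

end HasExtDerivAt

theorem dAt_mul {f g : X → ℂ} {y : X} (hf : MDifferentiableAt (𝓡 n) 𝓘(ℝ, ℂ) f y)
    (hg : MDifferentiableAt (𝓡 n) 𝓘(ℝ, ℂ) g y) :
    dAt n (fun x => f x * g x) y = f y • dAt n g y + g y • dAt n f y := by
  have h := (hf.hasMFDerivAt.mul hg.hasMFDerivAt).mfderiv
  unfold dAt
  rw [← map_smul, ← map_smul, ← map_add]
  congr 1

/-- The product of two terms. -/
def FormTerm.mul (t t' : FormTerm X) : FormTerm X :=
  ⟨fun x => t.coeff x * t'.coeff x, t.diffs ++ t'.diffs⟩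

theorem FormTerm.SmoothOn.mul {t t' : FormTerm X} {U : Set X} (h : t.SmoothOn n U)
    (h' : t'.SmoothOn n U) : (t.mul t').SmoothOn n U :=
  ⟨(contDiff_mul (𝕜 := ℝ) (𝔸 := ℂ)).contMDiff.comp_contMDiffOn (h.1.prodMk_space h'.1), fun g hg => (List.mem_append.1 hg).elim (h.2 g) (h'.2 g)⟩

theorem FormTerm.eval_mul (t t' : FormTerm X) (y : X) :
    (t.mul t').eval n y = t.eval n y * t'.eval n y := by
  simp only [FormTerm.eval, FormTerm.mul, List.map_append, List.prod_append]
  rw [smul_mul_smul_comm]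

/-- The sign in the second summand comes from moving the differential of the second coefficient past
the differentials of the first term. -/
theorem FormTerm.evalD_mul {t t' : FormTerm X} {U : Set X} (hU : IsOpen U) (h : t.SmoothOn n U)
    (h' : t'.SmoothOn n U) {y : X} (hy : y ∈ U) :
    (t.mul t').evalD n y
      = t.evalD n y * t'.eval n y + degScale (CoT n y) (-1) (t.eval n y) * t'.evalD n y := by
  have hd : ∀ {f : X → ℂ}, ContMDiffOn (𝓡 n) 𝓘(ℝ, ℂ) ∞ f U → MDifferentiableAt (𝓡 n) 𝓘(ℝ, ℂ) f y :=
    fun hf => (hf.contMDiffAt (hU.mem_nhds hy)).mdifferentiableAt (by simp)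
  have e := dAt_mul (hd h.1) (hd h'.1)
  simp only [FormTerm.evalD, FormTerm.mul, FormTerm.eval, List.map_append, List.prod_append]
  rw [e]
  have key := ι_mul_eq (mvfderiv (𝓡 n) t'.coeff y) ((t.diffs.map fun g => dAt n g y).prod)
  simp only [add_mul, smul_mul_assoc, map_smul, mul_smul_comm]
  rw [← mul_assoc, ← mul_assoc, add_comm]
  congr 2
  exact (congrArg (· * _) key).trans (mul_assoc _ _ _)

theorem list_sum_mul_sum {R ι : Type*} [Ring R] (l l' : List ι) (f g : ι → R) :
    (l.map f).sum * (l'.map g).sum = (l.flatMap fun t => l'.map fun t' => f t * g t').sum := by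
  induction l with
  | nil => simp
  | cons a l ih => simp [add_mul, ih, List.sum_map_mul_left]

/-- The exterior derivative is a relation witnessed by lists of terms, so it suffices to exhibit the
list of all products; the derivative need not be well defined. -/
theorem HasExtDerivAt.mul {w v w' v' : Form n X} {x₀ : X}
    (h : HasExtDerivAt w v x₀) (h' : HasExtDerivAt w' v' x₀) :
    HasExtDerivAt (w * w') (v * w' + formInv w * v') x₀ := by
  obtain ⟨U, hU, hx, ts, hs, he⟩ := h
  obtain ⟨U', hU', hx', ts', hs', he'⟩ := h'
  refine ⟨U ∩ U', hU.inter hU', ⟨hx, hx'⟩, ts.flatMap fun t => ts'.map fun t' => t.mul t', ?_, ?_⟩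
  · intro t ht
    obtain ⟨a, ha, ht⟩ := List.mem_flatMap.1 ht
    obtain ⟨b, hb, rfl⟩ := List.mem_map.1 ht
    exact ((hs a ha).mono Set.inter_subset_left).mul ((hs' b hb).mono Set.inter_subset_right)
  · intro y hy
    constructor
    · rw [Pi.mul_apply, (he y hy.1).1, (he' y hy.2).1, list_sum_mul_sum, List.map_flatMap]
      simp only [List.map_map]
      congr 1
      refine List.flatMap_congr fun t _ => ?_
      refine List.map_congr_left fun t' _ => ?_
      exact (FormTerm.eval_mul t t' y).symm
    · rw [Pi.add_apply, Pi.mul_apply, Pi.mul_apply, formInv_apply, (he y hy.1).1, (he' y hy.2).1,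
        (he y hy.1).2, (he' y hy.2).2, map_list_sum, List.map_map, list_sum_mul_sum,
        list_sum_mul_sum, List.map_flatMap]
      have hl : ∀ l : List (FormTerm X), (∀ t ∈ l, t.SmoothOn n (U ∩ U')) → ∀ l' : List (FormTerm X),
          (∀ t ∈ l', t.SmoothOn n (U ∩ U')) →
          (l.flatMap fun t => l'.map fun t' => t.evalD n y * t'.eval n y).sum
          + (l.flatMap fun t => l'.map fun t' => ((degScale (CoT n y) (-1)) ∘
            fun t : FormTerm X => t.eval n y) t * t'.evalD n y).sum
          = (l.flatMap fun t => (l'.map fun t' => t.mul t').map fun t => t.evalD n y).sum := by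
        intro l hl l' hl'
        induction l with
        | nil => simp
        | cons a l ih =>
          have e : ((l'.map fun t' => a.mul t').map fun t => t.evalD n y).sum
              = (l'.map fun t' => a.evalD n y * t'.eval n y).sum
              + (l'.map fun t' => degScale (CoT n y) (-1) (a.eval n y) * t'.evalD n y).sum := by
            rw [List.map_map, ← List.sum_map_add]
            congr 1
            refine List.map_congr_left fun t' ht' => ?_
            exact FormTerm.evalD_mul (hU.inter hU') (hl a (by simp)) (hl' t' ht') hy
          simp only [List.flatMap_cons, List.sum_append]
          rw [e, ← ih fun t ht => hl t (by simp [ht])]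
          simp only [Function.comp_apply]
          abel
      exact hl ts (fun t ht => (hs t ht).mono Set.inter_subset_left) ts'
        fun t ht => (hs' t ht).mono Set.inter_subset_right

theorem HasExtDerivAt.coeff {f : X → ℂ} {U : Set X} (hU : IsOpen U)
    (hf : ContMDiffOn (𝓡 n) 𝓘(ℝ, ℂ) ∞ f U) {x₀ : X} (hx : x₀ ∈ U) :
    HasExtDerivAt (fun y => algebraMap ℂ (ExteriorAlgebra ℂ (CoT n y)) (f y)) (dAt n f) x₀ :=
  ⟨U, hU, hx, [⟨f, []⟩], by simpa [FormTerm.SmoothOn] using hf, fun y _ => by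
    simp [FormTerm.eval, FormTerm.evalD, Algebra.algebraMap_eq_smul_one]⟩

/-- Written as `1 · df`, the form has derivative `d1 · df = 0`. -/
theorem HasExtDerivAt.differential {f : X → ℂ} {U : Set X} (hU : IsOpen U)
    (hf : ContMDiffOn (𝓡 n) 𝓘(ℝ, ℂ) ∞ f U) {x₀ : X} (hx : x₀ ∈ U) :
    HasExtDerivAt (dAt n f) 0 x₀ := by
  refine ⟨U, hU, hx, [⟨fun _ => 1, [f]⟩], by simpa [FormTerm.SmoothOn] using ⟨contMDiffOn_const, hf⟩, fun y _ => ?_⟩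
  have h1 : dAt n (fun _ : X => (1 : ℂ)) y = 0 := by
    unfold dAt; rw [mvfderiv_const, map_zero]
  simp [FormTerm.eval, FormTerm.evalD, h1]

end Calculus

section EvenElements

variable {V : Type*} [AddCommGroup V] [Module ℂ V]

theorem degScale_neg_one_of_mem {z : ExteriorAlgebra ℂ V} (hz : z ∈ evenPart V) :
    degScale V (-1) z = z := by
  refine Algebra.adjoin_induction ?_ ?_ ?_ ?_ hz
  · rintro _ ⟨a, b, rfl⟩
    rw [map_mul, degScale_ι, degScale_ι]
    simp
  · intro r; exact AlgHom.commutes _ r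
  · intro x y _ _ hx hy; rw [map_add, hx, hy]
  · intro x y _ _ hx hy; rw [map_mul, hx, hy]

end EvenElements

/-! ### Matrices of forms and closedness of traces of powers -/

section MatrixForms

variable {n : ℕ} {X : Type*} [TopologicalSpace X] [ChartedSpace (EuclideanSpace ℝ (Fin n)) X]
  {x₀ : X}

/-- Entrywise exterior derivative of a matrix of forms. -/
def MatHasExtDerivAt (M D : Matrix (Fin n) (Fin n) (Form n X)) (x₀ : X) : Prop :=
  ∀ i j, HasExtDerivAt (M i j) (D i j) x₀

theorem MatHasExtDerivAt.mul {M D M' D' : Matrix (Fin n) (Fin n) (Form n X)}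
    (h : MatHasExtDerivAt M D x₀) (h' : MatHasExtDerivAt M' D' x₀) :
    MatHasExtDerivAt (M * M') (D * M' + M.map formInv * D') x₀ := by
  intro i j
  have := HasExtDerivAt.sum Finset.univ (fun k _ => (h i k).mul (h' k j))
  rw [Matrix.add_apply, Matrix.mul_apply, Matrix.mul_apply, Matrix.mul_apply,
    ← Finset.sum_add_distrib]
  exact this

theorem MatHasExtDerivAt.add {M D M' D' : Matrix (Fin n) (Fin n) (Form n X)}
    (h : MatHasExtDerivAt M D x₀) (h' : MatHasExtDerivAt M' D' x₀) :
    MatHasExtDerivAt (M + M') (D + D') x₀ := fun i j => (h i j).add (h' i j)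

/-- The Bianchi identity for powers: if `d W = W θ - θ W` with `W` even, the same holds for all
powers of `W`. -/
theorem MatHasExtDerivAt.pow {W θ : Matrix (Fin n) (Fin n) (Form n X)}
    (h : MatHasExtDerivAt W (W * θ - θ * W) x₀) (hW : W.map formInv = W) (m : ℕ) :
    MatHasExtDerivAt (W ^ m) (W ^ m * θ - θ * W ^ m) x₀ := by
  induction m with
  | zero =>
    intro i j
    have e : (W ^ 0 * θ - θ * W ^ 0) i j = 0 := by simp
    rw [e, pow_zero, Matrix.one_apply]
    split_ifs
    · refine (HasExtDerivAt.coeff (n := n) (f := fun _ => 1) isOpen_univ contMDiffOn_const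
        (Set.mem_univ x₀)).congr isOpen_univ (Set.mem_univ x₀) (fun y _ => ?_) (fun y _ => ?_)
      · simp
      · unfold dAt; rw [mvfderiv_const, map_zero]; rfl
    · exact HasExtDerivAt.zero
  | succ m ih =>
    have hm : (W ^ m).map formInv = W ^ m := by
      have : (W ^ m).map formInv = (formInv.mapMatrix W) ^ m := by
        rw [← map_pow]; rfl
      rw [this]; exact congrArg (· ^ m) hW
    have := ih.mul h
    rw [hm] at this
    -- The middle terms `W^m θ W` cancel.
    have e : (W ^ m * θ - θ * W ^ m) * W + W ^ m * (W * θ - θ * W)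
        = W ^ (m + 1) * θ - θ * W ^ (m + 1) := by
      rw [pow_succ]; noncomm_ring
    rwa [e, ← pow_succ] at this

/-- The derivative is the trace of the commutator of `W ^ m` and `θ`. It vanishes because the
entries of `W ^ m` are even, hence commute with those of `θ`. -/
theorem MatHasExtDerivAt.trace_pow {W θ : Matrix (Fin n) (Fin n) (Form n X)}
    (h : MatHasExtDerivAt W (W * θ - θ * W) x₀) (hW : W.map formInv = W) (m : ℕ) :
    HasExtDerivAt (W ^ m).trace 0 x₀ := by
  have h1 := HasExtDerivAt.sum Finset.univ (fun i _ => h.pow hW m i i)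
  have hm : ∀ i j, formInv ((W ^ m) i j) = (W ^ m) i j := by
    have : (W ^ m).map formInv = (formInv.mapMatrix W) ^ m := by
      rw [← map_pow]; rfl
    intro i j
    have h2 : (W ^ m).map formInv = W ^ m := by rw [this]; exact congrArg (· ^ m) hW
    exact congrFun (congrFun h2 i) j
  have e : ∑ i, (W ^ m * θ - θ * W ^ m) i i = 0 := by
    change (W ^ m * θ - θ * W ^ m).trace = 0
    rw [Matrix.trace_sub, sub_eq_zero]
    simp only [Matrix.trace, Matrix.diag, Matrix.mul_apply]
    rw [Finset.sum_comm]
    refine Finset.sum_congr rfl fun i _ => Finset.sum_congr rfl fun j _ => ?_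
    funext y
    exact (commute_of_degScale_neg_one (congrFun (hm j i) y) _).symm
  rw [e] at h1
  exact h1

end MatrixForms

/-! ### Connection and curvature matrices in a frame; the Bianchi identity -/

section FrameForms

variable {n : ℕ} {X : Type*} [TopologicalSpace X] [ChartedSpace (EuclideanSpace ℝ (Fin n)) X]
  [IsManifold (𝓡 n) ∞ X] {x₀ : X}

/-- The differential of a real function as a complex form. -/
def dReal (f : X → ℝ) : Form n X := fun y =>
  ExteriorAlgebra.ι ℂ (Complex.ofRealCLM.comp (mvfderiv (𝓡 n) f y) : CoT n y)

omit [IsManifold (𝓡 n) ∞ X] in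
theorem dReal_eq {f : X → ℝ} {y : X} (hf : MDifferentiableAt (𝓡 n) 𝓘(ℝ, ℝ) f y) :
    dReal (n := n) f y = dAt n (fun z => (f z : ℂ)) y := by
  have hL : HasMFDerivAt 𝓘(ℝ, ℝ) 𝓘(ℝ, ℂ) Complex.ofRealCLM (f y) Complex.ofRealCLM :=
    (ContinuousLinearMap.hasFDerivAt Complex.ofRealCLM).hasMFDerivAt
  have h := (hL.comp y hf.hasMFDerivAt).mfderiv
  unfold dReal dAt
  congr 1
  exact h.symm

omit [IsManifold (𝓡 n) ∞ X] in
theorem contMDiffOn_ofReal {f : X → ℝ} {U : Set X} (hf : ContMDiffOn (𝓡 n) 𝓘(ℝ, ℝ) ∞ f U) :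
    ContMDiffOn (𝓡 n) 𝓘(ℝ, ℂ) ∞ (fun z => (f z : ℂ)) U :=
  Complex.ofRealCLM.contMDiff.comp_contMDiffOn hf

namespace CoordFrame

variable (F : CoordFrame (n := n) x₀)

theorem dReal_expand (f : X → ℝ) {y : X} (hy : y ∈ F.U) :
    dReal (n := n) f y = ∑ k, ((partialD (F.e k) f y : ℝ) : ℂ) • dReal (n := n) (F.ξ k) y := by
  unfold dReal
  simp only [← map_smul, ← map_sum]
  congr 1
  ext v
  have : mvfderiv (𝓡 n) f y v = ∑ k, mvfderiv (𝓡 n) (F.ξ k) y v * partialD (F.e k) f y := by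
    conv_lhs => rw [F.expand y hy v]
    rw [map_sum]
    simp only [map_smul]
    rfl
  simp only [ContinuousLinearMap.comp_apply, this, sum_apply, smul_apply]
  simp [mul_comm]

variable (cov : CovariantDerivative (𝓡 n) (EuclideanSpace ℝ (Fin n))
      (fun x : X => TangentSpace (𝓡 n) x))

/-- The complexification of a real function, as a form of degree zero. -/
def cform (f : X → ℝ) : Form n X := fun y => algebraMap ℂ (ExteriorAlgebra ℂ (CoT n y)) (f y : ℂ)

/-- The connection matrix. -/
def conn : Matrix (Fin n) (Fin n) (Form n X) :=
  Matrix.of fun i j => ∑ l, cform (F.Γ cov l i j) * dReal (F.ξ l)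

/-- The exterior derivative of the connection matrix. -/
def dconn : Matrix (Fin n) (Fin n) (Form n X) :=
  Matrix.of fun i j => ∑ l, dReal (F.Γ cov l i j) * dReal (F.ξ l)

/-- The curvature matrix in the frame. -/
def curv : Matrix (Fin n) (Fin n) (Form n X) := F.dconn cov + F.conn cov * F.conn cov

omit [IsManifold (𝓡 n) ∞ X] in
theorem formInv_dReal (f : X → ℝ) : formInv (dReal (n := n) f) = -dReal f := by
  funext y
  rw [formInv_apply, dReal, degScale_ι]
  simp [dReal]

omit [IsManifold (𝓡 n) ∞ X] in
theorem formInv_cform (f : X → ℝ) : formInv (cform (n := n) f) = cform f := by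
  funext y
  exact AlgHom.commutes _ _

theorem formInv_conn : (F.conn cov).map formInv = -F.conn cov := by
  ext i j : 2
  simp only [Matrix.map_apply, conn, Matrix.of_apply, map_sum, map_mul, formInv_dReal,
    formInv_cform, Matrix.neg_apply, mul_neg, Finset.sum_neg_distrib]

theorem formInv_dconn : (F.dconn cov).map formInv = F.dconn cov := by
  ext i j : 2
  simp only [Matrix.map_apply, dconn, Matrix.of_apply, map_sum, map_mul, formInv_dReal, neg_mul_neg]

theorem formInv_curv : (F.curv cov).map formInv = F.curv cov := by
  have : (F.curv cov).map formInv = formInv.mapMatrix (F.dconn cov)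
      + formInv.mapMatrix (F.conn cov) * formInv.mapMatrix (F.conn cov) := by
    rw [← map_mul, ← map_add]; rfl
  rw [this, RingHom.mapMatrix_apply, RingHom.mapMatrix_apply, formInv_conn, formInv_dconn, neg_mul_neg]
  rfl

variable {cov}

theorem hasExtDerivAt_cform {f : X → ℝ} (hf : ContMDiffOn (𝓡 n) 𝓘(ℝ, ℝ) ∞ f F.U) {y : X}
    (hy : y ∈ F.U) : HasExtDerivAt (cform f) (dReal (n := n) f) y :=
  (HasExtDerivAt.coeff F.isOpen (contMDiffOn_ofReal hf) hy).congr F.isOpen hy (fun _ _ => rfl)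
    fun _ hz => dReal_eq ((hf.contMDiffAt (F.isOpen.mem_nhds hz)).mdifferentiableAt (by simp))

theorem hasExtDerivAt_dReal {f : X → ℝ} (hf : ContMDiffOn (𝓡 n) 𝓘(ℝ, ℝ) ∞ f F.U) {y : X}
    (hy : y ∈ F.U) : HasExtDerivAt (dReal (n := n) f) 0 y :=
  (HasExtDerivAt.differential F.isOpen (contMDiffOn_ofReal hf) hy).congr F.isOpen hy
    (fun _ hz => dReal_eq ((hf.contMDiffAt (F.isOpen.mem_nhds hz)).mdifferentiableAt (by simp)))
    fun _ _ => rfl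

theorem hasExtDerivAt_conn (hs : cov.ContMDiffCovariantDerivative ∞) {y : X} (hy : y ∈ F.U) :
    MatHasExtDerivAt (F.conn cov) (F.dconn cov) y := by
  intro i j
  have := HasExtDerivAt.sum Finset.univ fun l (_ : l ∈ Finset.univ) =>
    (F.hasExtDerivAt_cform (F.Γ_smooth hs l i j) hy).mul (F.hasExtDerivAt_dReal (F.ξ_smooth l) hy)
  simpa [conn, dconn] using this

theorem hasExtDerivAt_dconn (hs : cov.ContMDiffCovariantDerivative ∞) {y : X} (hy : y ∈ F.U) :
    MatHasExtDerivAt (F.dconn cov) 0 y := by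
  intro i j
  have := HasExtDerivAt.sum Finset.univ fun l (_ : l ∈ Finset.univ) =>
    (F.hasExtDerivAt_dReal (F.Γ_smooth hs l i j) hy).mul (F.hasExtDerivAt_dReal (F.ξ_smooth l) hy)
  simpa [dconn] using this

/-- The Bianchi identity. -/
theorem bianchi (hs : cov.ContMDiffCovariantDerivative ∞) {y : X} (hy : y ∈ F.U) :
    MatHasExtDerivAt (F.curv cov) (F.curv cov * F.conn cov - F.conn cov * F.curv cov) y := by
  have h := (F.hasExtDerivAt_dconn hs hy).add
    ((F.hasExtDerivAt_conn hs hy).mul (F.hasExtDerivAt_conn hs hy))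
  rw [formInv_conn] at h
  -- With `W = dθ + θ²` one has `dW = dθ θ - θ dθ`, and the cubic terms of `Wθ - θW` cancel.
  have e : (0 : Matrix (Fin n) (Fin n) (Form n X)) + (F.dconn cov * F.conn cov
      + -F.conn cov * F.dconn cov) = F.curv cov * F.conn cov - F.conn cov * F.curv cov := by
    rw [curv]; noncomm_ring
  rwa [e] at h

end CoordFrame

end FrameForms

/-! ### Comparison of the curvature form with the curvature matrix of the frame -/

section CurvatureForm

open scoped Matrix

variable {n : ℕ} {X : Type*} [TopologicalSpace X] [ChartedSpace (EuclideanSpace ℝ (Fin n)) X]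
  [IsManifold (𝓡 n) ∞ X] {x₀ : X}

namespace CoordFrame

variable (F : CoordFrame (n := n) x₀)
  {cov : CovariantDerivative (𝓡 n) (EuclideanSpace ℝ (Fin n))
      (fun x : X => TangentSpace (𝓡 n) x)}

/-- The complexified coordinate differentials. -/
def dξ (k : Fin n) (y : X) : CoT n y := Complex.ofRealCLM.comp (mvfderiv (𝓡 n) (F.ξ k) y)

/-- The product of two coordinate differentials. -/
def dξdξ (k l : Fin n) (y : X) : evenPart (CoT n y) :=
  ⟨ExteriorAlgebra.ι ℂ (F.dξ k y) * ExteriorAlgebra.ι ℂ (F.dξ l y),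
    Algebra.subset_adjoin ⟨_, _, rfl⟩⟩

theorem dξdξ_swap (k l : Fin n) (y : X) : F.dξdξ l k y = -F.dξdξ k l y :=
  Subtype.ext (ι_mul_ι_anticomm _ _ _)

variable (cov) in
/-- The curvature matrix in the frame, with even entries. -/
def evenCurv (y : X) : Matrix (Fin n) (Fin n) (evenPart (CoT n y)) :=
  Matrix.of fun i j => (1 / 2 : ℂ) • ∑ k, ∑ l, (F.Riem cov k l i j y : ℂ) • F.dξdξ k l y

/-- The factor `1/2` undoes the double counting in a sum over ordered pairs of indices. -/
theorem half_antisymm {A : Type*} [AddCommGroup A] [Module ℂ A] (a : Fin n → Fin n → ℂ)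
    (d : Fin n → Fin n → A) (hd : ∀ k l, d l k = -d k l) :
    (1 / 2 : ℂ) • ∑ k, ∑ l, (a k l - a l k) • d k l = ∑ k, ∑ l, a k l • d k l := by
  have h : ∑ k, ∑ l, a l k • d k l = -∑ k, ∑ l, a k l • d k l := by
    rw [Finset.sum_comm]
    simp only [← Finset.sum_neg_distrib]
    refine Finset.sum_congr rfl fun k _ => Finset.sum_congr rfl fun l _ => ?_
    rw [hd, smul_neg]
  simp only [sub_smul, Finset.sum_sub_distrib]
  rw [h, sub_neg_eq_add, ← two_smul ℂ, smul_smul]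
  norm_num

theorem sum_mul_expand {B ι κ : Type*} [Ring B] [Algebra ℂ B] [Fintype ι] [Fintype κ]
    (a b : ι → κ → ℂ) (d : ι → B) : ∑ m, (∑ k, a k m • d k) * (∑ l, b l m • d l)
      = ∑ k, ∑ l, (∑ m, a k m * b l m) • (d k * d l) := by
  simp only [Finset.sum_mul_sum, smul_mul_smul_comm, Finset.sum_smul]
  rw [Finset.sum_comm]
  exact Finset.sum_congr rfl fun k _ => Finset.sum_comm

theorem conn_apply (i j : Fin n) (y : X) : F.conn cov i j y
    = ∑ k, (F.Γ cov k i j y : ℂ) • ExteriorAlgebra.ι ℂ (F.dξ k y) := by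
  rw [conn, Matrix.of_apply, Finset.sum_apply]
  exact Finset.sum_congr rfl fun k _ =>
    (Algebra.smul_def (F.Γ cov k i j y : ℂ) (dReal (n := n) (F.ξ k) y)).symm

theorem dconn_apply (i j : Fin n) {y : X} (hy : y ∈ F.U) : F.dconn cov i j y
    = ∑ k, ∑ l, (partialD (F.e k) (F.Γ cov l i j) y : ℂ) •
      (ExteriorAlgebra.ι ℂ (F.dξ k y) * ExteriorAlgebra.ι ℂ (F.dξ l y)) := by
  rw [dconn, Matrix.of_apply, Finset.sum_apply, Finset.sum_comm]
  refine Finset.sum_congr rfl fun l _ => ?_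
  rw [Pi.mul_apply, F.dReal_expand _ hy, Finset.sum_mul]
  exact Finset.sum_congr rfl fun k _ => smul_mul_assoc _ _ _

theorem curv_apply (i j : Fin n) {y : X} (hy : y ∈ F.U) : F.curv cov i j y
    = ∑ k, ∑ l, ((partialD (F.e k) (F.Γ cov l i j) y : ℂ)
        + ∑ m, (F.Γ cov k i m y : ℂ) * (F.Γ cov l m j y : ℂ)) •
      (ExteriorAlgebra.ι ℂ (F.dξ k y) * ExteriorAlgebra.ι ℂ (F.dξ l y)) := by
  rw [curv, Matrix.add_apply, Pi.add_apply, Matrix.mul_apply, Finset.sum_apply,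
    F.dconn_apply i j hy]
  have h : ∑ m, (F.conn cov i m * F.conn cov m j) y
      = ∑ k, ∑ l, (∑ m, (F.Γ cov k i m y : ℂ) * (F.Γ cov l m j y : ℂ)) •
      (ExteriorAlgebra.ι ℂ (F.dξ k y) * ExteriorAlgebra.ι ℂ (F.dξ l y)) := by
    rw [← sum_mul_expand]
    refine Finset.sum_congr rfl fun m _ => ?_
    rw [Pi.mul_apply, conn_apply, conn_apply]
  rw [h]
  simp only [add_smul, Finset.sum_add_distrib]

/-- Cartan's structure equation: the curvature tensor is the antisymmetrization of the coefficients
of `dθ + θ²`. The even version lives in a commutative ring, where determinants make sense; the other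
is a form that can be differentiated. -/
theorem coe_evenCurv {y : X} (hy : y ∈ F.U) (i j : Fin n) :
    (F.evenCurv cov y i j : ExteriorAlgebra ℂ (CoT n y)) = F.curv cov i j y := by
  have hR : ∀ k l, (F.Riem cov k l i j y : ℂ)
      = ((partialD (F.e k) (F.Γ cov l i j) y : ℂ)
        + ∑ m, (F.Γ cov k i m y : ℂ) * (F.Γ cov l m j y : ℂ))
      - ((partialD (F.e l) (F.Γ cov k i j) y : ℂ)
        + ∑ m, (F.Γ cov l i m y : ℂ) * (F.Γ cov k m j y : ℂ)) := by
    intro k l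
    rw [Riem, Finset.sum_sub_distrib]
    push_cast
    ring
  rw [evenCurv, Matrix.of_apply]
  simp only [hR]
  rw [half_antisymm (fun k l => (partialD (F.e k) (F.Γ cov l i j) y : ℂ)
        + ∑ m, (F.Γ cov k i m y : ℂ) * (F.Γ cov l m j y : ℂ)) (fun k l => F.dξdξ k l y)
    fun k l => F.dξdξ_swap k l y, F.curv_apply i j hy]
  simp only [AddSubmonoidClass.coe_finsetSum, Subalgebra.coe_smul]
  rfl

/-- The matrix expressing the standard basis through the frame. -/
def toFrame (y : X) : Matrix (Fin n) (Fin n) ℝ :=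
  Matrix.of fun i j => mvfderiv (𝓡 n) (F.ξ i) y (tbasis y j)

/-- The matrix expressing the frame through the standard basis. -/
def ofFrame (y : X) : Matrix (Fin n) (Fin n) ℝ := Matrix.of fun i j => tcoord y i (F.e j y)

omit [IsManifold (𝓡 n) ∞ X] in
theorem sum_tcoord {y : X} (v : TangentSpace (𝓡 n) y) : ∑ i, tcoord y i v • tbasis y i = v :=
  (EuclideanSpace.basisFun (Fin n) ℝ).sum_repr (v : EuclideanSpace ℝ (Fin n))

theorem toFrame_mul_ofFrame {y : X} (hy : y ∈ F.U) : F.toFrame y * F.ofFrame y = 1 := by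
  ext i j
  rw [Matrix.mul_apply]
  have h : mvfderiv (𝓡 n) (F.ξ i) y (∑ k, tcoord y k (F.e j y) • tbasis y k)
      = mvfderiv (𝓡 n) (F.ξ i) y (F.e j y) := by rw [sum_tcoord]
  rw [map_sum] at h
  simp only [map_smul] at h
  rw [Matrix.one_apply, ← F.dual i j y hy]
  refine Eq.trans ?_ h
  exact Finset.sum_congr rfl fun k _ => mul_comm _ _

theorem dξ_eq (k : Fin n) (y : X) : F.dξ k y = ∑ m, (F.toFrame y k m : ℂ) • dx y m := by
  ext v
  have h : mvfderiv (𝓡 n) (F.ξ k) y (∑ m, tcoord y m v • tbasis y m)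
      = mvfderiv (𝓡 n) (F.ξ k) y v := by rw [sum_tcoord]
  rw [map_sum] at h
  simp only [map_smul] at h
  rw [sum_apply]
  change ((mvfderiv (𝓡 n) (F.ξ k) y v : ℝ) : ℂ) = ∑ m, (F.toFrame y k m : ℂ) * (tcoord y m v : ℂ)
  rw [← h]
  simp [toFrame, mul_comm]

theorem dξdξ_eq (k l : Fin n) (y : X) : F.dξdξ k l y
    = ∑ p, ∑ q, ((F.toFrame y k p : ℂ) * (F.toFrame y l q : ℂ)) • dxdx y p q := by
  apply Subtype.ext
  simp only [dξdξ, dξ_eq, map_sum, map_smul, AddSubmonoidClass.coe_finsetSum, Subalgebra.coe_smul,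
    dxdx, Finset.sum_mul_sum, smul_mul_smul_comm]

/-- A real matrix with values in the constants. -/
abbrev cmat (y : X) (M : Matrix (Fin n) (Fin n) ℝ) : Matrix (Fin n) (Fin n) (evenPart (CoT n y)) :=
  ((algebraMap ℂ (evenPart (CoT n y))).comp Complex.ofRealHom).mapMatrix M

theorem sum_comm_six {A ι : Type*} [AddCommMonoid A] [Fintype ι]
    (f : ι → ι → ι → ι → ι → ι → A) : ∑ p, ∑ q, ∑ i, ∑ k, ∑ l, ∑ j, f p q i k l j
      = ∑ j, ∑ i, ∑ k, ∑ l, ∑ p, ∑ q, f p q i k l j := by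
  simp only [← Fintype.sum_prod_type']
  exact Fintype.sum_equiv ⟨fun ⟨p, q, i, k, l, j⟩ => ⟨j, i, k, l, p, q⟩,
    fun ⟨j, i, k, l, p, q⟩ => ⟨p, q, i, k, l, j⟩, fun _ => rfl, fun _ => rfl⟩ _ _ fun _ => rfl

theorem sum_conj_expand {A ι : Type*} [CommRing A] [Algebra ℂ A] [Fintype ι]
    (T : ι → ι → ℝ) (R : ι → ι → ι → ι → ℝ) (O : ι → ℝ) (t : ι → ℝ) (d : ι → ι → A) :
    (1 / 2 : ℂ) • ∑ p, ∑ q,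
      ((∑ i, (∑ k, ∑ l, ∑ j, T k p * T l q * t j * R k l i j) * O i : ℝ) : ℂ) • d p q
    = ∑ j, (∑ i, algebraMap ℂ A (O i) * ((1 / 2 : ℂ) • ∑ k, ∑ l, (R k l i j : ℂ) •
        ∑ p, ∑ q, ((T k p : ℂ) * (T l q : ℂ)) • d p q)) * algebraMap ℂ A (t j) := by
  have h : ∀ (c : ℂ) (a : A), a * algebraMap ℂ A c = c • a :=
    fun c a => by rw [mul_comm, Algebra.smul_def]
  simp only [h, ← Algebra.smul_def, Finset.smul_sum, smul_smul, Complex.ofReal_sum,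
    Finset.sum_smul, Finset.sum_mul, Complex.ofReal_mul]
  rw [sum_comm_six]
  refine Finset.sum_congr rfl fun _ _ => Finset.sum_congr rfl fun _ _ => Finset.sum_congr rfl
    fun _ _ => Finset.sum_congr rfl fun _ _ => Finset.sum_congr rfl fun _ _ =>
    Finset.sum_congr rfl fun _ _ => ?_
  congr 1
  ring

/-- Changing the basis conjugates the endomorphism indices, while the change of the two-form indices
is absorbed by rewriting `dξ` through `dx`. -/
theorem curvatureForm_eq (hs : cov.ContMDiffCovariantDerivative ∞) (ht : cov.torsion = 0) {y : X}
    (hy : y ∈ F.U) : curvatureForm cov y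
      = cmat y (F.ofFrame y) * F.evenCurv cov y * cmat y (F.toFrame y) := by
  refine Matrix.ext fun i j => ?_
  have hc : ∀ p q, tcoord y i (curvature cov y (tbasis y p) (tbasis y q) (tbasis y j))
      = ∑ i', (∑ k, ∑ l, ∑ j', F.toFrame y k p * F.toFrame y l q * F.toFrame y j' j *
        F.Riem cov k l i' j' y) * F.ofFrame y i i' := by
    intro p q
    rw [F.curvature_eq hs ht hy, map_sum]
    simp only [map_smul]
    rfl
  simp only [curvatureForm, Matrix.of_apply, hc, Matrix.mul_apply, evenCurv, dξdξ_eq]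
  exact sum_conj_expand (fun k p => F.toFrame y k p) (fun k l i j => F.Riem cov k l i j y)
    (fun i' => F.ofFrame y i i') (fun j' => F.toFrame y j' j) (dxdx y)

omit [IsManifold (𝓡 n) ∞ X] in
theorem cmat_mul (y : X) (M N : Matrix (Fin n) (Fin n) ℝ) : cmat y (M * N) = cmat y M * cmat y N :=
  map_mul _ _ _

theorem cmat_toFrame_mul_ofFrame {y : X} (hy : y ∈ F.U) :
    cmat y (F.toFrame y) * cmat y (F.ofFrame y) = 1 := by
  rw [← cmat_mul, F.toFrame_mul_ofFrame hy]; exact map_one _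

theorem curvatureForm_pow_eq (hs : cov.ContMDiffCovariantDerivative ∞) (ht : cov.torsion = 0)
    {y : X} (hy : y ∈ F.U) (m : ℕ) : curvatureForm cov y ^ m
      = cmat y (F.ofFrame y) * F.evenCurv cov y ^ m * cmat y (F.toFrame y) := by
  have h1 := F.cmat_toFrame_mul_ofFrame hy
  have h2 : cmat y (F.ofFrame y) * cmat y (F.toFrame y) = 1 := mul_eq_one_comm.1 h1
  induction m with
  | zero => rw [pow_zero, pow_zero, mul_one, h2]
  | succ m ih =>
    rw [pow_succ, ih, F.curvatureForm_eq hs ht hy, pow_succ]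
    calc _ = cmat y (F.ofFrame y) * F.evenCurv cov y ^ m
          * (cmat y (F.toFrame y) * cmat y (F.ofFrame y)) * F.evenCurv cov y
          * cmat y (F.toFrame y) := by simp only [mul_assoc]
      _ = _ := by rw [h1, mul_one]; simp only [mul_assoc]

/-- The standard basis of the tangent space comes from a chart chosen point by point, so the base
change matrices need not be smooth. Traces do not see them. -/
theorem trace_curvatureForm_pow (hs : cov.ContMDiffCovariantDerivative ∞) (ht : cov.torsion = 0)
    {y : X} (hy : y ∈ F.U) (m : ℕ) :
    (curvatureForm cov y ^ m).trace = (F.evenCurv cov y ^ m).trace := by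
  rw [F.curvatureForm_pow_eq hs ht hy, Matrix.trace_mul_comm, ← mul_assoc,
    F.cmat_toFrame_mul_ofFrame hy, one_mul]

theorem coe_evenCurv_pow {y : X} (hy : y ∈ F.U) (m : ℕ) (i j : Fin n) :
    ((F.evenCurv cov y ^ m) i j : ExteriorAlgebra ℂ (CoT n y)) = (F.curv cov ^ m) i j y := by
  have h1 := map_pow (evenPart (CoT n y)).val.toRingHom.mapMatrix (F.evenCurv cov y) m
  have h2 := map_pow (Pi.evalRingHom (fun x : X => ExteriorAlgebra ℂ (CoT n x)) y).mapMatrix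
    (F.curv cov) m
  have h3 : (evenPart (CoT n y)).val.toRingHom.mapMatrix (F.evenCurv cov y)
      = (Pi.evalRingHom (fun x : X => ExteriorAlgebra ℂ (CoT n x)) y).mapMatrix (F.curv cov) :=
    Matrix.ext fun i j => F.coe_evenCurv hy i j
  rw [h3, ← h2] at h1
  exact congrFun (congrFun h1 i) j

theorem coe_trace_curvatureForm_pow (hs : cov.ContMDiffCovariantDerivative ∞)
    (ht : cov.torsion = 0) {y : X} (hy : y ∈ F.U) (m : ℕ) :
    ((curvatureForm cov y ^ m).trace : ExteriorAlgebra ℂ (CoT n y)) = (F.curv cov ^ m).trace y := by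
  rw [F.trace_curvatureForm_pow hs ht hy, Matrix.trace, Matrix.trace, Finset.sum_apply,
    AddSubmonoidClass.coe_finsetSum]
  exact Finset.sum_congr rfl fun i _ => F.coe_evenCurv_pow hy m i i

/-- A bilinear form pulls back under a base change, so the witness is `Pᵀ g P`. -/
theorem exists_conj_of_neg_transpose {A : Type*} [CommRing A] {P Q g E : Matrix (Fin n) (Fin n) A}
    (hPQ : P * Q = 1) (hg : IsUnit g.det) (hE : Eᵀ * g = -(g * E)) :
    ∃ S : Matrix (Fin n) (Fin n) A, IsUnit S.det ∧
      (Q * E * P)ᵀ * S = -(S * (Q * E * P)) := by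
  have hP : IsUnit P.det := by
    have := congrArg Matrix.det hPQ
    rw [Matrix.det_mul, Matrix.det_one] at this
    exact IsUnit.of_mul_eq_one _ this
  have hPQ' : Qᵀ * Pᵀ = 1 := by rw [← Matrix.transpose_mul, hPQ, Matrix.transpose_one]
  have hPQ'' : Pᵀ * Qᵀ = 1 := mul_eq_one_comm.1 hPQ'
  refine ⟨Pᵀ * g * P, ?_, ?_⟩
  · rw [Matrix.det_mul, Matrix.det_mul, Matrix.det_transpose]
    exact (hP.mul hg).mul hP
  · calc (Q * E * P)ᵀ * (Pᵀ * g * P) = Pᵀ * Eᵀ * (Qᵀ * Pᵀ) * g * P := by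
          simp only [Matrix.transpose_mul, mul_assoc]
      _ = Pᵀ * (Eᵀ * g) * P := by rw [hPQ', mul_one]; simp only [mul_assoc]
      _ = -(Pᵀ * g * (P * Q) * E * P) := by
          rw [hE, hPQ, mul_one]; simp only [mul_neg, neg_mul, mul_assoc]
      _ = _ := by simp only [mul_assoc]

end CoordFrame

/-- The trace of a power of the curvature form is closed. -/
theorem isExtDeriv_trace_curvatureForm_pow [T2Space X]
    {cov : CovariantDerivative (𝓡 n) (EuclideanSpace ℝ (Fin n))
      (fun x : X => TangentSpace (𝓡 n) x)}
    (hs : cov.ContMDiffCovariantDerivative ∞) (ht : cov.torsion = 0) (m : ℕ) :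
    IsExtDeriv n (fun x : X => ((curvatureForm cov x ^ m).trace : ExteriorAlgebra ℂ (CoT n x))) 0 := by
  intro x
  obtain ⟨F⟩ := exists_coordFrame (n := n) x
  exact ((F.bianchi hs F.mem).trace_pow (F.formInv_curv cov) m).congr F.isOpen F.mem
    (fun y hy => F.coe_trace_curvatureForm_pow hs ht hy m) (fun _ _ => rfl)

end CurvatureForm

/-! ### Antisymmetry of the curvature form -/

section Metric

open scoped Matrix

variable {n : ℕ} {X : Type*} [TopologicalSpace X] [T2Space X]
  [ChartedSpace (EuclideanSpace ℝ (Fin n)) X]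
  [IsManifold (𝓡 n) ∞ X]
  [RiemannianBundle (fun x : X => TangentSpace (𝓡 n) x)]
  [IsContMDiffRiemannianBundle (𝓡 n) ∞ (EuclideanSpace ℝ (Fin n))
      (fun x : X => TangentSpace (𝓡 n) x)]
  {cov : CovariantDerivative (𝓡 n) (EuclideanSpace ℝ (Fin n))
      (fun x : X => TangentSpace (𝓡 n) x)}

-- The two-forms `dξ ∧ dξ` act as commuting scalars, so the identity holds component by component by
-- `Riem_gram`.
omit [T2Space X] in
theorem CoordFrame.evenCurv_gram {x₀ : X} (F : CoordFrame (n := n) x₀) (hcov : IsLeviCivita cov)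
    {y : X} (hy : y ∈ F.U) :
    (F.evenCurv cov y)ᵀ * CoordFrame.cmat y (Matrix.of fun i j => F.gram i j y)
      = -(CoordFrame.cmat y (Matrix.of fun i j => F.gram i j y) * F.evenCurv cov y) := by
  have hE : F.evenCurv cov y = (1 / 2 : ℂ) • ∑ k, ∑ l,
      F.dξdξ k l y • CoordFrame.cmat y (Matrix.of fun i j => F.Riem cov k l i j y) := by
    refine Matrix.ext fun i j => ?_
    simp only [CoordFrame.evenCurv, Matrix.of_apply, Matrix.smul_apply, Matrix.sum_apply]
    congr 1
    refine Finset.sum_congr rfl fun k _ => Finset.sum_congr rfl fun l _ => ?_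
    rw [Algebra.smul_def, mul_comm]; rfl
  rw [hE]
  simp only [Matrix.transpose_smul, Matrix.transpose_sum, Matrix.smul_mul, Matrix.mul_smul,
    Matrix.sum_mul, Matrix.mul_sum, ← smul_neg, ← Finset.sum_neg_distrib]
  congr 1
  refine Finset.sum_congr rfl fun k _ => Finset.sum_congr rfl fun l _ => ?_
  congr 1
  have := congrArg (CoordFrame.cmat y) (F.Riem_gram hcov hy k l)
  rw [CoordFrame.cmat_mul] at this
  refine Eq.trans ?_ (this.trans ?_)
  · rfl
  · rw [← CoordFrame.cmat_mul]; exact map_neg _ _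

/-- The curvature form is antisymmetric for a nondegenerate bilinear form. -/
theorem curvatureForm_antisymm (hcov : IsLeviCivita cov) (x : X) :
    ∃ S : Matrix (Fin n) (Fin n) (evenPart (CoT n x)), IsUnit S.det ∧
      (curvatureForm cov x)ᵀ * S = -(S * curvatureForm cov x) := by
  obtain ⟨F⟩ := exists_coordFrame (n := n) x
  rw [F.curvatureForm_eq hcov.smooth hcov.torsion_eq_zero F.mem]
  refine CoordFrame.exists_conj_of_neg_transpose (F.cmat_toFrame_mul_ofFrame F.mem) ?_
    (F.evenCurv_gram hcov F.mem)
  have := (F.gram_det_ne_zero F.mem).isUnit.map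
    ((algebraMap ℂ (evenPart (CoT n x))).comp Complex.ofRealHom)
  rwa [RingHom.map_det] at this

end Metric

/-! ### Nilpotency of even elements without body -/

section Nilpotency

open scoped Pointwise

variable (V : Type*) [AddCommGroup V] [Module ℂ V]

/-- The body as an algebra map. -/
def bodyHom : evenPart V →ₐ[ℂ] ℂ := ExteriorAlgebra.algebraMapInv.comp (evenPart V).val

/-- The ideal of even elements without body. -/
def soulIdeal : Ideal (evenPart V) := RingHom.ker (bodyHom V)

/-- The products of two odd generators, as even elements. -/
def evenGenerators : Set (evenPart V) :=
  {z | ∃ a b : V, (z : ExteriorAlgebra ℂ V) = ExteriorAlgebra.ι ℂ a * ExteriorAlgebra.ι ℂ b}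

variable {V}

theorem sub_body_mem_span (z : evenPart V) :
    z - algebraMap ℂ (evenPart V) (bodyHom V z) ∈ Ideal.span (evenGenerators V) := by
  obtain ⟨z, hz⟩ := z
  refine Algebra.adjoin_induction (p := fun z hz => (⟨z, hz⟩ : evenPart V)
    - algebraMap ℂ (evenPart V) (bodyHom V ⟨z, hz⟩) ∈ Ideal.span (evenGenerators V)) ?_ ?_ ?_ ?_ hz
  · rintro z ⟨a, b, rfl⟩
    have : bodyHom V ⟨ExteriorAlgebra.ι ℂ a * ExteriorAlgebra.ι ℂ b,
        Algebra.subset_adjoin ⟨a, b, rfl⟩⟩ = 0 := by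
      change ExteriorAlgebra.algebraMapInv (ExteriorAlgebra.ι ℂ a * ExteriorAlgebra.ι ℂ b) = 0
      rw [map_mul]
      simp [ExteriorAlgebra.algebraMapInv]
    rw [this, map_zero, sub_zero]
    exact Ideal.subset_span ⟨a, b, rfl⟩
  · intro r
    have : (⟨algebraMap ℂ _ r, Subalgebra.algebraMap_mem _ r⟩ : evenPart V)
      = algebraMap ℂ (evenPart V) r := rfl
    rw [this, AlgHom.commutes]
    simp
  · intro x y hx hy h1 h2
    have : (⟨x + y, add_mem hx hy⟩ : evenPart V) = ⟨x, hx⟩ + ⟨y, hy⟩ := rfl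
    rw [this, map_add, map_add, add_sub_add_comm]
    exact add_mem h1 h2
  · intro x y hx hy h1 h2
    have : (⟨x * y, mul_mem hx hy⟩ : evenPart V) = ⟨x, hx⟩ * ⟨y, hy⟩ := rfl
    rw [this, map_mul, map_mul]
    have e : ∀ p q a b : evenPart V, p * q - a * b = (p - a) * q + a * (q - b) := by
      intros; ring
    rw [e]
    exact add_mem (Ideal.mul_mem_right _ _ h1) (Ideal.mul_mem_left _ _ h2)

theorem soulIdeal_le_span : soulIdeal V ≤ Ideal.span (evenGenerators V) := by
  intro z hz
  have := sub_body_mem_span z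
  rwa [show bodyHom V z = 0 from hz, map_zero, sub_zero] at this

/-- More vectors than the dimension are linearly dependent, and an alternating map vanishes on them.
-/
theorem range_ι_pow_eq_bot [FiniteDimensional ℂ V] {m : ℕ} (hm : Module.finrank ℂ V < m) :
    LinearMap.range (ExteriorAlgebra.ι ℂ : V →ₗ[ℂ] ExteriorAlgebra ℂ V) ^ m = ⊥ := by
  change ⋀[ℂ]^m V = ⊥
  rw [← ExteriorAlgebra.ιMulti_span_fixedDegree, Submodule.span_eq_bot]
  rintro _ ⟨v, rfl⟩
  apply AlternatingMap.map_linearDependent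
  intro h
  have := h.fintype_card_le_finrank
  rw [Fintype.card_fin] at this
  omega

theorem coe_mem_of_mem_generators_pow (k : ℕ) : ∀ z ∈ evenGenerators V ^ k,
    (z : ExteriorAlgebra ℂ V) ∈
      LinearMap.range (ExteriorAlgebra.ι ℂ : V →ₗ[ℂ] ExteriorAlgebra ℂ V) ^ (2 * k) := by
  induction k with
  | zero =>
    intro z hz
    rw [pow_zero, Set.mem_one] at hz
    rw [hz, mul_zero, pow_zero]
    exact Submodule.one_le.1 le_rfl
  | succ k ih =>
    intro z hz
    rw [pow_succ] at hz
    obtain ⟨x, hx, y, ⟨a, b, hy⟩, rfl⟩ := Set.mem_mul.1 hz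
    rw [mul_add, mul_one, pow_add, pow_two]
    refine Submodule.mul_mem_mul (ih x hx) ?_
    rw [hy]
    exact Submodule.mul_mem_mul ⟨a, rfl⟩ ⟨b, rfl⟩

/-- The ideal is generated by products of two odd elements, so its `m`-th power is generated by
elements of degree `2m`. -/
theorem soulIdeal_pow_eq_bot [FiniteDimensional ℂ V] {m : ℕ} (hm : Module.finrank ℂ V < 2 * m) :
    soulIdeal V ^ m = ⊥ := by
  rw [eq_bot_iff]
  refine (Ideal.pow_right_mono soulIdeal_le_span m).trans ?_
  have h : Ideal.span (evenGenerators V) ^ m = Ideal.span (evenGenerators V ^ m) :=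
    Submodule.span_pow _ _
  rw [h, Ideal.span_le]
  intro z hz
  have := coe_mem_of_mem_generators_pow m z hz
  rw [range_ι_pow_eq_bot hm] at this
  exact Subtype.ext this

theorem exists_soulIdeal_pow_eq_bot [FiniteDimensional ℂ V] : ∃ m, soulIdeal V ^ m = ⊥ :=
  ⟨Module.finrank ℂ V + 1, soulIdeal_pow_eq_bot (by omega)⟩

theorem sub_body_mem (a : evenPart V) :
    a - algebraMap ℂ (evenPart V) (body V a) ∈ soulIdeal V := by
  change bodyHom V _ = 0
  rw [map_sub, AlgHom.commutes]
  exact sub_self _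

end Nilpotency

/-! ### The exponential of even elements -/

section Exponential

variable {V : Type*} [AddCommGroup V] [Module ℂ V]

/-- The truncated exponential series. -/
def expSum {A : Type*} [Ring A] [Algebra ℂ A] (m : ℕ) (a : A) : A :=
  ∑ k ∈ Finset.range m, ((k.factorial : ℂ)⁻¹) • a ^ k

theorem finsum_eq_expSum {A : Type*} [Ring A] [Algebra ℂ A] {m : ℕ} {a : A} (h : a ^ m = 0) :
    ∑ᶠ k : ℕ, ((k.factorial : ℂ)⁻¹) • a ^ k = expSum m a := by
  apply finsum_eq_sum_of_support_subset
  intro k hk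
  by_contra hlt
  apply hk
  have : m ≤ k := by simpa using hlt
  change ((k.factorial : ℂ)⁻¹) • a ^ k = 0
  rw [← Nat.add_sub_cancel' this, pow_add, h, zero_mul, smul_zero]

theorem map_expSum {A B : Type*} [Ring A] [Algebra ℂ A] [Ring B] [Algebra ℂ B] (f : A →ₐ[ℂ] B)
    (m : ℕ) (a : A) : f (expSum m a) = expSum m (f a) := by
  simp [expSum, map_sum, map_smul, map_pow]

theorem expSum_eq_exp {A : Type*} [CommRing A] [Algebra ℂ A] [Algebra ℚ A] {m : ℕ} {a : A}
    (h : a ^ m = 0) : expSum m a = IsNilpotent.exp a := by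
  rw [IsNilpotent.exp_eq_sum h]
  refine Finset.sum_congr rfl fun k _ => ?_
  rw [Algebra.smul_def, Algebra.smul_def]
  congr 1
  have : algebraMap ℚ A = (algebraMap ℂ A).comp (algebraMap ℚ ℂ) := RingHom.ext_rat _ _
  rw [this]
  simp

theorem gexp_eq {a : evenPart V} {m : ℕ} (h : soulIdeal V ^ m = ⊥) : gexp V a
    = Complex.exp (body V a) • expSum m (a - algebraMap ℂ (evenPart V) (body V a)) := by
  rw [gexp, finsum_eq_expSum]
  have := Ideal.pow_mem_pow (sub_body_mem a) m
  rwa [h] at this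

theorem gexp_eq_of_mem {a : evenPart V} {m : ℕ} (h : soulIdeal V ^ m = ⊥) (ha : a ∈ soulIdeal V) :
    gexp V a = expSum m a := by
  have : body V a = 0 := ha
  rw [gexp_eq h, this, map_zero, sub_zero, Complex.exp_zero, one_smul]

theorem gexp_zero [FiniteDimensional ℂ V] : gexp V 0 = 1 := by
  obtain ⟨m, hm⟩ := exists_soulIdeal_pow_eq_bot (V := V)
  -- The exponent `m + 1` guarantees that the truncated sum contains its zeroth term.
  rw [gexp_eq_of_mem (m := m + 1) (by rw [pow_succ, hm, Ideal.bot_mul]) (zero_mem _), expSum,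
    Finset.sum_range_succ']
  simp

/-- Body and soul are additive separately: the body uses the complex exponential law and the soul
the one for commuting nilpotents. -/
theorem gexp_add [FiniteDimensional ℂ V] (a b : evenPart V) :
    gexp V (a + b) = gexp V a * gexp V b := by
  obtain ⟨m, hm⟩ := exists_soulIdeal_pow_eq_bot (V := V)
  let _ : Algebra ℚ (evenPart V) := ((algebraMap ℂ (evenPart V)).comp (algebraMap ℚ ℂ)).toAlgebra
  have hn : ∀ a : evenPart V, (a - algebraMap ℂ (evenPart V) (body V a)) ^ m = 0 := fun a => by
    have := Ideal.pow_mem_pow (sub_body_mem a) m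
    rwa [hm] at this
  rw [gexp_eq hm, gexp_eq hm, gexp_eq hm, expSum_eq_exp (hn _), expSum_eq_exp (hn _),
    expSum_eq_exp (hn _), smul_mul_smul_comm,
    ← IsNilpotent.exp_add_of_commute (Commute.all _ _) ⟨m, hn a⟩ ⟨m, hn b⟩, ← Complex.exp_add]
  have : body V (a + b) = body V a + body V b := map_add (bodyHom V) a b
  rw [this, map_add, add_sub_add_comm]

theorem isUnit_gexp [FiniteDimensional ℂ V] (a : evenPart V) : IsUnit (gexp V a) :=
  IsUnit.of_mul_eq_one (gexp V (-a)) (by rw [← gexp_add, add_neg_cancel, gexp_zero])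

end Exponential

/-! ### Degree scaling on even elements -/

section EvenScale

variable {V : Type*} [AddCommGroup V] [Module ℂ V]

theorem degScale_mem (c : ℂ) {z : ExteriorAlgebra ℂ V} (hz : z ∈ evenPart V) :
    degScale V c z ∈ evenPart V := by
  refine Algebra.adjoin_induction ?_ ?_ ?_ ?_ hz
  · rintro _ ⟨a, b, rfl⟩
    rw [map_mul, degScale_ι, degScale_ι]
    refine Algebra.subset_adjoin ⟨c • a, c • b, ?_⟩
    rw [map_smul, map_smul]
  · intro r; rw [AlgHom.commutes]; exact Subalgebra.algebraMap_mem _ r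
  · intro x y _ _ hx hy; rw [map_add]; exact add_mem hx hy
  · intro x y _ _ hx hy; rw [map_mul]; exact mul_mem hx hy

variable (V) in
/-- The degree scaling of the even part. -/
def evenScale (c : ℂ) : evenPart V →ₐ[ℂ] evenPart V :=
  ((degScale V c).comp (evenPart V).val).codRestrict (evenPart V) fun z => degScale_mem c z.2

theorem coe_evenScale (c : ℂ) (z : evenPart V) :
    (evenScale V c z : ExteriorAlgebra ℂ V) = degScale V c z := rfl

end EvenScale

/-! ### The cotangent space and the degree of the curvature -/

section Cotangent

variable {n : ℕ} {X : Type*} [TopologicalSpace X] [ChartedSpace (EuclideanSpace ℝ (Fin n)) X]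

theorem span_dx (x : X) : Submodule.span ℂ (Set.range (dx x)) = (⊤ : Submodule ℂ (CoT n x)) := by
  rw [eq_top_iff]
  intro f _
  have : f = ∑ i, f (tbasis x i) • dx x i := by
    ext v
    have h : f (∑ m, tcoord x m v • tbasis x m) = f v := by rw [CoordFrame.sum_tcoord]
    rw [← h, map_sum, sum_apply]
    refine Finset.sum_congr rfl fun i _ => ?_
    rw [map_smul, smul_apply]
    change (tcoord x i v : ℝ) • f (tbasis x i) = f (tbasis x i) * ((tcoord x i v : ℝ) : ℂ)
    rw [Complex.real_smul, mul_comm]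
  rw [this]
  exact Submodule.sum_mem _ fun i _ => Submodule.smul_mem _ _ (Submodule.subset_span ⟨i, rfl⟩)

instance finiteDimensional_coT (x : X) : FiniteDimensional ℂ (CoT n x) :=
  ⟨by rw [← span_dx x]; exact Submodule.fg_span (Set.finite_range _)⟩

theorem finrank_coT_le (x : X) : Module.finrank ℂ (CoT n x) ≤ n := by
  have := finrank_range_le_card (R := ℂ) (dx (n := n) x)
  rw [Set.finrank, span_dx, finrank_top, Fintype.card_fin] at this
  exact this

/-- The exponent is generous, since degree `2(n + 1)` is far above `n`; the same `n + 1` also serves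
as length of the exponential sums. -/
theorem soulIdeal_coT_pow (x : X) : soulIdeal (CoT n x) ^ (n + 1) = ⊥ :=
  soulIdeal_pow_eq_bot (by have := finrank_coT_le (n := n) x; omega)

variable [IsManifold (𝓡 n) ∞ X]
  (cov : CovariantDerivative (𝓡 n) (EuclideanSpace ℝ (Fin n))
      (fun x : X => TangentSpace (𝓡 n) x))

omit [IsManifold (𝓡 n) ∞ X] in
theorem dxdx_mem_soulIdeal (x : X) (k l : Fin n) : dxdx x k l ∈ soulIdeal (CoT n x) := by
  change ExteriorAlgebra.algebraMapInv (R := ℂ) (M := CoT n x)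
    (ExteriorAlgebra.ι ℂ (dx x k) * ExteriorAlgebra.ι ℂ (dx x l)) = 0
  rw [map_mul]
  simp [ExteriorAlgebra.algebraMapInv]

theorem curvatureForm_mem_soulIdeal (x : X) (i j : Fin n) :
    curvatureForm cov x i j ∈ soulIdeal (CoT n x) := by
  rw [curvatureForm, Matrix.of_apply]
  exact Submodule.smul_of_tower_mem _ _ (Submodule.sum_mem _ fun k _ => Submodule.sum_mem _
    fun l _ => Submodule.smul_of_tower_mem _ _ (dxdx_mem_soulIdeal x k l))

omit [IsManifold (𝓡 n) ∞ X] in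
theorem evenScale_dxdx (c : ℂ) (x : X) (k l : Fin n) :
    evenScale (CoT n x) c (dxdx x k l) = c ^ 2 • dxdx x k l := by
  apply Subtype.ext
  rw [coe_evenScale]
  change degScale _ c (ExteriorAlgebra.ι ℂ _ * ExteriorAlgebra.ι ℂ _)
    = c ^ 2 • (ExteriorAlgebra.ι ℂ _ * ExteriorAlgebra.ι ℂ _)
  rw [map_mul, degScale_ι, degScale_ι, smul_mul_smul_comm, pow_two]

theorem evenScale_curvatureForm (c : ℂ) (x : X) :
    (evenScale (CoT n x) c).mapMatrix (curvatureForm cov x) = c ^ 2 • curvatureForm cov x := by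
  refine Matrix.ext fun i j => ?_
  simp only [AlgHom.mapMatrix_apply, Matrix.map_apply, Matrix.smul_apply, curvatureForm,
    Matrix.of_apply, map_smul, map_sum, evenScale_dxdx, Finset.smul_sum, smul_smul]
  refine Finset.sum_congr rfl fun k _ => Finset.sum_congr rfl fun l _ => ?_
  congr 1; ring

theorem evenScale_trace_curvatureForm_pow (c : ℂ) (x : X) (m : ℕ) :
    evenScale (CoT n x) c (curvatureForm cov x ^ m).trace
      = c ^ (2 * m) • (curvatureForm cov x ^ m).trace := by
  have h := map_pow (evenScale (CoT n x) c).mapMatrix (curvatureForm cov x) m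
  rw [evenScale_curvatureForm, smul_pow, ← pow_mul] at h
  have := congrArg Matrix.trace h
  rw [Matrix.trace_smul] at this
  rw [← this, Matrix.trace, map_sum]
  rfl

end Cotangent

/-! ### Logarithmic derivatives of formal power series -/

section PowerSeriesODE

open PowerSeries

variable {A : Type*} [CommRing A] [Algebra ℂ A]

/-- Uniqueness for the differential equation `y' = y b` in power series. -/
theorem eq_of_derivative_eq_mul {y w b : A⟦X⟧} (hy : d⁄dX A y = y * b) (hw : d⁄dX A w = w * b)
    (h0 : constantCoeff y = constantCoeff w) : y = w := by
  ext k
  induction k using Nat.strong_induction_on with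
  | _ k ih =>
    cases k with
    | zero => simpa using h0
    | succ k =>
      have h1 := congrArg (coeff k) hy
      have h2 := congrArg (coeff k) hw
      rw [coeff_derivative, coeff_mul] at h1 h2
      have h3 : coeff (k + 1) y * ((k : A) + 1) = coeff (k + 1) w * ((k : A) + 1) := by
        rw [h1, h2]
        refine Finset.sum_congr rfl fun p hp => ?_
        rw [ih p.1 (by have := Finset.HasAntidiagonal.mem_antidiagonal.1 hp; omega)]
      have hu : IsUnit ((k : A) + 1) := by
        have : IsUnit ((k : ℂ) + 1) := (Nat.cast_add_one_ne_zero k).isUnit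
        simpa using this.map (algebraMap ℂ A)
      exact hu.mul_right_cancel h3

omit [Algebra ℂ A] in
theorem eq_of_mul_eq_mul_of_constantCoeff_eq_one {y b b' : A⟦X⟧} (hy : constantCoeff y = 1)
    (h : y * b = y * b') : b = b' := by
  have : IsUnit y := isUnit_iff_constantCoeff.2 (by rw [hy]; exact isUnit_one)
  exact this.mul_left_cancel h

omit [Algebra ℂ A] in
theorem derivative_rescale (a : A) (f : A⟦X⟧) :
    d⁄dX A (rescale a f) = C a * rescale a (d⁄dX A f) := by
  ext k
  rw [coeff_derivative, coeff_rescale, coeff_C_mul, coeff_rescale, coeff_derivative]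
  ring

omit [Algebra ℂ A] in
theorem derivative_map {B : Type*} [CommRing B] (g : A →+* B) (f : A⟦X⟧) :
    d⁄dX B (map g f) = map g (d⁄dX A f) := by
  ext k
  simp [coeff_derivative]

omit [Algebra ℂ A] in
theorem derivative_prod_eq {ι : Type*} (s : Finset ι) (f b : ι → A⟦X⟧)
    (h : ∀ i ∈ s, d⁄dX A (f i) = f i * b i) :
    d⁄dX A (∏ i ∈ s, f i) = (∏ i ∈ s, f i) * ∑ i ∈ s, b i := by
  classical
  induction s using Finset.induction_on with
  | empty => simp
  | insert i s hi ih =>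
    rw [Finset.prod_insert hi, Finset.sum_insert hi, Derivation.leibniz, smul_eq_mul, smul_eq_mul,
      ih fun j hj => h j (Finset.mem_insert_of_mem hj), h i (Finset.mem_insert_self i s)]
    ring

/-- The multiplicative sequence `∏ Q(xᵢ t)` of a power series `Q`. -/
def multSeq {ι : Type*} [Fintype ι] (Q : ℂ⟦X⟧) (x : ι → A) : A⟦X⟧ :=
  ∏ i, rescale (x i) (map (algebraMap ℂ A) Q)

/-- Logarithmic derivatives of products add up, so the coefficients of the logarithmic derivative of
`∏ Q(xᵢ t)` are power sums. Identities between symmetric functions thereby become uniqueness for a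
linear differential equation. -/
theorem derivative_multSeq {ι : Type*} [Fintype ι] {Q ℓ : ℂ⟦X⟧} (h : d⁄dX ℂ Q = Q * ℓ)
    (x : ι → A) : d⁄dX A (multSeq Q x)
      = multSeq Q x * mk fun m => algebraMap ℂ A (coeff m ℓ) * ∑ i, x i ^ (m + 1) := by
  rw [multSeq, derivative_prod_eq Finset.univ _
    fun i => C (x i) * rescale (x i) (map (algebraMap ℂ A) ℓ)]
  · congr 1
    ext m
    rw [map_sum, coeff_mk, Finset.mul_sum]
    refine Finset.sum_congr rfl fun i _ => ?_
    rw [coeff_C_mul, coeff_rescale, coeff_map]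
    ring
  · intro i _
    rw [derivative_rescale, derivative_map, h, map_mul, map_mul]
    ring

-- The chain rule for `f(t²)`.
omit [Algebra ℂ A] in
theorem derivative_expand_two (f : A⟦X⟧) : d⁄dX A (expand 2 two_ne_zero f)
    = expand 2 two_ne_zero (d⁄dX A f) * (2 * X) := by
  ext k
  rw [coeff_derivative]
  cases k with
  | zero =>
    rw [coeff_expand_of_not_dvd _ _ _ (by norm_num)]
    simp
  | succ k =>
    rw [mul_comm 2 X, ← mul_assoc, show (2 : A⟦X⟧) = C 2 from (map_ofNat _ 2).symm, coeff_mul_C,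
      coeff_succ_mul_X]
    rw [coeff_expand, coeff_expand]
    by_cases h2 : 2 ∣ k
    · obtain ⟨j, rfl⟩ := h2
      rw [if_pos (by omega), if_pos (by omega), show (2 * j + 1 + 1) / 2 = j + 1 by omega,
        show 2 * j / 2 = j by omega, coeff_derivative]
      push_cast; ring
    · rw [if_neg (by omega), if_neg h2]; ring

end PowerSeriesODE

/-! ### The derivative and the parity of `det (1 + tW)` -/

section Jacobi

open PowerSeries

variable {A : Type*} [CommRing A] {ι : Type*} [Fintype ι] [DecidableEq ι]

/-- The resolvent `(1 + t W)⁻¹`. -/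
def resolvent (W : Matrix ι ι A) : Matrix ι ι A⟦X⟧ :=
  Matrix.of fun i j => mk fun k => (-1) ^ k * (W ^ k) i j

theorem one_add_smul_mul_resolvent (W : Matrix ι ι A) :
    (1 + (X : A⟦X⟧) • W.map C) * resolvent W = 1 := by
  rw [add_mul, one_mul, Matrix.smul_mul]
  ext i j k
  have h : ∀ k, coeff k ((W.map C * resolvent W) i j) = (-1) ^ k * (W ^ (k + 1)) i j := by
    intro k
    rw [Matrix.mul_apply, map_sum, pow_succ', Matrix.mul_apply, Finset.mul_sum]
    refine Finset.sum_congr rfl fun l _ => ?_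
    rw [Matrix.map_apply, coeff_C_mul, resolvent, Matrix.of_apply, coeff_mk]
    ring
  rw [Matrix.add_apply, Matrix.smul_apply, smul_eq_mul, map_add]
  cases k with
  | zero =>
    rw [coeff_zero_X_mul, resolvent, Matrix.of_apply, coeff_mk, Matrix.one_apply]
    simp only [pow_zero, Matrix.one_apply]
    split_ifs <;> simp
  | succ k =>
    rw [coeff_succ_X_mul, h, resolvent, Matrix.of_apply, coeff_mk, Matrix.one_apply]
    split_ifs <;> simp [coeff_one, pow_succ]

theorem trace_resolvent_mul (W : Matrix ι ι A) :
    (resolvent W * W.map C).trace = mk fun k => (-1) ^ k * (W ^ (k + 1)).trace := by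
  ext k
  rw [Matrix.trace, map_sum, coeff_mk, Matrix.trace, Finset.mul_sum]
  refine Finset.sum_congr rfl fun i _ => ?_
  rw [Matrix.diag_apply, Matrix.diag_apply, Matrix.mul_apply, map_sum, pow_succ, Matrix.mul_apply,
    Finset.mul_sum]
  refine Finset.sum_congr rfl fun l _ => ?_
  rw [Matrix.map_apply, coeff_mul_C, resolvent, Matrix.of_apply, coeff_mk]
  ring

/-- `det (1 + t W)` as a polynomial in `t`. -/
def detPoly (W : Matrix ι ι A) : Polynomial A :=
  Matrix.det (1 + (Polynomial.X : Polynomial A) • W.map Polynomial.C)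

theorem coe_detPoly (W : Matrix ι ι A) :
    (detPoly W : A⟦X⟧) = Matrix.det (1 + (X : A⟦X⟧) • W.map C) := by
  have h := RingHom.map_det (Polynomial.coeToPowerSeries.ringHom (R := A))
    (1 + (Polynomial.X : Polynomial A) • W.map Polynomial.C)
  rw [Polynomial.coeToPowerSeries.ringHom_apply] at h
  rw [detPoly, h]
  congr 1
  rw [map_add, map_one]
  congr 1
  refine Matrix.ext fun i j => ?_
  simp only [RingHom.mapMatrix_apply, Matrix.map_apply, Matrix.smul_apply, smul_eq_mul,
    Polynomial.coeToPowerSeries.ringHom_apply, Polynomial.coe_mul, Polynomial.coe_X, Polynomial.coe_C]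

/-- Jacobi's formula for `det (1 + t W)`. -/
theorem derivative_detPoly (W : Matrix ι ι A) : ((Polynomial.derivative (detPoly W) : Polynomial A) :
    A⟦X⟧) = (detPoly W : A⟦X⟧) * mk fun k => (-1) ^ k * (W ^ (k + 1)).trace := by
  set U : Matrix ι ι A⟦X⟧ := 1 + (X : A⟦X⟧) • W.map C with hU
  -- The derivative is the linear coefficient in a second variable `y` of `det (1 + (t + y) W)`.
  -- Factoring out `1 + tW` leaves `det (1 + y (1 + tW)⁻¹ W)`, whose linear coefficient is a trace.
  have h1 : (Polynomial.taylor (X : A⟦X⟧) ((detPoly W).map C)).coeff 1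
      = ((Polynomial.derivative (detPoly W) : Polynomial A) : A⟦X⟧) := by
    rw [Polynomial.taylor_coeff_one, Polynomial.derivative_map, Polynomial.eval_map,
      Polynomial.eval₂_C_X_eq_coe]
  have h2 : Polynomial.taylor (X : A⟦X⟧) ((detPoly W).map C)
      = Polynomial.C U.det * Matrix.det (1 + (Polynomial.X : Polynomial A⟦X⟧) •
        (resolvent W * W.map C).map Polynomial.C) := by
    have e : Polynomial.taylor (X : A⟦X⟧) ((detPoly W).map C)
        = (Polynomial.eval₂RingHom ((Polynomial.C : A⟦X⟧ →+* _).comp (C : A →+* A⟦X⟧))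
          (Polynomial.X + Polynomial.C X)) (detPoly W) := by
      rw [Polynomial.taylor_apply, Polynomial.comp, Polynomial.eval₂_map]; rfl
    rw [e, detPoly, RingHom.map_det, RingHom.map_det, ← Matrix.det_mul]
    congr 1
    have h3 : Polynomial.C.mapMatrix U * ((resolvent W * W.map C).map Polynomial.C)
        = Polynomial.C.mapMatrix (W.map C) := by
      change Polynomial.C.mapMatrix U * (Polynomial.C.mapMatrix (resolvent W * W.map C)) = _
      rw [← map_mul, ← mul_assoc, one_add_smul_mul_resolvent, one_mul]
    rw [mul_add, mul_one, Matrix.mul_smul, h3, map_add, map_one, hU, map_add, map_one, add_assoc]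
    congr 1
    refine Matrix.ext fun i j => ?_
    simp only [RingHom.mapMatrix_apply, Matrix.map_apply, Matrix.smul_apply, Matrix.add_apply,
      smul_eq_mul, map_mul, Polynomial.coe_eval₂RingHom, Polynomial.eval₂_mul, Polynomial.eval₂_X,
      Polynomial.eval₂_C,
      RingHom.comp_apply, add_mul]
    exact add_comm _ _
  rw [← h1, h2, Polynomial.coeff_C_mul, Matrix.coeff_det_one_add_X_smul_one, trace_resolvent_mul,
    coe_detPoly]

/-- Transposition does not change the determinant, and `S` intertwines `1 + tWᵀ` with `1 - tW`. So
the polynomial is even in `t`, and its odd coefficients equal their negatives. -/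
theorem coeff_detPoly_odd [Algebra ℂ A] {W S : Matrix ι ι A} (hS : IsUnit S.det)
    (h : W.transpose * S = -(S * W)) (k : ℕ) : (detPoly W).coeff (2 * k + 1) = 0 := by
  have h1 : detPoly W = (detPoly W).comp (-Polynomial.X) := by
    have hSu : IsUnit (Polynomial.C.mapMatrix S).det := by
      rw [← RingHom.map_det]; exact hS.map Polynomial.C
    apply hSu.mul_left_cancel
    have e : (detPoly W).comp (-Polynomial.X)
        = Matrix.det (1 - (Polynomial.X : Polynomial A) • W.map Polynomial.C) := by
      have := RingHom.map_det (Polynomial.compRingHom (-Polynomial.X : Polynomial A))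
        (1 + (Polynomial.X : Polynomial A) • W.map Polynomial.C)
      rw [Polynomial.coe_compRingHom_apply] at this
      rw [detPoly, this]
      congr 1
      ext i j : 2
      simp only [RingHom.mapMatrix_apply, Matrix.map_apply, Matrix.add_apply, Matrix.smul_apply,
        Matrix.sub_apply, map_add, smul_eq_mul, map_mul, Polynomial.coe_compRingHom_apply,
        Polynomial.X_comp, Polynomial.C_comp, Matrix.one_apply]
      split_ifs <;> simp [sub_eq_add_neg]
    have ht : detPoly W
        = Matrix.det (1 + (Polynomial.X : Polynomial A) • W.transpose.map Polynomial.C) := by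
      rw [detPoly, ← Matrix.det_transpose, Matrix.transpose_add, Matrix.transpose_one,
        Matrix.transpose_smul, Matrix.transpose_map]
    rw [e, ← Matrix.det_mul, ht, mul_comm, ← Matrix.det_mul]
    congr 1
    have h2 : Polynomial.C.mapMatrix W.transpose * Polynomial.C.mapMatrix S
        = -(Polynomial.C.mapMatrix S * Polynomial.C.mapMatrix W) := by
      rw [← map_mul, ← map_mul, h, map_neg]
    rw [add_mul, mul_sub, one_mul, mul_one, Matrix.smul_mul, Matrix.mul_smul, sub_eq_add_neg,
      ← smul_neg]
    congr 2
  have h2 := congrArg (fun p => p.coeff (2 * k + 1)) h1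
  have hX : (-Polynomial.X : Polynomial A) = Polynomial.C (-1) * Polynomial.X := by simp
  simp only [hX, Polynomial.comp_C_mul_X_coeff] at h2
  rw [pow_succ, pow_mul] at h2
  simp only [neg_one_sq, one_pow, mul_neg, mul_one] at h2
  have h3 : (2 : ℂ) • (detPoly W).coeff (2 * k + 1) = 0 := by
    rw [two_smul]; nth_rewrite 1 [h2]; exact neg_add_cancel _
  have := congrArg (fun z => (2⁻¹ : ℂ) • z) h3
  simpa [smul_smul] using this

end Jacobi

/-! ### Multiplicative sequences in formal roots, inside the ring of symmetric polynomials -/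

section Symmetric

open PowerSeries

theorem map_multSeq {A B : Type*} [CommRing A] [Algebra ℂ A] [CommRing B] [Algebra ℂ B]
    {ι : Type*} [Fintype ι] (g : A →ₐ[ℂ] B) (Q : ℂ⟦X⟧) (x : ι → A) :
    map (g : A →+* B) (multSeq Q x) = multSeq Q fun i => g (x i) := by
  rw [multSeq, map_prod, multSeq]
  refine Finset.prod_congr rfl fun i _ => ?_
  ext k
  simp [coeff_rescale]

/-- The multiplicative sequence of a polynomial, as a polynomial. -/
def multPoly {A : Type*} [CommRing A] [Algebra ℂ A] {ι : Type*} [Fintype ι] (q : Polynomial ℂ)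
    (x : ι → A) : Polynomial A :=
  ∏ i, (q.map (algebraMap ℂ A)).comp (Polynomial.C (x i) * Polynomial.X)

theorem coe_multPoly {A : Type*} [CommRing A] [Algebra ℂ A] {ι : Type*} [Fintype ι]
    (q : Polynomial ℂ) (x : ι → A) : (multPoly q x : A⟦X⟧) = multSeq (q : ℂ⟦X⟧) x := by
  rw [multPoly, multSeq, ← Polynomial.coeToPowerSeries.ringHom_apply, map_prod]
  refine Finset.prod_congr rfl fun i _ => ?_
  ext k
  rw [Polynomial.coeToPowerSeries.ringHom_apply, Polynomial.coeff_coe, coeff_rescale,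
    Polynomial.comp_C_mul_X_coeff]
  simp [mul_comm]

theorem eval_one_multPoly {A : Type*} [CommRing A] [Algebra ℂ A] {ι : Type*} [Fintype ι]
    (q : Polynomial ℂ) (x : ι → A) :
    (multPoly q x).eval 1 = ∏ i, Polynomial.aeval (x i) q := by
  rw [multPoly, Polynomial.eval_prod]
  refine Finset.prod_congr rfl fun i _ => ?_
  rw [Polynomial.eval_comp, Polynomial.eval_map_algebraMap]
  simp

variable {n : ℕ}

/-- The ring of symmetric polynomials. -/
abbrev SymRing (n : ℕ) := MvPolynomial.symmetricSubalgebra (Fin n) ℂ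

/-- The multiplicative sequence of a power series in the ring of symmetric polynomials. -/
def symSeq (n : ℕ) (Q : ℂ⟦X⟧) : (SymRing n)⟦X⟧ :=
  mk fun k => ⟨coeff k (multSeq Q (MvPolynomial.X : Fin n → MvPolynomial (Fin n) ℂ)), by
    intro e
    have h := map_multSeq (MvPolynomial.rename e) Q
      (MvPolynomial.X : Fin n → MvPolynomial (Fin n) ℂ)
    have h2 : (multSeq Q fun i => MvPolynomial.rename e (MvPolynomial.X i : MvPolynomial (Fin n) ℂ))
        = multSeq Q (MvPolynomial.X : Fin n → MvPolynomial (Fin n) ℂ) := by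
      simp only [MvPolynomial.rename_X]
      exact Equiv.prod_comp e fun i : Fin n => rescale (MvPolynomial.X i : MvPolynomial (Fin n) ℂ)
        (map (algebraMap ℂ (MvPolynomial (Fin n) ℂ)) Q)
    rw [h2] at h
    conv_rhs => rw [← h]
    rw [coeff_map]
    rfl⟩

theorem map_symSeq (Q : ℂ⟦X⟧) : map ((SymRing n).val : SymRing n →+* _) (symSeq n Q)
    = multSeq Q (MvPolynomial.X : Fin n → MvPolynomial (Fin n) ℂ) := by
  ext k : 1
  rw [coeff_map, symSeq, coeff_mk]
  rfl

/-- The power sums in the ring of symmetric polynomials. -/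
def symPsum (n m : ℕ) : SymRing n :=
  ⟨MvPolynomial.psum (Fin n) ℂ m, MvPolynomial.psum_isSymmetric _ _ _⟩

/-- The elementary symmetric polynomials in the ring of symmetric polynomials. -/
def symEsymm (n k : ℕ) : SymRing n :=
  ⟨MvPolynomial.esymm (Fin n) ℂ k, MvPolynomial.esymm_isSymmetric _ _ _⟩

/-- Proved among all polynomials, where the roots exist, and brought back by injectivity. Inside the
symmetric ring `symHom` can then be applied, although the target ring has no roots. -/
theorem derivative_symSeq {Q ℓ : ℂ⟦X⟧} (h : d⁄dX ℂ Q = Q * ℓ) :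
    d⁄dX (SymRing n) (symSeq n Q)
      = symSeq n Q * mk fun m => algebraMap ℂ (SymRing n) (coeff m ℓ) * symPsum n (m + 1) := by
  have hinj : Function.Injective (map ((SymRing n).val : SymRing n →+* MvPolynomial (Fin n) ℂ)) :=
    map_injective _ Subtype.val_injective
  apply hinj
  rw [← derivative_map, map_mul, map_symSeq, derivative_multSeq h]
  congr 1

theorem coeff_symSeq_one_add_X (k : ℕ) : coeff k (symSeq n (1 + X)) = symEsymm n k := by
  apply Subtype.ext
  rw [symSeq, coeff_mk]
  change coeff k (multSeq (1 + X) _) = MvPolynomial.esymm (Fin n) ℂ k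
  have h : multSeq (1 + X) (MvPolynomial.X : Fin n → MvPolynomial (Fin n) ℂ)
      = ∏ i, (1 + C (MvPolynomial.X i) * X) := by
    refine Finset.prod_congr rfl fun i _ => ?_
    rw [map_add, map_one, map_add, map_one, map_X, rescale_X]
  rw [h, Finset.prod_one_add, map_sum, MvPolynomial.esymm, Finset.powersetCard_eq_filter,
    Finset.sum_filter]
  refine Finset.sum_congr rfl fun t _ => ?_
  rw [Finset.prod_mul_distrib, Finset.prod_const, ← map_prod, coeff_C_mul, coeff_X_pow]
  split_ifs with h1 h2 h2
  · rw [mul_one]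
  · exact absurd h1.symm h2
  · exact absurd h2.symm h1
  · rw [mul_zero]

theorem symEsymm_zero : symEsymm n 0 = 1 := 
  Subtype.ext (MvPolynomial.esymm_zero (σ := Fin n) (R := ℂ))

theorem symEsymm_of_lt {k : ℕ} (h : n < k) : symEsymm n k = 0 := by
  apply Subtype.ext
  change MvPolynomial.esymm (Fin n) ℂ k = 0
  rw [MvPolynomial.esymm, Finset.powersetCard_eq_empty.2 (by simpa using h), Finset.sum_empty]

/-- The homomorphism from the ring of symmetric polynomials with prescribed values on the
elementary symmetric polynomials. -/
def symHom {A : Type*} [CommRing A] [Algebra ℂ A] (p : Fin n → A) : SymRing n →ₐ[ℂ] A :=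
  (MvPolynomial.aeval p).comp
    (MvPolynomial.esymmAlgEquiv (σ := Fin n) (R := ℂ) (n := n) (by simp)).symm.toAlgHom

theorem symHom_symEsymm {A : Type*} [CommRing A] [Algebra ℂ A] (p : Fin n → A) (i : Fin n) :
    symHom p (symEsymm n (i + 1)) = p i := by
  have := MvPolynomial.esymmAlgEquiv_symm_apply (R := ℂ) (σ := Fin n) (n := n) (by simp) i
  change MvPolynomial.aeval p ((MvPolynomial.esymmAlgEquiv (Fin n) ℂ (n := n) (by simp)).symm _) = _
  rw [symEsymm, this, MvPolynomial.aeval_X]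

/-- The product without the variable `t` is the value at `t = 1`, which makes sense because `q` is a
polynomial; this is why the characteristic series is truncated. -/
theorem sum_coeff_symSeq (q : Polynomial ℂ) {N : ℕ}
    (hN : (multPoly q (MvPolynomial.X : Fin n → MvPolynomial (Fin n) ℂ)).natDegree < N) :
    ((∑ k ∈ Finset.range N, coeff k (symSeq n (q : ℂ⟦X⟧)) : SymRing n) : MvPolynomial (Fin n) ℂ)
      = ∏ i, Polynomial.aeval (MvPolynomial.X i) q := by
  rw [← eval_one_multPoly, Polynomial.eval_eq_sum_range' hN, AddSubmonoidClass.coe_finsetSum]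
  refine Finset.sum_congr rfl fun k _ => ?_
  rw [one_pow, mul_one, symSeq, coeff_mk]
  change coeff k (multSeq (q : ℂ⟦X⟧) _) = _
  rw [← coe_multPoly, Polynomial.coeff_coe]

end Symmetric

/-! ### Logarithmic derivative of a truncated series -/

section Truncation

open PowerSeries

/-- The logarithmic derivative of a truncated series. -/
theorem exists_logDeriv_trunc {Q ℓ : ℂ⟦X⟧} (h : d⁄dX ℂ Q = Q * ℓ) (h0 : constantCoeff Q = 1) (n : ℕ) :
    ∃ ℓ' : ℂ⟦X⟧, d⁄dX ℂ (Q.trunc (n + 1) : ℂ⟦X⟧) = (Q.trunc (n + 1) : ℂ⟦X⟧) * ℓ' ∧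
      ∀ m < n, coeff m ℓ' = coeff m ℓ := by
  set T : ℂ⟦X⟧ := (Q.trunc (n + 1) : ℂ⟦X⟧) with hT
  have hc : ∀ k < n + 1, coeff k T = coeff k Q := fun k hk => by
    rw [hT, Polynomial.coeff_coe, coeff_trunc, if_pos hk]
  have hT0 : constantCoeff T = 1 := by
    rw [← coeff_zero_eq_constantCoeff_apply, hc 0 (by omega), coeff_zero_eq_constantCoeff_apply, h0]
  have hT0' : constantCoeff T ≠ 0 := by rw [hT0]; exact one_ne_zero
  refine ⟨T⁻¹ * d⁄dX ℂ T, by rw [← mul_assoc, PowerSeries.mul_inv_cancel _ hT0', one_mul], ?_⟩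
  set ℓ' := T⁻¹ * d⁄dX ℂ T
  have hℓ' : T * ℓ' = d⁄dX ℂ T := by rw [← mul_assoc, PowerSeries.mul_inv_cancel _ hT0', one_mul]
  have hd : X ^ n ∣ ℓ' - ℓ := by
    -- Both `Q - T` and the difference of the derivatives are divisible by `X ^ n`.
    have e : ℓ' - ℓ = Q⁻¹ * ((Q - T) * ℓ' + (d⁄dX ℂ T - d⁄dX ℂ Q)) := by
      have hQ : Q * Q⁻¹ = 1 := PowerSeries.mul_inv_cancel _ (by rw [h0]; exact one_ne_zero)
      rw [h, ← hℓ']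
      linear_combination (ℓ - ℓ') * hQ
    rw [e]
    refine Dvd.dvd.mul_left (dvd_add (Dvd.dvd.mul_right ?_ _) ?_) _
    · rw [X_pow_dvd_iff]
      intro m hm
      rw [map_sub, hc m (by omega), sub_self]
    · rw [X_pow_dvd_iff]
      intro m hm
      rw [map_sub, coeff_derivative, coeff_derivative, hc (m + 1) (by omega), sub_self]
  intro m hm
  rw [← sub_eq_zero, ← map_sub]
  exact X_pow_dvd_iff.1 hd m hm

end Truncation

/-! ### A genus as the exponential of traces of powers -/

section GenusFormula

open PowerSeries

variable {A : Type*} [CommRing A] [Algebra ℂ A] {n : ℕ}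

omit [Algebra ℂ A] in
theorem coeff_zero_detPoly (W : Matrix (Fin n) (Fin n) A) : (detPoly W).coeff 0 = 1 := by
  rw [detPoly, Matrix.det_one_add_X_smul]
  simp

omit [Algebra ℂ A] in
theorem coeff_detPoly_of_lt (W : Matrix (Fin n) (Fin n) A) {k : ℕ} (hk : n < k) :
    (detPoly W).coeff k = 0 := by
  apply Polynomial.coeff_eq_zero_of_natDegree_lt
  refine lt_of_le_of_lt ?_ hk
  have := Polynomial.natDegree_det_X_add_C_le W 1
  rw [Fintype.card_fin] at this
  have e : (Polynomial.X : Polynomial A) • W.map Polynomial.C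
      + (1 : Matrix (Fin n) (Fin n) A).map Polynomial.C
      = 1 + (Polynomial.X : Polynomial A) • W.map Polynomial.C := by
    rw [add_comm]
    congr 1
    exact map_one Polynomial.C.mapMatrix
  rwa [e] at this

theorem constantCoeff_multSeq {ι : Type*} [Fintype ι] {Q : ℂ⟦X⟧} (h : constantCoeff Q = 1)
    (x : ι → A) : constantCoeff (multSeq Q x) = 1 := by
  rw [multSeq, map_prod]
  refine Finset.prod_eq_one fun i _ => ?_
  rw [← coeff_zero_eq_constantCoeff_apply, coeff_rescale, coeff_map,
    coeff_zero_eq_constantCoeff_apply, h]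
  simp

theorem constantCoeff_symSeq {Q : ℂ⟦X⟧} (h : constantCoeff Q = 1) :
    constantCoeff (symSeq n Q) = 1 := by
  apply Subtype.ext
  rw [← coeff_zero_eq_constantCoeff_apply, symSeq, coeff_mk]
  change coeff 0 (multSeq Q _) = 1
  rw [coeff_zero_eq_constantCoeff_apply, constantCoeff_multSeq h]

/-- The coefficients of even degree of `det (1 + t W)`. -/
def evenCoeff (W : Matrix (Fin n) (Fin n) A) (i : Fin n) : A := (detPoly W).coeff (2 * (i + 1))

/-- The series `∏ (1 + xᵢ t)` generates the elementary symmetric polynomials, which `symHom` sends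
to the even coefficients. -/
theorem map_symSeq_one_add_X (W : Matrix (Fin n) (Fin n) A) :
    map (symHom (evenCoeff W) : SymRing n →+* A) (symSeq n (1 + X))
      = mk fun k => (detPoly W).coeff (2 * k) := by
  ext k
  rw [coeff_map, coeff_symSeq_one_add_X, coeff_mk]
  change symHom (evenCoeff W) (symEsymm n k) = _
  rcases Nat.eq_zero_or_pos k with rfl | hk
  · rw [symEsymm_zero, map_one, mul_zero, coeff_zero_detPoly]
  · rcases le_or_gt k n with h | h
    · have := symHom_symEsymm (evenCoeff W) ⟨k - 1, by omega⟩
      simp only [Nat.sub_add_cancel hk] at this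
      rw [this, evenCoeff]
      simp only [Nat.sub_add_cancel hk]
    · rw [symEsymm_of_lt h, map_zero, coeff_detPoly_of_lt W (by omega)]

/-- Newton's identities for the even coefficients of `det (1 + t W)`. -/
theorem symHom_symPsum {W S : Matrix (Fin n) (Fin n) A} (hS : IsUnit S.det)
    (hW : W.transpose * S = -(S * W)) (m : ℕ) : symHom (evenCoeff W) (symPsum n (m + 1))
      = ((1 / 2 : ℂ) * (-1) ^ (m + 1)) • (W ^ (2 * (m + 1))).trace := by
  set φ := symHom (evenCoeff W)
  set E : A⟦X⟧ := mk fun k => (detPoly W).coeff (2 * k) with hE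
  set β : A⟦X⟧ := mk fun m => algebraMap ℂ A ((-1) ^ m) * φ (symPsum n (m + 1)) with hβ
  have hdE : d⁄dX A E = E * β := by
    have h1 : d⁄dX ℂ (1 + X : ℂ⟦X⟧) = (1 + X) * mk fun m => (-1) ^ m := by
      have h2 : d⁄dX ℂ (1 + X : ℂ⟦X⟧) = 1 := by
        rw [map_add, derivative_one, derivative_X, zero_add]
      rw [h2]
      ext k
      rw [add_mul, one_mul, map_add, coeff_mk, coeff_one]
      cases k with
      | zero => simp
      | succ k => rw [coeff_succ_X_mul, coeff_mk, pow_succ]; simp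
    have h3 := congrArg (map (φ : SymRing n →+* A)) (derivative_symSeq (n := n) h1)
    rw [← derivative_map, map_mul, map_symSeq_one_add_X] at h3
    rw [← hE] at h3
    rw [h3]
    congr 1
    ext k
    rw [coeff_map, coeff_mk, hβ, coeff_mk, coeff_mk, map_mul]
    congr 1
    exact φ.commutes _
  -- By antisymmetry the determinant is `E(t²)`. Its logarithmic derivative is known both from
  -- Jacobi's formula and from the power sums, and the coefficients of `t^(2m+1)` are compared.
  have hP : (detPoly W : A⟦X⟧) = expand 2 two_ne_zero E := by
    ext k
    rw [Polynomial.coeff_coe, coeff_expand]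
    split_ifs with h
    · rw [hE, coeff_mk, Nat.mul_div_cancel' h]
    · obtain ⟨j, rfl⟩ : ∃ j, k = 2 * j + 1 := ⟨k / 2, by omega⟩
      exact coeff_detPoly_odd hS hW j
  have h4 := derivative_expand_two E
  rw [hdE, map_mul, ← hP, derivative_coe, derivative_detPoly, mul_assoc] at h4
  have h5 := eq_of_mul_eq_mul_of_constantCoeff_eq_one (by
    rw [← coeff_zero_eq_constantCoeff_apply, Polynomial.coeff_coe, coeff_zero_detPoly]) h4
  have h6 := congrArg (coeff (2 * m + 1)) h5
  rw [mul_comm 2 X, ← mul_assoc, show (2 : A⟦X⟧) = C 2 from (map_ofNat _ 2).symm, coeff_mul_C,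
      coeff_succ_mul_X, coeff_expand_mul, hβ, coeff_mk, coeff_mk, pow_succ, pow_mul] at h6
  simp only [neg_one_sq, one_pow, one_mul] at h6
  have h7 : ((-1 : ℂ) ^ m * (-1) ^ m) = 1 := by rw [← mul_pow]; simp
  have h8 : φ (symPsum n (m + 1)) = ((1 / 2 : ℂ) * (-1) ^ m) •
      (algebraMap ℂ A ((-1) ^ m) * φ (symPsum n (m + 1)) * 2) := by
    rw [show (2 : A) = algebraMap ℂ A 2 from (map_ofNat _ 2).symm, mul_comm _ (algebraMap ℂ A 2),
      ← Algebra.smul_def, ← Algebra.smul_def, smul_smul, smul_smul,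
      show (1 / 2 : ℂ) * (-1) ^ m * 2 * (-1) ^ m = (-1) ^ m * (-1) ^ m by ring, h7, one_smul]
  rw [h8, ← h6, show 2 * m + 1 + 1 = 2 * (m + 1) by ring, pow_succ]
  simp

omit [Algebra ℂ A] in
theorem matrix_pow_mem {I : Ideal A} {W : Matrix (Fin n) (Fin n) A} (hW : ∀ i j, W i j ∈ I)
    (k : ℕ) (i j : Fin n) : (W ^ (k + 1)) i j ∈ I ^ (k + 1) := by
  induction k generalizing i j with
  | zero => simpa using hW i j
  | succ k ih =>
    have e : W ^ (k + 1 + 1) = W ^ (k + 1) * W := pow_succ _ _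
    rw [e, Matrix.mul_apply, pow_succ I]
    exact Ideal.sum_mem _ fun l _ => Ideal.mul_mem_mul (ih i l) (hW l j)

omit [Algebra ℂ A] in
theorem trace_pow_mem {I : Ideal A} {W : Matrix (Fin n) (Fin n) A} (hW : ∀ i j, W i j ∈ I)
    (k : ℕ) : (W ^ (k + 1)).trace ∈ I ^ (k + 1) :=
  Ideal.sum_mem _ fun i _ => matrix_pow_mem hW k i i

/-- Differentiation shortens the truncated exponential by one term, so `y' = y z'` holds only if the
lost top term is annihilated by `z'`. -/
theorem derivative_expSum (m : ℕ) (z : Polynomial A) :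
    Polynomial.derivative (expSum (m + 1) z) = expSum m z * Polynomial.derivative z := by
  rw [expSum, Finset.sum_range_succ', map_add, map_sum, expSum, Finset.sum_mul]
  simp only [pow_zero, Polynomial.derivative_smul, Polynomial.derivative_one, smul_zero, add_zero]
  refine Finset.sum_congr rfl fun k _ => ?_
  rw [Polynomial.derivative_pow, Nat.add_sub_cancel, Nat.factorial_succ, ← smul_mul_assoc,
    ← smul_mul_assoc]
  congr 1
  have e : Polynomial.C ((k + 1 : ℕ) : A) = algebraMap ℂ (Polynomial A) ((k + 1 : ℕ) : ℂ) := by simp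
  rw [smul_mul_assoc, e, ← Algebra.smul_def, smul_smul]
  congr 1
  have := Nat.cast_add_one_ne_zero (R := ℂ) k
  push_cast
  field_simp

/-- A genus, expressed by traces of powers of the curvature: `∏ Q(xᵢ) = exp (∑ Lₘ πₘ)`. -/
theorem aeval_genus {I : Ideal A} (hI : I ^ (n + 1) = ⊥) {W S : Matrix (Fin n) (Fin n) A}
    (hWI : ∀ i j, W i j ∈ I) (hS : IsUnit S.det) (hW : W.transpose * S = -(S * W))
    {q : Polynomial ℂ} {ℓ : ℂ⟦X⟧} (hq : d⁄dX ℂ (q : ℂ⟦X⟧) = q * ℓ) (hq0 : q.coeff 0 = 1)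
    {G : SymRing n} (hG : (G : MvPolynomial (Fin n) ℂ)
      = ∏ i, Polynomial.aeval (MvPolynomial.X i) q) :
    symHom (evenCoeff W) G = expSum (n + 1) (∑ m ∈ Finset.range n,
      (coeff m ℓ / (m + 1) * ((1 / 2 : ℂ) * (-1) ^ (m + 1))) • (W ^ (2 * (m + 1))).trace) := by
  set φ := symHom (evenCoeff W) with hφ
  have hI' : ∀ k, n < k → ∀ a ∈ I ^ k, a = 0 := fun k hk a ha => by
    have := Ideal.pow_le_pow_right (I := I) (show n + 1 ≤ k from hk) ha
    rwa [hI] at this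
  -- The exponent with `t^(m+1)` inserted: its derivative is the logarithmic derivative of the
  -- multiplicative sequence, and its value at `t = 1` is the exponent wanted.
  set z : Polynomial A := ∑ m ∈ Finset.range n, Polynomial.C ((coeff m ℓ / (m + 1) *
    ((1 / 2 : ℂ) * (-1) ^ (m + 1))) • (W ^ (2 * (m + 1))).trace) * Polynomial.X ^ (m + 1) with hz
  have hzI : z ∈ I.map (Polynomial.C : A →+* Polynomial A) := by
    refine Ideal.sum_mem _ fun m _ => Ideal.mul_mem_right _ _ (Ideal.mem_map_of_mem _ ?_)
    exact Submodule.smul_of_tower_mem _ _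
      (Ideal.pow_le_self (by omega) (trace_pow_mem hWI (2 * m + 1)))
  have hdz : ((Polynomial.derivative z : Polynomial A) : A⟦X⟧)
      = mk fun m => algebraMap ℂ A (coeff m ℓ) * φ (symPsum n (m + 1)) := by
    ext k
    rw [Polynomial.coeff_coe, Polynomial.coeff_derivative, coeff_mk, symHom_symPsum hS hW, hz,
      Polynomial.finsetSum_coeff]
    simp only [Polynomial.coeff_C_mul, Polynomial.coeff_X_pow, add_left_inj]
    simp only [mul_ite, mul_one, mul_zero, Finset.sum_ite_eq, Finset.mem_range]
    split_ifs with h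
    · have hk : ((k : A) + 1) = algebraMap ℂ A ((k : ℂ) + 1) := by simp
      rw [hk, mul_comm, ← Algebra.smul_def, ← Algebra.smul_def, smul_smul, smul_smul]
      congr 1
      have := Nat.cast_add_one_ne_zero (R := ℂ) k
      field_simp
    -- Beyond the cut-off the traces vanish by nilpotency, so `z` loses nothing by being a
    -- polynomial.
    · have h0 := hI' (2 * k + 1 + 1) (by omega) _ (trace_pow_mem hWI (2 * k + 1))
      rw [show 2 * k + 1 + 1 = 2 * (k + 1) by ring] at h0
      rw [zero_mul, h0, smul_zero, mul_zero]
  -- The top term missing after differentiation of the truncated exponential: it lies in the `(n +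
  -- 1)`-st power of a nilpotent ideal.
  have hzn : z ^ n * Polynomial.derivative z = 0 := by
    have hd : Polynomial.derivative z ∈ I.map (Polynomial.C : A →+* Polynomial A) := by
      rw [Ideal.mem_map_C_iff]
      intro k
      rw [Polynomial.coeff_derivative]
      exact Ideal.mul_mem_right _ _ (Ideal.mem_map_C_iff.1 hzI _)
    have := Ideal.mul_mem_mul (Ideal.pow_mem_pow hzI n) hd
    rw [← pow_succ, ← Ideal.map_pow, hI, Ideal.map_bot] at this
    exact this
  have hdE : Polynomial.derivative (expSum (n + 1) z)
      = expSum (n + 1) z * Polynomial.derivative z := by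
    rw [derivative_expSum, expSum, expSum, Finset.sum_range_succ, add_mul, smul_mul_assoc, hzn,
      smul_zero, add_zero]
  have hz0 : z.coeff 0 = 0 := by
    rw [hz, Polynomial.finsetSum_coeff]
    exact Finset.sum_eq_zero fun m _ => by simp
  have hE0 : (expSum (n + 1) z).coeff 0 = 1 := by
    rw [expSum, Finset.sum_range_succ', Polynomial.coeff_add, Polynomial.finsetSum_coeff,
      Finset.sum_eq_zero]
    · simp
    · intro k _
      rw [Polynomial.coeff_smul, pow_succ, Polynomial.mul_coeff_zero, hz0, mul_zero, smul_zero]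
  have key : map (φ : SymRing n →+* A) (symSeq n (q : ℂ⟦X⟧)) = (expSum (n + 1) z : Polynomial A) := by
    refine eq_of_derivative_eq_mul (b := mk fun m => algebraMap ℂ A (coeff m ℓ) *
      φ (symPsum n (m + 1))) ?_ ?_ ?_
    · rw [derivative_map, derivative_symSeq hq, map_mul]
      congr 1
      ext k
      rw [coeff_map, coeff_mk, coeff_mk, map_mul]
      congr 1
      exact φ.commutes _
    · rw [derivative_coe, hdE, Polynomial.coe_mul, hdz]
    · rw [← coeff_zero_eq_constantCoeff_apply, coeff_map, coeff_zero_eq_constantCoeff_apply,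
        constantCoeff_symSeq (by simpa using hq0), map_one, ← coeff_zero_eq_constantCoeff_apply,
        Polynomial.coeff_coe, hE0]
  -- A common degree bound, so that both polynomials can be evaluated at `1` as the same finite sum
  -- of coefficients.
  set N := max (multPoly q (MvPolynomial.X : Fin n → MvPolynomial (Fin n) ℂ)).natDegree
    (expSum (n + 1) z).natDegree + 1 with hN
  have hG' : G = ∑ k ∈ Finset.range N, coeff k (symSeq n (q : ℂ⟦X⟧)) := by
    apply Subtype.ext
    rw [hG, sum_coeff_symSeq q (N := N) (by omega)]
  have h1 : (expSum (n + 1) z).eval 1 = ∑ k ∈ Finset.range N, φ (coeff k (symSeq n (q : ℂ⟦X⟧))) := by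
    rw [Polynomial.eval_eq_sum_range' (n := N) (by omega)]
    refine Finset.sum_congr rfl fun k _ => ?_
    rw [one_pow, mul_one, ← Polynomial.coeff_coe, ← key, coeff_map]
    rfl
  rw [hG', map_sum, ← h1]
  have h2 := map_expSum ((Polynomial.aeval (1 : A) : Polynomial A →ₐ[A] A).restrictScalars ℂ)
    (n + 1) z
  change Polynomial.aeval (1 : A) _ = expSum (n + 1) (Polynomial.aeval (1 : A) z) at h2
  rw [Polynomial.coe_aeval_eq_eval] at h2
  rw [h2, hz, Polynomial.eval_finsetSum]
  congr 1
  refine Finset.sum_congr rfl fun m _ => ?_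
  simp

end GenusFormula

/-! ### The characteristic series, Bernoulli numbers and zeta values -/

section AHatSeries

open PowerSeries

/-- The power series `sinh (x / 2) / (x / 2)` in `x ^ 2`. -/
def sinhSeries : ℂ⟦X⟧ := mk fun j => ((4 : ℂ) ^ j * ((2 * j + 1).factorial : ℂ))⁻¹

theorem constantCoeff_sinhSeries : constantCoeff sinhSeries = 1 := by
  rw [← coeff_zero_eq_constantCoeff_apply, sinhSeries, coeff_mk]
  simp

theorem X_mul_expand_sinhSeries : (X : ℂ⟦X⟧) * expand 2 two_ne_zero sinhSeries
    = rescale (1 / 2 : ℂ) (exp ℂ) - rescale (-(1 / 2) : ℂ) (exp ℂ) := by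
  ext k
  rw [map_sub, coeff_rescale, coeff_rescale, coeff_exp]
  cases k with
  | zero => simp
  | succ k =>
    rw [coeff_succ_X_mul, coeff_expand, neg_pow (1 / 2 : ℂ)]
    rcases Nat.even_or_odd' k with ⟨j, rfl | rfl⟩
    · rw [if_pos (by omega), Nat.mul_div_cancel_left _ two_pos, sinhSeries, coeff_mk,
        Odd.neg_one_pow ⟨j, rfl⟩]
      have : ((2 * j + 1).factorial : ℂ) ≠ 0 := by exact_mod_cast Nat.factorial_ne_zero _
      rw [show (4 : ℂ) = 2 ^ 2 by norm_num, ← pow_mul]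
      simp only [one_div, inv_pow, map_inv₀, map_natCast]
      field_simp
      ring
    · rw [if_neg (by omega), (by rw [show 2 * j + 1 + 1 = 2 * (j + 1) by ring, pow_mul]; simp :
        (-1 : ℂ) ^ (2 * j + 1 + 1) = 1)]
      ring

/-- The factorization `e^x - 1 = e^(x/2) (e^(x/2) - e^(-x/2))` exhibits `x/(e^x - 1)` as the inverse
of `e^(x/2)` times the sinh quotient. -/
theorem bernoulli_mul_exp_mul_sinhSeries : bernoulliPowerSeries ℂ * (rescale (1 / 2 : ℂ) (exp ℂ)
    * expand 2 two_ne_zero sinhSeries) = 1 := by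
  have h1 : rescale (1 / 2 : ℂ) (exp ℂ) * rescale (1 / 2 : ℂ) (exp ℂ) = exp ℂ := by
    rw [exp_mul_exp_eq_exp_add]; norm_num
  have h2 : rescale (1 / 2 : ℂ) (exp ℂ) * rescale (-(1 / 2) : ℂ) (exp ℂ) = 1 := by
    rw [exp_mul_exp_eq_exp_add]; simp
  have h3 := bernoulliPowerSeries_mul_exp_sub_one ℂ
  have h4 := X_mul_expand_sinhSeries
  refine mul_left_cancel₀ (X_ne_zero (R := ℂ)) ?_
  linear_combination h3 + bernoulliPowerSeries ℂ * h1 - bernoulliPowerSeries ℂ * h2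
    + bernoulliPowerSeries ℂ * rescale (1 / 2 : ℂ) (exp ℂ) * h4

/-- The logarithmic derivative of `sinh (x / 2) / (x / 2)`. -/
theorem X_mul_logDeriv_sinhSeries : X * (d⁄dX ℂ (expand 2 two_ne_zero sinhSeries)
    * (bernoulliPowerSeries ℂ * rescale (1 / 2 : ℂ) (exp ℂ)))
    = bernoulliPowerSeries ℂ - 1 + C (1 / 2) * X := by
  have h1 : rescale (1 / 2 : ℂ) (exp ℂ) * rescale (1 / 2 : ℂ) (exp ℂ) = exp ℂ := by
    rw [exp_mul_exp_eq_exp_add]; norm_num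
  have h2 : rescale (1 / 2 : ℂ) (exp ℂ) * rescale (-(1 / 2) : ℂ) (exp ℂ) = 1 := by
    rw [exp_mul_exp_eq_exp_add]; simp
  have h3 := bernoulliPowerSeries_mul_exp_sub_one ℂ
  have h4 := congrArg (d⁄dX ℂ) X_mul_expand_sinhSeries
  have h5 := X_mul_expand_sinhSeries
  have h6 := bernoulli_mul_exp_mul_sinhSeries
  have hexp : d⁄dX ℂ (exp ℂ) = exp ℂ := by
    ext k
    rw [coeff_derivative, coeff_exp, coeff_exp, Nat.factorial_succ]
    have := Nat.cast_add_one_ne_zero (R := ℂ) k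
    have : (k.factorial : ℂ) ≠ 0 := by exact_mod_cast Nat.factorial_ne_zero _
    simp only [one_div, map_inv₀, map_natCast]
    push_cast
    field_simp
  rw [Derivation.leibniz, map_sub, derivative_rescale, derivative_rescale, hexp, derivative_X,
    smul_eq_mul, smul_eq_mul, map_neg, mul_one] at h4
  have hC : (C (1 / 2 : ℂ) : ℂ⟦X⟧) + C (1 / 2) = 1 := by rw [← map_add]; norm_num
  set S := expand 2 two_ne_zero sinhSeries
  set B := bernoulliPowerSeries ℂ
  set h := rescale (1 / 2 : ℂ) (exp ℂ)
  set h' := rescale (-(1 / 2) : ℂ) (exp ℂ)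
  set c : ℂ⟦X⟧ := C (1 / 2 : ℂ)
  linear_combination B * h * h4 - h6 + c * B * h1 + c * B * h2 + c * h3 + B * hC

/-- In the variable `x` the logarithmic derivative times `x` is `B(x) - 1 + x/2`, with `B` the
Bernoulli series. Passing from `x²` to `x` costs the factor `2x` of the chain rule, whence the shift
by two and the `2` in the denominator. -/
theorem coeff_logDeriv_sinhSeries (m : ℕ) : coeff m (d⁄dX ℂ sinhSeries * sinhSeries⁻¹)
    = (bernoulli (2 * (m + 1)) : ℂ) / (2 * (2 * (m + 1)).factorial) := by
  have hS : sinhSeries * sinhSeries⁻¹ = 1 :=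
    PowerSeries.mul_inv_cancel _ (by rw [constantCoeff_sinhSeries]; exact one_ne_zero)
  have h1 : expand 2 two_ne_zero sinhSeries⁻¹
      = bernoulliPowerSeries ℂ * rescale (1 / 2 : ℂ) (exp ℂ) := by
    have h2 := congrArg (expand 2 two_ne_zero) hS
    rw [map_mul, map_one] at h2
    have h3 := bernoulli_mul_exp_mul_sinhSeries
    linear_combination (bernoulliPowerSeries ℂ * rescale (1 / 2 : ℂ) (exp ℂ)) * h2
      - (expand 2 two_ne_zero sinhSeries⁻¹) * h3
  have h2 := X_mul_logDeriv_sinhSeries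
  rw [← h1, derivative_expand_two] at h2
  have h3 : (X : ℂ⟦X⟧) * (X * (C 2 * expand 2 two_ne_zero (d⁄dX ℂ sinhSeries * sinhSeries⁻¹)))
      = bernoulliPowerSeries ℂ - 1 + C (1 / 2) * X := by
    rw [← h2, map_mul, show (C 2 : ℂ⟦X⟧) = 2 from map_ofNat _ 2]; ring
  have h4 := congrArg (coeff (2 * m + 1 + 1)) h3
  rw [coeff_succ_X_mul, coeff_succ_X_mul, coeff_C_mul, coeff_expand_mul, map_add, map_sub,
    coeff_C_mul, coeff_X, coeff_one, if_neg (by omega), if_neg (by omega), bernoulliPowerSeries,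
    coeff_mk] at h4
  rw [show 2 * (m + 1) = 2 * m + 1 + 1 by ring]
  have : ((2 * m + 1 + 1).factorial : ℂ) ≠ 0 := by exact_mod_cast Nat.factorial_ne_zero _
  simp at h4
  field_simp
  field_simp at h4
  linear_combination h4

theorem constantCoeff_aHatSeries : constantCoeff aHatSeries = 1 := by
  change constantCoeff sinhSeries⁻¹ = 1
  rw [constantCoeff_inv, constantCoeff_sinhSeries, inv_one]

/-- Euler's formula for `ζ(2k)` replaces the Bernoulli numbers. Here the characteristic series
acquires the same zeta values as the regularized determinant. -/
theorem derivative_aHatSeries : d⁄dX ℂ aHatSeries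
    = aHatSeries * mk fun m => (-1) ^ (m + 1) * riemannZeta (2 * (m + 1 : ℕ))
      / (2 * Real.pi : ℂ) ^ (2 * (m + 1)) := by
  have h : (mk fun m => (-1) ^ (m + 1) * riemannZeta (2 * (m + 1 : ℕ))
      / (2 * Real.pi : ℂ) ^ (2 * (m + 1))) = -(d⁄dX ℂ sinhSeries * sinhSeries⁻¹) := by
    ext m
    rw [coeff_mk, map_neg, coeff_logDeriv_sinhSeries, riemannZeta_two_mul_nat (by omega)]
    have hp : (Real.pi : ℂ) ≠ 0 := by exact_mod_cast Real.pi_ne_zero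
    have : ((2 * (m + 1)).factorial : ℂ) ≠ 0 := by exact_mod_cast Nat.factorial_ne_zero _
    have h2 : (2 : ℂ) ^ (2 * (m + 1)) = 2 * 2 ^ (2 * (m + 1) - 1) := by
      rw [← pow_succ']; congr 1
    have h3 : (-1 : ℂ) ^ (m + 1) * (-1) ^ (m + 1 + 1) = -1 := by
      rw [pow_succ _ (m + 1), ← mul_assoc, ← mul_pow]; simp
    rw [mul_pow, h2]
    field_simp
    linear_combination (bernoulli (2 * (m + 1)) : ℂ) * h3
  rw [h]
  change d⁄dX ℂ sinhSeries⁻¹ = sinhSeries⁻¹ * _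
  rw [derivative_inv']
  ring

end AHatSeries

/-! ### The `Â`-polynomial of an antisymmetric nilpotent matrix -/

section AbstractAHat

variable {A : Type*} [CommRing A] [Algebra ℂ A] {n : ℕ}

/-- One factor `(2π)^(-2(m+1))` comes from normalizing the curvature and another from the series;
the sign `(-1)^(m+1)` occurs in the series and in Newton's identities and squares to one. Only the
first `n` coefficients of the logarithmic derivative enter, so the truncation does no harm. -/
theorem aeval_aHatPoly {I : Ideal A} (hI : I ^ (n + 1) = ⊥) {Ω S : Matrix (Fin n) (Fin n) A}
    (hΩ : ∀ i j, Ω i j ∈ I) (hS : IsUnit S.det) (h : Ω.transpose * S = -(S * Ω)) :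
    MvPolynomial.aeval (evenCoeff ((1 / (2 * Real.pi) : ℂ) • Ω)) (aHatPoly n)
    = expSum (n + 1) (∑ m ∈ Finset.range n, (riemannZeta (2 * (m + 1 : ℕ)) / (2 * (m + 1 : ℕ))
      / (2 * Real.pi : ℂ) ^ (4 * (m + 1))) • (Ω ^ (2 * (m + 1))).trace) := by
  obtain ⟨ℓ, hℓ, hc⟩ := exists_logDeriv_trunc derivative_aHatSeries constantCoeff_aHatSeries n
  have h := aeval_genus hI (W := (1 / (2 * Real.pi) : ℂ) • Ω)
    (S := S) (fun i j => Submodule.smul_of_tower_mem _ _ (hΩ i j)) hS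
    (by rw [Matrix.transpose_smul, Matrix.smul_mul, h, Matrix.mul_smul, smul_neg]) hℓ
    (by rw [PowerSeries.coeff_trunc, if_pos (by omega),
          PowerSeries.coeff_zero_eq_constantCoeff_apply, constantCoeff_aHatSeries])
    (G := aHatSymm n) rfl
  refine Eq.trans rfl (h.trans ?_)
  congr 1
  refine Finset.sum_congr rfl fun m hm => ?_
  rw [hc m (Finset.mem_range.1 hm), PowerSeries.coeff_mk, smul_pow, Matrix.trace_smul, smul_smul]
  congr 1
  have hp : (Real.pi : ℂ) ≠ 0 := by exact_mod_cast Real.pi_ne_zero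
  have := Nat.cast_add_one_ne_zero (R := ℂ) m
  have h3 : (-1 : ℂ) ^ (m + 1) * (-1) ^ (m + 1) = 1 := by rw [← mul_pow]; simp
  rw [show 4 * (m + 1) = 2 * (m + 1) + 2 * (m + 1) by ring, pow_add (2 * (Real.pi : ℂ)), div_pow,
    one_pow]
  have hP : (2 * Real.pi : ℂ) ^ (2 * (m + 1)) ≠ 0 := pow_ne_zero _ (mul_ne_zero two_ne_zero hp)
  generalize (2 * Real.pi : ℂ) ^ (2 * (m + 1)) = P at hP ⊢
  generalize (-1 : ℂ) ^ (m + 1) = e at h3 ⊢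
  push_cast
  field_simp
  linear_combination (riemannZeta (2 * ((m : ℂ) + 1))) * h3

theorem map_expSum_sum {B : Type*} [CommRing B] [Algebra ℂ B] {f : A →ₐ[ℂ] B} {t : ℕ → A}
    {t' : ℕ → B} {d c c' : ℕ → ℂ}
    (h : ∀ m, f (t m) = d m • t' m) (hc : ∀ m, c m * d m = c' m) (N k : ℕ) :
    f (expSum N (∑ m ∈ Finset.range k, c m • t m))
      = expSum N (∑ m ∈ Finset.range k, c' m • t' m) := by
  rw [map_expSum, map_sum]
  congr 1
  refine Finset.sum_congr rfl fun m _ => ?_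
  rw [map_smul, h, smul_smul, hc]

end AbstractAHat

/-! ### The `Â`-form as an exponential of traces -/

section AHatForm

variable {n : ℕ} {X : Type*} [TopologicalSpace X] [T2Space X]
  [ChartedSpace (EuclideanSpace ℝ (Fin n)) X]
  [IsManifold (𝓡 n) ∞ X]
  [RiemannianBundle (fun x : X => TangentSpace (𝓡 n) x)]
  [IsContMDiffRiemannianBundle (𝓡 n) ∞ (EuclideanSpace ℝ (Fin n))
      (fun x : X => TangentSpace (𝓡 n) x)]
  {cov : CovariantDerivative (𝓡 n) (EuclideanSpace ℝ (Fin n))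
      (fun x : X => TangentSpace (𝓡 n) x)}

/-- The `Â`-form is the exponential of a combination of traces of powers of the curvature. -/
theorem aHatForm_eq_expSum (hcov : IsLeviCivita cov) (x : X) : aHatForm cov x
    = expSum (n + 1) (∑ m ∈ Finset.range n, (riemannZeta (2 * (m + 1 : ℕ)) / (2 * (m + 1 : ℕ))
      / (2 * Real.pi : ℂ) ^ (4 * (m + 1))) • (curvatureForm cov x ^ (2 * (m + 1))).trace) := by
  obtain ⟨S, hS, hW⟩ := curvatureForm_antisymm hcov x
  exact aeval_aHatPoly (soulIdeal_coT_pow x) (curvatureForm_mem_soulIdeal cov x) hS hW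

/-- The trace of the power `2(m+1)` has form degree `4(m+1)` and picks up `(2πr)^(2(m+1))`, which
turns `(2π)^(-4(m+1))` into `(r/2π)^(2(m+1))`. -/
theorem evenScale_aHatForm (hcov : IsLeviCivita cov) (x : X) {r : ℝ} (hr : 0 < r) :
    evenScale (CoT n x) ((Real.sqrt (2 * Real.pi * r) : ℝ) : ℂ) (aHatForm cov x)
    = expSum (n + 1) (∑ m ∈ Finset.range n, (riemannZeta (2 * (m + 1 : ℕ)) / (2 * (m + 1 : ℕ))
      * (r / (2 * Real.pi) : ℂ) ^ (2 * (m + 1))) • (curvatureForm cov x ^ (2 * (m + 1))).trace) := by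
  rw [aHatForm_eq_expSum hcov]
  refine map_expSum_sum (fun m => evenScale_trace_curvatureForm_pow cov _ x (2 * (m + 1))) ?_ _ _
  intro m
  have hp : (Real.pi : ℂ) ≠ 0 := by exact_mod_cast Real.pi_ne_zero
  have h1 : (((Real.sqrt (2 * Real.pi * r) : ℝ) : ℂ)) ^ 2 = 2 * Real.pi * r := by
    rw [← Complex.ofReal_pow, Real.sq_sqrt (by positivity)]; push_cast; ring
  have hP : (2 * Real.pi : ℂ) ^ (2 * (m + 1)) ≠ 0 := pow_ne_zero _ (mul_ne_zero two_ne_zero hp)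
  rw [pow_mul _ 2, h1, mul_pow (2 * (Real.pi : ℂ)) (r : ℂ), div_pow,
    show 4 * (m + 1) = 2 * (m + 1) + 2 * (m + 1) by ring, pow_add]
  generalize (2 * Real.pi : ℂ) ^ (2 * (m + 1)) = P at hP ⊢
  field_simp

end AHatForm

/-! ### Closed forms: products, exponentials and degree scaling -/

section ClosedForms

variable {n : ℕ} {X : Type*} [TopologicalSpace X] [ChartedSpace (EuclideanSpace ℝ (Fin n)) X]

theorem IsExtDeriv.mul_closed {w w' : Form n X} (h : IsExtDeriv n w 0) (h' : IsExtDeriv n w' 0) :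
    IsExtDeriv n (w * w') 0 := by
  intro x₀
  have := HasExtDerivAt.mul (h x₀) (h' x₀)
  rwa [zero_mul, mul_zero, add_zero] at this

theorem IsExtDeriv.one : IsExtDeriv n (1 : Form n X) 0 := by
  intro x₀
  refine (HasExtDerivAt.coeff (n := n) (f := fun _ => 1) isOpen_univ contMDiffOn_const
    (Set.mem_univ x₀)).congr isOpen_univ (Set.mem_univ x₀) (fun y _ => ?_) (fun y _ => ?_)
  · simp
  · unfold dAt; rw [mvfderiv_const, map_zero]; rfl

theorem IsExtDeriv.pow_closed {w : Form n X} (h : IsExtDeriv n w 0) (k : ℕ) :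
    IsExtDeriv n (w ^ k) 0 := by
  induction k with
  | zero => rw [pow_zero]; exact IsExtDeriv.one
  | succ k ih => rw [pow_succ]; exact ih.mul_closed h

theorem IsExtDeriv.sum_closed {ι : Type*} (s : Finset ι) {w : ι → Form n X}
    (h : ∀ i ∈ s, IsExtDeriv n (w i) 0) : IsExtDeriv n (∑ i ∈ s, w i) 0 := by
  classical
  induction s using Finset.induction_on with
  | empty => rw [Finset.sum_empty]; exact IsExtDeriv.zero
  | insert i s hi ih =>
    rw [Finset.sum_insert hi]
    have := (h i (Finset.mem_insert_self i s)).add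
      (ih fun j hj => h j (Finset.mem_insert_of_mem hj))
    rwa [add_zero] at this

theorem IsExtDeriv.smul_closed (c : ℂ) {w : Form n X} (h : IsExtDeriv n w 0) :
    IsExtDeriv n (c • w) 0 := by
  have := h.smul c
  rwa [smul_zero] at this

theorem IsExtDeriv.expSum_closed {w : Form n X} (h : IsExtDeriv n w 0) (m : ℕ) :
    IsExtDeriv n (expSum m w) 0 :=
  IsExtDeriv.sum_closed _ fun k _ => (h.pow_closed k).smul_closed _

theorem degScale_degScale {V : Type*} [AddCommGroup V] [Module ℂ V] (a b : ℂ)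
    (z : ExteriorAlgebra ℂ V) : degScale V a (degScale V b z) = degScale V (a * b) z := by
  have : (degScale V a).comp (degScale V b) = degScale V (a * b) := by
    apply ExteriorAlgebra.hom_ext
    ext v
    simp only [LinearMap.comp_apply, AlgHom.toLinearMap_apply, AlgHom.comp_apply, degScale_ι,
      ← smul_smul, map_smul]
    rw [smul_comm]
  exact DFunLike.congr_fun this z

theorem degScale_one {V : Type*} [AddCommGroup V] [Module ℂ V] (z : ExteriorAlgebra ℂ V) :
    degScale V 1 z = z := by
  rw [degScale, one_smul, ExteriorAlgebra.map_id]; rfl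

theorem degScale_prod_dAt (c : ℂ) (y : X) (l : List (X → ℂ)) :
    degScale (CoT n y) c (l.map fun g => dAt n g y).prod
      = c ^ l.length • (l.map fun g => dAt n g y).prod := by
  induction l with
  | nil => simp
  | cons g l ih =>
    rw [List.map_cons, List.prod_cons, map_mul, ih, List.length_cons, dAt, degScale_ι,
      smul_mul_smul_comm, pow_succ']

theorem degScale_eval (c : ℂ) (t : FormTerm X) (y : X) :
    degScale (CoT n y) c (t.eval n y) = c ^ t.diffs.length • t.eval n y := by
  rw [FormTerm.eval, map_smul, degScale_prod_dAt, smul_comm]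

theorem degScale_evalD (c : ℂ) (t : FormTerm X) (y : X) :
    degScale (CoT n y) c (t.evalD n y) = c • c ^ t.diffs.length • t.evalD n y := by
  rw [FormTerm.evalD, map_mul, degScale_prod_dAt]
  rw [dAt, degScale_ι, smul_mul_smul_comm, smul_smul]

/-- The derivative of a term with `k` differentials is homogeneous of degree `k + 1`. Scaling the
vanishing sum by degree and dividing by one factor `c` produces the weights `c ^ k`. -/
theorem sum_pow_smul_evalD {c : ℂ} (hc : c ≠ 0) {ts : List (FormTerm X)} {y : X}
    (h : (ts.map fun t => t.evalD n y).sum = 0) :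
    (ts.map fun t => c ^ t.diffs.length • t.evalD n y).sum = 0 := by
  have h1 := congrArg (fun z => c⁻¹ • degScale (CoT n y) c z) h
  simp only [map_zero, smul_zero] at h1
  rw [map_list_sum, List.map_map, List.smul_sum, List.map_map] at h1
  rw [← h1]
  congr 1
  refine List.map_congr_left fun t _ => ?_
  simp only [Function.comp_apply]
  rw [degScale_evalD, inv_smul_smul₀ hc]

theorem IsExtDeriv.degScale_closed {c : ℂ} (hc : c ≠ 0) {w : Form n X} (h : IsExtDeriv n w 0) :
    IsExtDeriv n (fun x => degScale (CoT n x) c (w x)) 0 := by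
  intro x₀
  obtain ⟨U, hU, hx, ts, hs, he⟩ := h x₀
  refine ⟨U, hU, hx, ts.map fun t => ⟨fun x => c ^ t.diffs.length * t.coeff x, t.diffs⟩, ?_,
    fun y hy => ?_⟩
  · intro t ht
    obtain ⟨t', ht', rfl⟩ := List.mem_map.1 ht
    exact ⟨(ContinuousLinearMap.mul ℝ ℂ (c ^ t'.diffs.length)).contMDiff.comp_contMDiffOn
      (hs t' ht').1, (hs t' ht').2⟩
  · have key : ∀ t ∈ ts, dAt n (fun x => c ^ t.diffs.length * t.coeff x) y
        = c ^ t.diffs.length • dAt n t.coeff y := fun t ht =>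
      dAt_const_smul _ (((hs t ht).1.contMDiffAt (hU.mem_nhds hy)).mdifferentiableAt (by simp))
    constructor
    · change degScale (CoT n y) c (w y) = _
      rw [(he y hy).1, map_list_sum, List.map_map, List.map_map]
      congr 1
      refine List.map_congr_left fun t _ => ?_
      simp only [Function.comp_apply]
      rw [degScale_eval, FormTerm.eval, FormTerm.eval, smul_smul]
    · rw [List.map_map]
      refine (Eq.trans ?_ (sum_pow_smul_evalD hc (he y hy).2.symm)).symm
      congr 1
      refine List.map_congr_left fun t ht => ?_
      simp only [Function.comp_apply]
      rw [FormTerm.evalD, FormTerm.evalD, key t ht, smul_mul_assoc]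

end ClosedForms

/-! ### Closedness of the `Â`-form -/

section AHatClosed

variable {n : ℕ} {X : Type*} [TopologicalSpace X] [T2Space X]
  [ChartedSpace (EuclideanSpace ℝ (Fin n)) X]
  [IsManifold (𝓡 n) ∞ X]
  [RiemannianBundle (fun x : X => TangentSpace (𝓡 n) x)]
  [IsContMDiffRiemannianBundle (𝓡 n) ∞ (EuclideanSpace ℝ (Fin n))
      (fun x : X => TangentSpace (𝓡 n) x)]
  {cov : CovariantDerivative (𝓡 n) (EuclideanSpace ℝ (Fin n))
      (fun x : X => TangentSpace (𝓡 n) x)}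

theorem aHatForm_closed (hcov : IsLeviCivita cov) :
    IsExtDeriv n (fun x : X => (aHatForm cov x : ExteriorAlgebra ℂ (CoT n x))) 0 := by
  have h := (IsExtDeriv.sum_closed (Finset.range n) fun m _ =>
    (isExtDeriv_trace_curvatureForm_pow (X := X) hcov.smooth hcov.torsion_eq_zero
      (2 * (m + 1))).smul_closed (riemannZeta (2 * (m + 1 : ℕ)) / (2 * (m + 1 : ℕ))
      / (2 * Real.pi : ℂ) ^ (4 * (m + 1)))).expSum_closed (n + 1)
  convert h using 1
  funext x
  rw [aHatForm_eq_expSum hcov]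
  have e1 := map_expSum (evenPart (CoT n x)).val (n + 1)
    (∑ m ∈ Finset.range n, (riemannZeta (2 * (m + 1 : ℕ)) / (2 * (m + 1 : ℕ))
      / (2 * Real.pi : ℂ) ^ (4 * (m + 1))) • (curvatureForm cov x ^ (2 * (m + 1))).trace)
  refine Eq.trans e1 ?_
  refine Eq.trans ?_ (map_expSum (Pi.evalAlgHom ℂ (fun x : X => ExteriorAlgebra ℂ (CoT n x)) x)
    (n + 1) _).symm
  congr 1
  rw [map_sum, map_sum]
  rfl

end AHatClosed

/-! ### Closed even forms as supersymmetric functions -/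

section Supersymmetry

variable {n : ℕ} {X : Type*} [TopologicalSpace X] [ChartedSpace (EuclideanSpace ℝ (Fin n)) X]

/-- The inclusion of forms into functions of all odd coordinates. -/
def inclOdd (y : X) : ExteriorAlgebra ℂ (CoT n y) →ₐ[ℂ] Odd n y :=
  ExteriorAlgebra.map (LinearMap.inl ℂ (CoT n y) (ℂ × ℂ))

theorem restrictRho_inclOdd (y : X) (z : ExteriorAlgebra ℂ (CoT n y)) :
    restrictRho n y (inclOdd y z) = z := by
  have : (restrictRho n y).comp (inclOdd y) = AlgHom.id ℂ _ := by
    apply ExteriorAlgebra.hom_ext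
    ext v
    simp [restrictRho, inclOdd]
  exact DFunLike.congr_fun this z

theorem inclOdd_dAt (g : X → ℂ) (y : X) : inclOdd y (dAt n g y) = dOdd n g y := by
  rw [inclOdd, dAt, ExteriorAlgebra.map_apply_ι]; rfl

theorem inclOdd_prod (y : X) (l : List (X → ℂ)) :
    inclOdd y (l.map fun g => dAt n g y).prod = (l.map fun g => dOdd n g y).prod := by
  rw [map_list_prod, List.map_map]
  congr 1
  exact List.map_congr_left fun g _ => inclOdd_dAt g y

theorem nu_mul_rho_mul_nu_mul_rho (y : X) : nu n y * rho n y * (nu n y * rho n y) = 0 := by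
  have h : rho n y * nu n y = -(nu n y * rho n y) := ι_mul_ι_anticomm _ _ _
  have h2 : nu n y * nu n y = 0 := ExteriorAlgebra.ι_sq_zero _
  calc _ = nu n y * (rho n y * nu n y) * rho n y := by simp only [mul_assoc]
    _ = -(nu n y * nu n y * rho n y * rho n y) := by rw [h]; simp only [mul_neg, neg_mul, mul_assoc]
    _ = 0 := by rw [h2]; simp

theorem xi_mul_nu_mul_rho (u r : ℝ) (y : X) : xi n u r y * (nu n y * rho n y) = 0 := by
  have h : rho n y * nu n y = -(nu n y * rho n y) := ι_mul_ι_anticomm _ _ _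
  have h2 : nu n y * nu n y = 0 := ExteriorAlgebra.ι_sq_zero _
  have h3 : rho n y * rho n y = 0 := ExteriorAlgebra.ι_sq_zero _
  rw [xi, add_mul, neg_mul, ← mul_assoc, h2, zero_mul, neg_zero, zero_add, smul_mul_assoc,
    ← mul_assoc, h, neg_mul, mul_assoc, h3, mul_zero, neg_zero, smul_zero]

theorem nu_mul_rho_mul_ι (y : X) (a : CoT n y × ℂ × ℂ) :
    nu n y * rho n y * ExteriorAlgebra.ι ℂ a = ExteriorAlgebra.ι ℂ a * (nu n y * rho n y) := by
  have h1 : rho n y * ExteriorAlgebra.ι ℂ a = -(ExteriorAlgebra.ι ℂ a * rho n y) :=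
    ι_mul_ι_anticomm _ _ _
  have h2 : nu n y * ExteriorAlgebra.ι ℂ a = -(ExteriorAlgebra.ι ℂ a * nu n y) :=
    ι_mul_ι_anticomm _ _ _
  rw [mul_assoc, h1, mul_neg, ← mul_assoc, h2, neg_mul, neg_neg, mul_assoc]

/-- Since `νρ` is central and squares to zero, the `k` factors multiply to `1 - k (i/r) νρ`. -/
theorem prod_psiFactor (r : ℝ) (y : X) (l : List (X → ℂ)) :
    (l.map fun g => psiFactor n r y * dOdd n g y).prod
      = (1 - ((l.length : ℂ) * (Complex.I / (r : ℂ))) • (nu n y * rho n y))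
        * (l.map fun g => dOdd n g y).prod := by
  induction l with
  | nil => simp
  | cons g l ih =>
    rw [List.map_cons, List.prod_cons, ih, List.map_cons, List.prod_cons, List.length_cons]
    have hc : dOdd n g y * (1 - ((l.length : ℂ) * (Complex.I / (r : ℂ))) • (nu n y * rho n y))
        = (1 - ((l.length : ℂ) * (Complex.I / (r : ℂ))) • (nu n y * rho n y)) * dOdd n g y := by
      rw [mul_sub, sub_mul, mul_one, one_mul, mul_smul_comm, smul_mul_assoc, dOdd,
        nu_mul_rho_mul_ι]
    have hp : psiFactor n r y * (1 - ((l.length : ℂ) * (Complex.I / (r : ℂ))) •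
        (nu n y * rho n y))
        = 1 - (((l.length + 1 : ℕ) : ℂ) * (Complex.I / (r : ℂ))) • (nu n y * rho n y) := by
      rw [psiFactor, sub_mul, mul_sub, mul_sub, mul_one, one_mul, mul_one, smul_mul_smul_comm,
        nu_mul_rho_mul_nu_mul_rho, smul_zero, sub_zero, sub_sub, ← add_smul]
      congr 2
      push_cast; ring
    calc _ = psiFactor n r y * (dOdd n g y * (1 - ((l.length : ℂ) * (Complex.I / (r : ℂ))) •
          (nu n y * rho n y))) * (l.map fun g => dOdd n g y).prod := by simp only [mul_assoc]
      _ = psiFactor n r y * (1 - ((l.length : ℂ) * (Complex.I / (r : ℂ))) • (nu n y * rho n y))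
          * (dOdd n g y * (l.map fun g => dOdd n g y).prod) := by rw [hc]; simp only [mul_assoc]
      _ = _ := by rw [hp]

/-- The term `(c r)^(k/2) f dg₁ ⋯ dgₖ`. -/
def scaledTerm (c : ℝ) (t : FormTerm X) : SuperTerm X where
  coeff r y := (Real.sqrt (c * r) : ℂ) ^ t.diffs.length * t.coeff y
  rhoPow := 0
  diffs := t.diffs

theorem scaledTerm_smoothOn {c : ℝ} (hc : 0 < c) {t : FormTerm X} {U : Set X}
    (h : t.SmoothOn n U) : (scaledTerm c t).SmoothOn n (Set.Ioi 0) U := by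
  refine ⟨?_, h.2⟩
  have h1 : ContMDiffOn (𝓘(ℝ, ℝ).prod (𝓡 n)) 𝓘(ℝ, ℂ) ∞ (fun p : ℝ × X => t.coeff p.2)
      (Set.Ioi 0 ×ˢ U) := h.1.comp contMDiff_snd.contMDiffOn fun p hp => hp.2
  have h2 : ContMDiffOn (𝓘(ℝ, ℝ).prod (𝓡 n)) 𝓘(ℝ, ℂ) ∞
      (fun p : ℝ × X => (Real.sqrt (c * p.1) : ℂ) ^ t.diffs.length) (Set.Ioi 0 ×ˢ U) := by
    have h3 : ContDiffOn ℝ ∞ (fun r : ℝ => (Real.sqrt (c * r) : ℂ) ^ t.diffs.length)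
        (Set.Ioi 0) := by
      refine ContDiffOn.pow ?_ _
      refine Complex.ofRealCLM.contDiff.comp_contDiffOn ?_
      refine ContDiffOn.sqrt (contDiff_const.mul contDiff_id).contDiffOn fun x hx => ?_
      exact (mul_pos hc hx).ne'
    exact h3.contMDiffOn.comp contMDiff_fst.contMDiffOn fun p hp => hp.1
  exact (contDiff_mul (𝕜 := ℝ) (𝔸 := ℂ)).contMDiff.comp_contMDiffOn (h2.prodMk_space h1)

theorem scaledTerm_eval (c r : ℝ) (t : FormTerm X) (y : X) : (scaledTerm c t).eval n r y
    = inclOdd y (degScale (CoT n y) (Real.sqrt (c * r) : ℂ) (t.eval n y)) := by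
  rw [degScale_eval, FormTerm.eval, map_smul, map_smul, inclOdd_prod, smul_smul, SuperTerm.eval,
    scaledTerm, pow_zero, one_mul]

theorem scaledTerm_reflect (c r : ℝ) (t : FormTerm X) (y : X) : (scaledTerm c t).reflect n r y
    = inclOdd y (degScale (CoT n y) (Real.sqrt (c * r) : ℂ)
      (degScale (CoT n y) (-1) (t.eval n y))) := by
  have h : ∀ l : List (X → ℂ), (l.map fun g => -dOdd n g y).prod
      = (-1 : ℂ) ^ l.length • (l.map fun g => dOdd n g y).prod := by
    intro l
    induction l with
    | nil => simp
    | cons g l ih =>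
      rw [List.map_cons, List.prod_cons, ih, List.map_cons, List.prod_cons, List.length_cons,
        neg_mul, mul_smul_comm, pow_succ', mul_smul, neg_one_smul]
  rw [degScale_eval, map_smul, map_smul, ← scaledTerm_eval, SuperTerm.reflect, SuperTerm.eval]
  change _ • ((-rho n y) ^ 0 * (t.diffs.map _).prod) = _
  rw [h, pow_zero, one_mul, smul_comm, scaledTerm, pow_zero, one_mul]

theorem deriv_sqrt_pow {c r : ℝ} (hc : 0 < c) (hr : 0 < r) (k : ℕ) (a : ℂ) :
    deriv (fun r' : ℝ => (Real.sqrt (c * r') : ℂ) ^ k * a) r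
      = (k : ℂ) / (2 * r) * ((Real.sqrt (c * r) : ℂ) ^ k * a) := by
  have hcr : 0 < c * r := mul_pos hc hr
  have h1 : HasDerivAt (fun r' : ℝ => Real.sqrt (c * r')) (c / (2 * Real.sqrt (c * r))) r := by
    have := ((hasDerivAt_id r).const_mul c).sqrt hcr.ne'
    simpa using this
  have h2 := (h1.ofReal_comp.pow k).mul_const a
  have h3 : HasDerivAt (fun r' : ℝ => (Real.sqrt (c * r') : ℂ) ^ k * a) _ r := h2
  rw [h3.deriv]
  have hs : (Real.sqrt (c * r) : ℂ) ≠ 0 := by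
    exact_mod_cast (Real.sqrt_pos.2 hcr).ne'
  have hs2 : (Real.sqrt (c * r) : ℂ) * (Real.sqrt (c * r) : ℂ) = c * r := by
    rw [← Complex.ofReal_mul, Real.mul_self_sqrt hcr.le]; push_cast; ring
  have hr' : (r : ℂ) ≠ 0 := by exact_mod_cast hr.ne'
  cases k with
  | zero => simp
  | succ k =>
    push_cast
    rw [pow_succ]
    field_simp
    linear_combination -a * hs2

/-- Differentiating `r^(k/2)` gives `k/(2r)`, so the change `2iνρ` of `r` contributes `k (i/r) νρ`,
exactly offset by the rescaling of `k` factors `ψ`. This is what forces the weight `r^(k/2)`. The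
change of `x` leaves `ξ` times the exterior derivative, and further products vanish because `ξνρ =
0`. -/
theorem scaledTerm_translate {c r : ℝ} (hc : 0 < c) (hr : 0 < r) (u : ℝ) {t : FormTerm X} {y : X}
    (ht : MDifferentiableAt (𝓡 n) 𝓘(ℝ, ℂ) t.coeff y) : (scaledTerm c t).translate n u r y
    = (scaledTerm c t).eval n r y + xi n u r y * inclOdd y
      ((Real.sqrt (c * r) : ℂ) ^ t.diffs.length • t.evalD n y) := by
  set k := t.diffs.length with hk
  set s : ℂ := (Real.sqrt (c * r) : ℂ) ^ k with hs
  set D := (t.diffs.map fun g => dOdd n g y).prod with hD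
  have hd : dOdd n ((scaledTerm c t).coeff r) y = s • dOdd n t.coeff y := by
    rw [← inclOdd_dAt, ← inclOdd_dAt, ← map_smul, ← dAt_const_smul _ ht]
    rfl
  have h1 : inclOdd y (s • t.evalD n y) = s • (dOdd n t.coeff y * D) := by
    rw [map_smul, FormTerm.evalD, map_mul, inclOdd_dAt, inclOdd_prod]
  rw [SuperTerm.translate, hd, h1]
  change (algebraMap ℂ (Odd n y) (s * t.coeff y) + (2 * Complex.I * deriv (fun r' : ℝ =>
    (Real.sqrt (c * r') : ℂ) ^ k * t.coeff y) r) • (nu n y * rho n y) + xi n u r y *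
    s • dOdd n t.coeff y) * (rho n y ^ 0 * (t.diffs.map fun g => psiFactor n r y * dOdd n g y).prod)
    = (s * t.coeff y) • (rho n y ^ 0 * D) + _
  rw [deriv_sqrt_pow hc hr, prod_psiFactor, pow_zero, one_mul, one_mul, ← hk, ← hs, ← hD, ← mul_assoc]
  have hr' : (r : ℂ) ≠ 0 := by exact_mod_cast hr.ne'
  have hx : xi n u r y * s • dOdd n t.coeff y * ((k * (Complex.I / (r : ℂ))) • (nu n y * rho n y))
      = 0 := by
    rw [mul_smul_comm, mul_smul_comm, smul_mul_assoc, mul_assoc, dOdd, ← nu_mul_rho_mul_ι,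
      ← mul_assoc, xi_mul_nu_mul_rho, zero_mul, smul_zero, smul_zero]
  have hf : (algebraMap ℂ (Odd n y) (s * t.coeff y) + (2 * Complex.I * ((k : ℂ) / (2 * r) *
      (s * t.coeff y))) • (nu n y * rho n y))
      * (1 - (k * (Complex.I / (r : ℂ))) • (nu n y * rho n y))
      = algebraMap ℂ (Odd n y) (s * t.coeff y) := by
    rw [add_mul, mul_sub, mul_sub, mul_one, mul_one, smul_mul_smul_comm,
      nu_mul_rho_mul_nu_mul_rho, smul_zero, sub_zero, ← Algebra.smul_def, smul_smul,
      show s * t.coeff y * (k * (Complex.I / (r : ℂ)))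
        = 2 * Complex.I * ((k : ℂ) / (2 * r) * (s * t.coeff y)) by field_simp, sub_add_cancel]
  rw [add_mul, hf, mul_sub, mul_one, hx, sub_zero, add_mul, ← Algebra.smul_def, mul_smul_comm,
    smul_mul_assoc, mul_smul_comm, mul_assoc]

/-- A closed even form, scaled by degree, is a supersymmetric function. -/
theorem isSupersymmetric_of_closed {w : Form n X} (hw : IsExtDeriv n w 0)
    (he : ∀ x, w x ∈ evenPart (CoT n x)) {c : ℝ} (hc : 0 < c) {f : ℝ → Form n X}
    (hf : ∀ r : ℝ, 0 < r → ∀ x, f r x = degScale (CoT n x) (Real.sqrt (c * r) : ℂ) (w x)) :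
    IsSupersymmetric n f := by
  -- The invariant extension can be taken independent of `ρ`.
  refine ⟨fun r y => inclOdd y (degScale (CoT n y) (Real.sqrt (c * r) : ℂ) (w y)), ?_,
    fun r hr y => by rw [restrictRho_inclOdd, hf r hr]⟩
  intro r₀ hr₀ x₀
  obtain ⟨U, hU, hx, ts, hs, hv⟩ := hw x₀
  refine ⟨Set.Ioi 0, U, isOpen_Ioi, hr₀, hU, hx, ts.map (scaledTerm c), ?_, ?_⟩
  · intro t ht
    obtain ⟨t', ht', rfl⟩ := List.mem_map.1 ht
    exact scaledTerm_smoothOn hc (hs t' ht')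
  intro r hr y hy
  have hr : 0 < r := hr
  have hF : inclOdd y (degScale (CoT n y) (Real.sqrt (c * r) : ℂ) (w y))
      = ((ts.map (scaledTerm c)).map fun t => t.eval n r y).sum := by
    rw [(hv y hy).1, map_list_sum, map_list_sum, List.map_map, List.map_map, List.map_map]
    congr 1
    refine List.map_congr_left fun t _ => ?_
    simp only [Function.comp_apply]
    rw [scaledTerm_eval]
  refine ⟨hF, fun u => ?_, ?_⟩
  · refine Eq.trans ?_ hF.symm
    rw [List.map_map, List.map_map]
    have h1 : ∀ t ∈ ts, ((fun t => t.translate n u r y) ∘ scaledTerm c) t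
        = (scaledTerm c t).eval n r y + xi n u r y * inclOdd y
          ((Real.sqrt (c * r) : ℂ) ^ t.diffs.length • t.evalD n y) := fun t ht =>
      scaledTerm_translate hc hr u
        (((hs t ht).1.contMDiffAt (hU.mem_nhds hy)).mdifferentiableAt (by simp))
    rw [List.map_congr_left h1, List.sum_map_add, List.sum_map_mul_left]
    -- The defect of invariance is `ξ` times the rescaled exterior derivative, which vanishes for a
    -- closed form.
    have h2 : (ts.map fun t => inclOdd y
        ((Real.sqrt (c * r) : ℂ) ^ t.diffs.length • t.evalD n y)).sum = 0 := by
      have h3 := sum_pow_smul_evalD (c := (Real.sqrt (c * r) : ℂ))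
        (by exact_mod_cast (Real.sqrt_pos.2 (mul_pos hc hr)).ne') (hv y hy).2.symm
      have h4 := congrArg (inclOdd y) h3
      rw [map_list_sum, List.map_map, map_zero] at h4
      exact h4
    rw [h2, mul_zero, add_zero]
    rfl
  · have h1 : ((ts.map (scaledTerm c)).map fun t => t.reflect n r y).sum
        = inclOdd y (degScale (CoT n y) (Real.sqrt (c * r) : ℂ)
          (degScale (CoT n y) (-1) (w y))) := by
      rw [(hv y hy).1, map_list_sum, map_list_sum, map_list_sum, List.map_map, List.map_map,
        List.map_map, List.map_map]
      congr 1
      refine List.map_congr_left fun t _ => ?_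
      simp only [Function.comp_apply]
      rw [scaledTerm_reflect]
    exact h1.trans (by rw [degScale_neg_one_of_mem (he y)])

/-- A closed even form is represented by its rescaling. -/
theorem represents_of_closed {w : Form n X} (hw : w ∈ closedEvenForms n X) {f : ℝ → Form n X}
    (hf : ∀ r : ℝ, 0 < r → ∀ x, f r x
      = degScale (CoT n x) ((Real.sqrt (2 * Real.pi * r) : ℝ) : ℂ) (w x)) :
    Represents n f (Submodule.Quotient.mk ⟨w, hw⟩) := by
  have hp : (0 : ℝ) < Real.sqrt (2 * Real.pi) := Real.sqrt_pos.2 (by positivity)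
  have hp' : ((Real.sqrt (2 * Real.pi) : ℝ) : ℂ) ≠ 0 := by exact_mod_cast hp.ne'
  -- The factor `√(2πr)` is split as `√r √(2π)`. Normalization removes the second factor, so the
  -- representing form is `w` itself.
  refine ⟨⟨fun x => degScale (CoT n x) ((Real.sqrt (2 * Real.pi) : ℝ) : ℂ) (w x),
    IsExtDeriv.degScale_closed hp' hw.1, fun x => degScale_mem _ (hw.2 x)⟩, ⟨w, hw⟩, ?_, ?_, rfl⟩
  · intro r hr x
    rw [hf r hr, degScale_degScale, ← Complex.ofReal_mul, ← Real.sqrt_mul hr.le, mul_comm r]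
  · intro x
    change w x = degScale _ _ (degScale _ _ (w x))
    rw [degScale_degScale, ← Complex.ofReal_mul, inv_mul_cancel₀ hp.ne', Complex.ofReal_one,
      degScale_one]

end Supersymmetry

/-! ### Uniqueness of the zeta derivative; meromorphy of `ζ` -/

section Meromorphic

open Filter

/-- A meromorphic function on the plane that vanishes on a half plane and is analytic at the origin
vanishes near the origin. -/
theorem eventually_zero_of_meromorphic {g : ℂ → ℂ} (hg : ∀ s, MeromorphicAt g s) {σ : ℝ}
    (h0 : ∀ s : ℂ, σ < s.re → g s = 0) (ha : AnalyticAt ℂ g 0) : ∀ᶠ s in 𝓝 (0 : ℂ), g s = 0 := by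
  have hm : MeromorphicOn g Set.univ := fun s _ => hg s
  -- The order is infinite at a point of the half plane, and this propagates over the connected
  -- plane.
  have h1 : meromorphicOrderAt g ((σ + 1 : ℝ) : ℂ) = ⊤ := by
    rw [meromorphicOrderAt_eq_top_iff]
    apply eventually_nhdsWithin_of_eventually_nhds
    have : IsOpen {s : ℂ | σ < s.re} := isOpen_lt continuous_const Complex.continuous_re
    filter_upwards [this.mem_nhds (by simp : ((σ + 1 : ℝ) : ℂ) ∈ {s : ℂ | σ < s.re})] with s hs
    exact h0 s hs
  have h2 : meromorphicOrderAt g 0 = ⊤ := by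
    by_contra h
    exact hm.meromorphicOrderAt_ne_top_of_isPreconnected isPreconnected_univ (Set.mem_univ 0)
      (Set.mem_univ ((σ + 1 : ℝ) : ℂ)) h h1
  rw [meromorphicOrderAt_eq_top_iff] at h2
  exact ha.frequently_zero_iff_eventually_zero.1 h2.frequently

/-- Linear functionals separate points, so it is enough to compare coefficients; two continuations
agree on a common half plane, hence near the origin. -/
theorem HasZetaDeriv.unique {A : Type*} [CommRing A] [Algebra ℂ A] {M : Type*} [AddCommGroup M]
    [Module A M] {T : Module.End A M} {S : Set ℂ} {z z' : A} (h : HasZetaDeriv T S z)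
    (h' : HasZetaDeriv T S z') : z = z' := by
  obtain ⟨Z, ⟨σ, hσ⟩, hZ⟩ := h
  obtain ⟨Z', ⟨σ', hσ'⟩, hZ'⟩ := h'
  rw [← sub_eq_zero, ← Module.forall_dual_apply_eq_zero_iff ℂ]
  intro l
  obtain ⟨hm, ha, hd⟩ := hZ l
  obtain ⟨hm', ha', hd'⟩ := hZ' l
  have h := eventually_zero_of_meromorphic (g := fun w => l (Z w) - l (Z' w)) (σ := max σ σ')
    (fun s => (hm s).sub (hm' s)) (fun s hs => by
      rw [sub_eq_zero]
      exact (hσ s ((le_max_left _ _).trans_lt hs) l).unique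
        (hσ' s ((le_max_right _ _).trans_lt hs) l)) (ha.sub ha')
  have h1 : deriv (fun w => l (Z w) - l (Z' w)) 0 = 0 := by
    have : (fun w => l (Z w) - l (Z' w)) =ᶠ[𝓝 0] fun _ => (0 : ℂ) := h
    rw [this.deriv_eq, deriv_const]
  rw [deriv_fun_sub ha.differentiableAt ha'.differentiableAt, hd, hd'] at h1
  rw [map_sub, h1]

theorem analyticAt_riemannZeta {s : ℂ} (hs : s ≠ 1) : AnalyticAt ℂ riemannZeta s := by
  have h : ∀ᶠ z in 𝓝 s, z ≠ 1 := isOpen_ne.mem_nhds hs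
  exact Complex.analyticAt_of_differentiable_on_punctured_nhds_of_continuousAt
    (eventually_nhdsWithin_of_eventually_nhds (h.mono fun _ hz => differentiableAt_riemannZeta hz))
    (differentiableAt_riemannZeta hs).continuousAt

theorem meromorphicAt_riemannZeta (s : ℂ) : MeromorphicAt riemannZeta s := by
  rcases eq_or_ne s 1 with rfl | hs
  -- The exponent is `2` although the pole is simple. With exponent `1` the product takes the value
  -- `0` at `1` but tends to `1`; with the square both are `0`.
  · refine ⟨2, Complex.analyticAt_of_differentiable_on_punctured_nhds_of_continuousAt ?_ ?_⟩
    · filter_upwards [self_mem_nhdsWithin] with z hz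
      exact ((differentiableAt_id.sub_const 1).pow 2).smul (differentiableAt_riemannZeta hz)
    · rw [continuousAt_iff_punctured_nhds]
      have h1 : Tendsto (fun z : ℂ => (z - 1) * ((z - 1) * riemannZeta z)) (𝓝[≠] 1)
          (𝓝 (0 * 1)) := by
        refine Tendsto.mul ?_ riemannZeta_residue_one
        have : Tendsto (fun z : ℂ => z - 1) (𝓝 1) (𝓝 (1 - 1)) :=
          (continuous_id.sub continuous_const).tendsto 1
        rw [sub_self] at this
        exact this.mono_left nhdsWithin_le_nhds
      simpa [pow_two, mul_assoc] using h1
  · exact (analyticAt_riemannZeta hs).meromorphicAt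

end Meromorphic

/-! ### Binomial coefficients as functions of `s` -/

section Binomial

theorem choose_eq_prod (a : ℂ) (j : ℕ) :
    Ring.choose a j = (j.factorial : ℂ)⁻¹ * ∏ i ∈ Finset.range j, (a - i) := by
  rw [Ring.choose_eq_smul, smul_eq_mul, ← descPochhammer_eval_eq_prod_range,
    ← Polynomial.aeval_eq_smeval, ← descPochhammer_map (Int.castRingHom ℂ), Polynomial.eval_map]
  rfl

theorem analyticAt_choose_neg (j : ℕ) (s : ℂ) : AnalyticAt ℂ (fun s => Ring.choose (-s) j) s := by
  simp only [choose_eq_prod]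
  refine analyticAt_const.mul ?_
  exact Finset.analyticAt_fun_prod _ fun i _ => analyticAt_id.neg.sub analyticAt_const

/-- For `j ≥ 1` the binomial has a factor `s`, so the derivative at `0` sees only the value of `g`
there. -/
theorem deriv_choose_neg_mul {j : ℕ} (hj : j ≠ 0) {g : ℂ → ℂ} (hg : AnalyticAt ℂ g 0) :
    deriv (fun s => Ring.choose (-s) j * g s) 0 = (-1) ^ j / j * g 0 := by
  obtain ⟨j, rfl⟩ := Nat.exists_eq_succ_of_ne_zero hj
  set q : ℂ → ℂ := fun s => -(((j + 1).factorial : ℂ)⁻¹ * ∏ i ∈ Finset.range j,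
    (-s - ((i + 1 : ℕ) : ℂ))) with hq
  have hqa : AnalyticAt ℂ q 0 := by
    refine (analyticAt_const.mul ?_).neg
    exact Finset.analyticAt_fun_prod _ fun i _ => analyticAt_id.neg.sub analyticAt_const
  have he : (fun s => Ring.choose (-s) (j + 1) * g s) = fun s => s * (q s * g s) := by
    funext s
    rw [choose_eq_prod, Finset.prod_range_succ', hq]
    simp
    ring
  have hq0 : q 0 = (-1) ^ (j + 1) / (j + 1 : ℕ) := by
    have : ∏ i ∈ Finset.range j, (-(0 : ℂ) - ((i + 1 : ℕ) : ℂ)) = (-1) ^ j * j.factorial := by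
      rw [← Finset.prod_range_add_one_eq_factorial, Nat.cast_prod, ← Finset.card_range j,
        ← Finset.prod_const, Finset.card_range, ← Finset.prod_mul_distrib]
      refine Finset.prod_congr rfl fun i _ => ?_
      ring
    rw [hq]
    simp only [this]
    have h1 : (j.factorial : ℂ) ≠ 0 := by exact_mod_cast Nat.factorial_ne_zero _
    have := Nat.cast_add_one_ne_zero (R := ℂ) j
    rw [Nat.factorial_succ]
    push_cast
    field_simp
    ring
  have hd := (hasDerivAt_id (0 : ℂ)).mul (hqa.mul hg).differentiableAt.hasDerivAt
  change deriv (fun s => Ring.choose (-s) (j + 1) * g s) 0 = _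
  rw [he]
  have h2 : deriv (fun s => s * (q s * g s)) 0 = _ := hd.deriv
  rw [h2]
  simp [hq0]

end Binomial

/-! ### The zeta function of an operator with spectrum `(ck)^p` -/

section Spectrum

/-- `x ^ w` for a positive number `x`. -/
def posPow (x : ℝ) (w : ℂ) : ℂ := Complex.exp (Real.log x * w)

theorem posPow_mul {x y : ℝ} (hx : 0 < x) (hy : 0 < y) (w : ℂ) :
    posPow (x * y) w = posPow x w * posPow y w := by
  rw [posPow, posPow, posPow, Real.log_mul hx.ne' hy.ne', ← Complex.exp_add]
  push_cast
  ring_nf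

theorem posPow_add (x : ℝ) (w w' : ℂ) : posPow x (w + w') = posPow x w * posPow x w' := by
  rw [posPow, posPow, posPow, ← Complex.exp_add, mul_add]

theorem posPow_neg_nat {x : ℝ} (hx : 0 < x) (j : ℕ) : posPow x (-j) = ((x : ℂ) ^ j)⁻¹ := by
  rw [posPow, mul_neg, Complex.exp_neg, mul_comm, Complex.exp_nat_mul, ← Complex.ofReal_exp,
    Real.exp_log hx]

theorem pow_cpow_eq_posPow {x : ℝ} (hx : 0 < x) (p : ℕ) (s : ℂ) :
    ((x : ℂ) ^ p) ^ s = posPow x (p * s) := by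
  have h : ((x : ℂ) ^ p) ≠ 0 := pow_ne_zero _ (by exact_mod_cast hx.ne')
  rw [Complex.cpow_def_of_ne_zero h, ← Complex.ofReal_pow, ← Complex.ofReal_log (by positivity),
    Real.log_pow, posPow]
  push_cast
  ring_nf

theorem analyticAt_posPow (x : ℝ) (w : ℂ) : AnalyticAt ℂ (posPow x) w :=
  (analyticAt_const.mul analyticAt_id).cexp

theorem hasSum_posPow {w : ℂ} (hw : 1 < w.re) :
    HasSum (fun k : ℕ => posPow (k + 1 : ℝ) (-w)) (riemannZeta w) := by
  have h1 : Summable fun k : ℕ => 1 / (((k + 1 : ℕ) : ℂ)) ^ w :=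
    (summable_nat_add_iff 1).2 (Complex.summable_one_div_nat_cpow.2 hw)
  have h2 := h1.hasSum
  have h3 : ∑' k : ℕ, 1 / (((k + 1 : ℕ) : ℂ)) ^ w = riemannZeta w := by
    rw [zeta_eq_tsum_one_div_nat_add_one_cpow hw]
    simp
  rw [h3] at h2
  convert h2 using 1
  funext k
  have h4 : ((k : ℝ) + 1) > 0 := by positivity
  have := pow_cpow_eq_posPow h4 1 w
  rw [pow_one, Nat.cast_one, one_mul] at this
  push_cast at this ⊢
  rw [this, posPow, posPow, mul_neg, Complex.exp_neg, one_div]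

variable {A : Type*} [CommRing A] [Algebra ℂ A] {M : Type*} [AddCommGroup M] [Module A M]

/-- The coefficient functions of the zeta function. -/
def zetaCoeff (c : ℝ) (p j : ℕ) (s : ℂ) : ℂ :=
  Ring.choose (-s) j * (posPow c (-(p * s + j)) * riemannZeta (p * s + j))

theorem analyticAt_affine (p j : ℕ) (s : ℂ) : AnalyticAt ℂ (fun s : ℂ => (p : ℂ) * s + j) s :=
  (analyticAt_const.mul analyticAt_id).add analyticAt_const

theorem meromorphicAt_zetaCoeff (c : ℝ) (p j : ℕ) (s : ℂ) :
    MeromorphicAt (zetaCoeff c p j) s := by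
  refine (analyticAt_choose_neg j s).meromorphicAt.mul (MeromorphicAt.mul ?_ ?_)
  · exact ((analyticAt_posPow c _).comp (analyticAt_affine p j s).neg).meromorphicAt
  · exact (meromorphicAt_riemannZeta _).comp_analyticAt (analyticAt_affine p j s)

/-- At `s = 0` the argument of `ζ` is `j`, so `j = 1` is the only case that hits the pole. -/
theorem analyticAt_posPow_mul_zeta (c : ℝ) (p : ℕ) {j : ℕ} (hj : j ≠ 1) :
    AnalyticAt ℂ (fun s : ℂ => posPow c (-(p * s + j)) * riemannZeta (p * s + j)) 0 := by
  refine AnalyticAt.mul ?_ ?_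
  · exact (analyticAt_posPow c _).comp (analyticAt_affine p j 0).neg
  · refine AnalyticAt.comp (g := riemannZeta) (analyticAt_riemannZeta ?_) (analyticAt_affine p j 0)
    simpa using hj

theorem analyticAt_zetaCoeff (c : ℝ) (p : ℕ) {j : ℕ} (hj : j ≠ 1) :
    AnalyticAt ℂ (zetaCoeff c p j) 0 :=
  (analyticAt_choose_neg j 0).mul (analyticAt_posPow_mul_zeta c p hj)

theorem deriv_zetaCoeff {c : ℝ} (hc : 0 < c) (p : ℕ) {j : ℕ} (hj : j ≠ 0) (hj1 : j ≠ 1) :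
    deriv (zetaCoeff c p j) 0 = (-1) ^ j / j * (((c : ℂ) ^ j)⁻¹ * riemannZeta j) := by
  have := deriv_choose_neg_mul hj (analyticAt_posPow_mul_zeta c p hj1)
  rw [mul_zero, zero_add, posPow_neg_nat hc] at this
  exact this

/-- The zeta function of an operator with eigenvalues `(c k) ^ p`, `k ≥ 1`, for which the traces of
the nilpotent parts are homogeneous in `k`. -/
theorem hasZetaDeriv_of_spectrum {T : Module.End A M} {S : Set ℂ} {c : ℝ} (hc : 0 < c) {p : ℕ}
    (hp : p ≠ 0) {N : ℕ} {a : ℕ → A} (ha : a 1 = 0)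
    (hS : ∀ k : ℕ, ((c * (k + 1) : ℝ) : ℂ) ^ p ∈ S)
    (hT : ∀ (k : ℕ) (s : ℂ), zetaTerm T s (((c * (k + 1) : ℝ) : ℂ) ^ p)
      = ((((c * (k + 1) : ℝ) : ℂ) ^ p) ^ (-s)) • ∑ j ∈ Finset.range N,
        Ring.choose (-s) j • ((((c * (k + 1) : ℝ) : ℂ) ^ j)⁻¹ • a j))
    (h0 : ∀ μ ∈ S, (∀ k : ℕ, μ ≠ ((c * (k + 1) : ℝ) : ℂ) ^ p) → ∀ s, zetaTerm T s μ = 0) :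
    HasZetaDeriv T S (∑ j ∈ Finset.range N, deriv (zetaCoeff c p j) 0 • a j) := by
  -- The term `j = 1`, which would involve the pole of `ζ`, is discarded using `a 1 = 0`.
  have hl : ∀ (l : A →ₗ[ℂ] ℂ), (fun s => l (∑ j ∈ Finset.range N, zetaCoeff c p j s • a j))
      = fun s => ∑ j ∈ (Finset.range N).erase 1, zetaCoeff c p j s * l (a j) := by
    intro l
    funext s
    rw [map_sum]
    simp only [map_smul, smul_eq_mul]
    refine (Finset.sum_subset (Finset.erase_subset _ _) fun j hj' hj => ?_).symm
    have : j = 1 := by_contra fun hne => hj (Finset.mem_erase.2 ⟨hne, hj'⟩)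
    rw [this, ha, map_zero, mul_zero]
  -- The abscissa `2` is more than enough: as `p ≥ 1`, all arguments `ps + j` have real part above
  -- `1`.
  refine ⟨fun s => ∑ j ∈ Finset.range N, zetaCoeff c p j s • a j, ⟨2, fun s hs l => ?_⟩,
    fun l => ⟨fun s => ?_, ?_, ?_⟩⟩
  · have hpos : ∀ k : ℕ, 0 < c * (k + 1 : ℝ) := fun k => by positivity
    have hinj : Function.Injective fun k : ℕ => (⟨_, hS k⟩ : S) := by
      intro k k' h
      have h1 : ((c * (k + 1) : ℝ) : ℂ) ^ p = ((c * (k' + 1) : ℝ) : ℂ) ^ p := congrArg Subtype.val h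
      have h2 : (c * (k + 1) : ℝ) ^ p = (c * (k' + 1)) ^ p := by exact_mod_cast h1
      have h3 := (pow_left_inj₀ (hpos k).le (hpos k').le hp).1 h2
      have h4 := mul_left_cancel₀ hc.ne' h3
      exact_mod_cast add_right_cancel h4
    rw [← hinj.hasSum_iff]
    · have hterm : ∀ k : ℕ, l (zetaTerm T s (((c * (k + 1) : ℝ) : ℂ) ^ p))
          = ∑ j ∈ Finset.range N, (Ring.choose (-s) j * posPow c (-(p * s + j)) * l (a j)) *
            posPow (k + 1 : ℝ) (-(p * s + j)) := by
        intro k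
        rw [hT, map_smul, map_sum, smul_eq_mul, Finset.mul_sum]
        refine Finset.sum_congr rfl fun j _ => ?_
        rw [map_smul, map_smul, smul_eq_mul, smul_eq_mul, pow_cpow_eq_posPow (hpos k),
          ← posPow_neg_nat (hpos k)]
        have : posPow (c * (k + 1)) (-(p * s + j))
            = posPow (c * (k + 1)) (p * -s) * posPow (c * (k + 1)) (-j) := by
          rw [← posPow_add]; congr 1; ring
        rw [posPow_mul hc (by positivity)] at this
        linear_combination -(Ring.choose (-s) j * l (a j)) * this
      have : ((fun μ : S => l (zetaTerm T s μ)) ∘ fun k : ℕ => (⟨_, hS k⟩ : S))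
          = fun k : ℕ => ∑ j ∈ Finset.range N, (Ring.choose (-s) j * posPow c (-(p * s + j)) *
            l (a j)) * posPow (k + 1 : ℝ) (-(p * s + j)) := funext hterm
      rw [this, map_sum]
      refine hasSum_sum fun j _ => ?_
      rw [map_smul, smul_eq_mul, show zetaCoeff c p j s * l (a j) = (Ring.choose (-s) j *
        posPow c (-(p * s + j)) * l (a j)) * riemannZeta (p * s + j) by rw [zetaCoeff]; ring]
      refine (hasSum_posPow ?_).mul_left _
      have hp1 : (1 : ℝ) ≤ p := by exact_mod_cast Nat.one_le_iff_ne_zero.2 hp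
      have : ((p : ℂ) * s + j).re = p * s.re + j := by simp
      rw [this]
      have hj : (0 : ℝ) ≤ j := Nat.cast_nonneg j
      nlinarith
    · intro μ hμ
      rw [h0 μ μ.2 (fun k hk => hμ ⟨k, Subtype.ext hk.symm⟩), map_zero]
  · rw [hl]
    exact MeromorphicAt.fun_sum fun j _ =>
      (meromorphicAt_zetaCoeff c p j s).mul (MeromorphicAt.const _ _)
  · rw [hl]
    exact Finset.analyticAt_fun_sum _ fun j hj =>
      (analyticAt_zetaCoeff c p (Finset.ne_of_mem_erase hj)).mul analyticAt_const
  · have hd : ∀ j ∈ (Finset.range N).erase 1,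
        DifferentiableAt ℂ (fun s => zetaCoeff c p j s * l (a j)) 0 := fun j hj =>
      ((analyticAt_zetaCoeff c p (Finset.ne_of_mem_erase hj)).mul analyticAt_const).differentiableAt
    rw [hl, deriv_fun_sum hd, map_sum]
    simp only [map_smul, smul_eq_mul]
    refine Eq.trans (Finset.sum_congr rfl fun j hj => ?_)
      (Finset.sum_subset (Finset.erase_subset 1 _) fun j hj' hj => ?_)
    · rw [deriv_mul_const
        (analyticAt_zetaCoeff c p (Finset.ne_of_mem_erase hj)).differentiableAt]
    · have : j = 1 := by_contra fun hne => hj (Finset.mem_erase.2 ⟨hne, hj'⟩)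
      rw [this, ha, map_zero, mul_zero]

end Spectrum

/-! ### Fourier modes on the circle -/

section Circle

open Complex

variable {r : ℝ}

/-- The frequency of the `m`-th Fourier mode on the circle of circumference `r`. -/
def modeFreq (r : ℝ) (m : ℤ) : ℂ := I * ((2 * Real.pi / r * m : ℝ) : ℂ)

theorem exp_modeFreq_mul (hr : r ≠ 0) (m : ℤ) : exp (modeFreq r m * r) = 1 := by
  have hr' : (r : ℂ) ≠ 0 := by exact_mod_cast hr
  rw [modeFreq, show I * ((2 * Real.pi / r * m : ℝ) : ℂ) * r = m * (2 * Real.pi * I) by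
    push_cast; field_simp]
  exact exp_int_mul_two_pi_mul_I m

theorem modeFreq_ne_zero (hr : r ≠ 0) {m : ℤ} (hm : m ≠ 0) : modeFreq r m ≠ 0 := by
  refine mul_ne_zero I_ne_zero ?_
  have : (m : ℝ) ≠ 0 := by exact_mod_cast hm
  exact_mod_cast mul_ne_zero (div_ne_zero Real.two_pi_pos.ne' hr) this

theorem integral_exp_modeFreq (hr : r ≠ 0) {m : ℤ} (hm : m ≠ 0) :
    ∫ t in (0 : ℝ)..r, exp (modeFreq r m * t) = 0 := by
  rw [integral_exp_mul_complex (modeFreq_ne_zero hr hm), exp_modeFreq_mul hr]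
  simp

theorem contDiff_exp_mul (a : ℂ) : ContDiff ℝ ∞ fun t : ℝ => exp (a * t) :=
  (contDiff_const.mul ofRealCLM.contDiff).cexp

/-- The `m`-th Fourier mode, projected to the complement of the constants. -/
def fourierMode (hr : 0 < r) (m : ℤ) : circleFun r :=
  if hm : m ≠ 0 then
    ⟨fun t => exp (modeFreq r m * t), contDiff_exp_mul _, fun t => by
      change exp (modeFreq r m * (t + r : ℝ)) = exp (modeFreq r m * t)
      rw [ofReal_add, mul_add, exp_add, exp_modeFreq_mul hr.ne', mul_one],
      integral_exp_modeFreq hr.ne' hm⟩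
  else 0

theorem fourierMode_zero (hr : 0 < r) : fourierMode hr 0 = 0 := by simp [fourierMode]

theorem fourierMode_apply (hr : 0 < r) {m : ℤ} (hm : m ≠ 0) (t : ℝ) :
    (fourierMode hr m).1 t = exp (modeFreq r m * t) := by rw [fourierMode, dif_pos hm]

theorem hasDerivAt_exp_mul (a : ℂ) (t : ℝ) :
    HasDerivAt (fun t : ℝ => exp (a * t)) (a * exp (a * t)) t := by
  have h : HasDerivAt (fun z : ℂ => exp (a * z)) (exp (a * t) * (a * 1)) t :=
    ((hasDerivAt_id (t : ℂ)).const_mul a).cexp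
  rw [mul_comm a]
  simpa using h.comp_ofReal

theorem ddt_fourierMode (hr : 0 < r) (m : ℤ) :
    ddt r (fourierMode hr m) = modeFreq r m • fourierMode hr m := by
  rcases eq_or_ne m 0 with rfl | hm
  · rw [fourierMode_zero, map_zero, smul_zero]
  · refine Subtype.ext (funext fun t => ?_)
    have h : (fourierMode hr m).1 = fun t : ℝ => exp (modeFreq r m * t) :=
      funext fun t => fourierMode_apply hr hm t
    change deriv (fourierMode hr m).1 t = modeFreq r m • (fourierMode hr m).1 t
    rw [h]
    exact (hasDerivAt_exp_mul (modeFreq r m) t).deriv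

/-- The `m`-th Fourier coefficient. -/
def modeCoeff (r : ℝ) (m : ℤ) : circleFun r →ₗ[ℂ] ℂ where
  toFun f := (1 / r : ℂ) * ∫ t in (0 : ℝ)..r, exp (modeFreq r (-m) * t) * f.1 t
  map_add' f g := by
    have hi : ∀ f : circleFun r, IntervalIntegrable (fun t : ℝ => exp (modeFreq r (-m) * t) * f.1 t)
        MeasureTheory.volume 0 r := fun f =>
      ((contDiff_exp_mul _).continuous.mul f.2.1.continuous).intervalIntegrable _ _
    rw [← mul_add, ← intervalIntegral.integral_add (hi f) (hi g)]
    simp only [Submodule.coe_add, Pi.add_apply, mul_add]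
  map_smul' c f := by
    have : ∀ t : ℝ, exp (modeFreq r (-m) * t) * (c • f).1 t
        = c * (exp (modeFreq r (-m) * t) * f.1 t) := fun t => by
      rw [SetLike.val_smul, Pi.smul_apply, smul_eq_mul]; ring
    simp only [this, intervalIntegral.integral_const_mul, RingHom.id_apply, smul_eq_mul]
    ring

theorem modeCoeff_apply (m : ℤ) (f : circleFun r) :
    modeCoeff r m f = (1 / r : ℂ) * ∫ t in (0 : ℝ)..r, exp (modeFreq r (-m) * t) * f.1 t := rfl

theorem modeFreq_neg (m : ℤ) : modeFreq r (-m) = -modeFreq r m := by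
  rw [modeFreq, modeFreq]; push_cast; ring

theorem modeFreq_add (m m' : ℤ) : modeFreq r (m + m') = modeFreq r m + modeFreq r m' := by
  rw [modeFreq, modeFreq, modeFreq]; push_cast; ring

/-- Integration by parts; the boundary terms cancel by periodicity. -/
theorem modeCoeff_ddt (hr : 0 < r) (m : ℤ) (f : circleFun r) :
    modeCoeff r m (ddt r f) = modeFreq r m * modeCoeff r m f := by
  have hf : ∀ t, HasDerivAt f.1 (deriv f.1 t) t := fun t =>
    (f.2.1.differentiable (by simp) t).hasDerivAt
  have hd : Continuous (deriv f.1) := ((contDiff_infty_iff_deriv.1 f.2.1).2).continuous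
  have h := intervalIntegral.integral_mul_deriv_eq_deriv_mul (a := 0) (b := r)
    (u := fun t : ℝ => exp (modeFreq r (-m) * t)) (v := f.1)
    (fun t _ => hasDerivAt_exp_mul _ t) (fun t _ => hf t)
    ((continuous_const.mul (contDiff_exp_mul _).continuous).intervalIntegrable _ _)
    (hd.intervalIntegrable _ _)
  have hp : f.1 r = f.1 0 := by
    have := f.2.2.1 0
    rwa [zero_add] at this
  simp only [mul_assoc, intervalIntegral.integral_const_mul] at h
  rw [exp_modeFreq_mul hr.ne', hp, ofReal_zero, mul_zero, exp_zero, sub_self, zero_sub,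
    modeFreq_neg] at h
  rw [modeCoeff_apply, modeCoeff_apply, modeFreq_neg]
  change (1 / r : ℂ) * (∫ t in (0 : ℝ)..r, exp (-modeFreq r m * t) * deriv f.1 t) = _
  rw [h]
  ring

theorem modeCoeff_zero (f : circleFun r) : modeCoeff r 0 f = 0 := by
  have : modeFreq r 0 = 0 := by simp [modeFreq]
  rw [modeCoeff_apply, neg_zero, this]
  simp only [zero_mul, exp_zero, one_mul]
  rw [f.2.2.2, mul_zero]

theorem modeCoeff_fourierMode (hr : 0 < r) (m : ℤ) {m' : ℤ} (hm' : m' ≠ 0) :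
    modeCoeff r m (fourierMode hr m') = if m = m' then 1 else 0 := by
  have h : ∀ t : ℝ, exp (modeFreq r (-m) * t) * (fourierMode hr m').1 t
      = exp (modeFreq r (-m + m') * t) := fun t => by
    rw [modeFreq_add, add_mul, exp_add, fourierMode_apply hr hm']
  rw [modeCoeff_apply]
  simp only [h]
  split_ifs with hm
  · have hr' : (r : ℂ) ≠ 0 := by exact_mod_cast hr.ne'
    have : modeFreq r 0 = 0 := by simp [modeFreq]
    rw [hm, neg_add_cancel, this]
    simp [hr']
  · rw [integral_exp_modeFreq hr.ne' (fun h => hm (by omega)), mul_zero]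

/-- The zeroth coefficient vanishes by orthogonality to the constants. If all coefficients are zero,
they are summable, so the Fourier series converges pointwise to the function. -/
theorem eq_zero_of_modeCoeff (hr : 0 < r) (f : circleFun r) (h : ∀ m, m ≠ 0 → modeCoeff r m f = 0) :
    f = 0 := by
  have : Fact (0 < r) := ⟨hr⟩
  have h' : ∀ m, modeCoeff r m f = 0 := fun m => by
    rcases eq_or_ne m 0 with rfl | hm
    · exact modeCoeff_zero f
    · exact h m hm
  have hper : Function.Periodic f.1 r := f.2.2.1
  let g : C(AddCircle r, ℂ) := ⟨hper.lift, by
    exact continuous_coinduced_dom.2 f.2.1.continuous⟩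
  have hg : ∀ t : ℝ, g t = f.1 t := fun t => rfl
  have hc : ∀ m, fourierCoeff g m = 0 := by
    intro m
    rw [fourierCoeff_eq_intervalIntegral g m 0, zero_add, ← h' m, modeCoeff_apply, real_smul]
    congr 1
    · push_cast; rfl
    · refine intervalIntegral.integral_congr fun t _ => ?_
      rw [fourier_coe_apply, hg, smul_eq_mul, modeFreq]
      congr 2
      push_cast
      ring
  have hs := has_pointwise_sum_fourier_series_of_summable (f := g) (by
    rw [funext hc]; exact summable_zero)
  refine Subtype.ext (funext fun t => ?_)
  have := hs t
  simp only [hc, zero_smul] at this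
  rw [hg] at this
  exact this.unique hasSum_zero

end Circle

/-! ### Operators acting mode by mode and traces on generalized eigenspaces -/

section Modes

variable {A : Type*} [CommRing A] [Algebra ℂ A] {n : ℕ} {r : ℝ}

/-- The `m`-th Fourier coefficient of a section. -/
def sectionCoeff (n : ℕ) (r : ℝ) (A : Type*) [CommRing A] [Algebra ℂ A] (m : ℤ) :
    NormalSections n r A →ₗ[A] (Fin n → A) :=
  (TensorProduct.AlgebraTensorModule.rid ℂ A (Fin n → A)).toLinearMap ∘ₗ
    TensorProduct.AlgebraTensorModule.map LinearMap.id (modeCoeff r m)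

theorem sectionCoeff_tmul (m : ℤ) (v : Fin n → A) (f : circleFun r) :
    sectionCoeff n r A m (v ⊗ₜ f) = modeCoeff r m f • v := rfl

/-- The sections proportional to the `m`-th Fourier mode. -/
def modeSection (n : ℕ) (A : Type*) [CommRing A] [Algebra ℂ A] (hr : 0 < r) (m : ℤ) :
    (Fin n → A) →ₗ[A] NormalSections n r A :=
  (TensorProduct.AlgebraTensorModule.mk ℂ A (Fin n → A) (circleFun r)).flip (fourierMode hr m)

theorem modeSection_apply (hr : 0 < r) (m : ℤ) (v : Fin n → A) :
    modeSection n A hr m v = v ⊗ₜ fourierMode hr m := rfl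

/-- A complex basis of the fibre reduces the statement to scalar functions, with no topology on `A`.
-/
theorem eq_zero_of_sectionCoeff (hr : 0 < r) (x : NormalSections n r A)
    (h : ∀ m, m ≠ 0 → sectionCoeff n r A m x = 0) : x = 0 := by
  let b := Module.Free.chooseBasis ℂ (Fin n → A)
  let e := TensorProduct.equivFinsuppOfBasisLeft (N := circleFun r) b
  have key : ∀ m i (x : NormalSections n r A),
      modeCoeff r m (e x i) = b.repr (sectionCoeff n r A m x) i := by
    intro m i x
    induction x using TensorProduct.induction_on with
    | zero => simp
    | add x y hx hy => simp only [map_add, Finsupp.add_apply, hx, hy]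
    | tmul v f =>
      rw [sectionCoeff_tmul, map_smul, Finsupp.smul_apply]
      simp [e, mul_comm]
  refine e.injective ?_
  rw [map_zero]
  refine Finsupp.ext fun i => eq_zero_of_modeCoeff hr _ fun m hm => ?_
  rw [key, h m hm, map_zero, Finsupp.zero_apply]

theorem sectionCoeff_modeSection (hr : 0 < r) (m : ℤ) {m' : ℤ} (hm' : m' ≠ 0) (v : Fin n → A) :
    sectionCoeff n r A m (modeSection n A hr m' v) = if m = m' then v else 0 := by
  rw [modeSection_apply, sectionCoeff_tmul, modeCoeff_fourierMode hr m hm']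
  split_ifs <;> simp

theorem sectionCoeff_opTensor (m : ℤ) (P : (Fin n → A) →ₗ[A] (Fin n → A))
    (L : circleFun r →ₗ[ℂ] circleFun r) {c : ℂ} (hL : ∀ f, modeCoeff r m (L f) = c * modeCoeff r m f)
    (x : NormalSections n r A) :
    sectionCoeff n r A m (opTensor n r P L x) = algebraMap ℂ A c • P (sectionCoeff n r A m x) := by
  induction x using TensorProduct.induction_on with
  | zero => simp
  | add x y hx hy => simp only [map_add, smul_add, hx, hy]
  | tmul v f =>
    change sectionCoeff n r A m (P v ⊗ₜ L f) = _
    rw [sectionCoeff_tmul, sectionCoeff_tmul, hL, P.map_smul_of_tower, algebraMap_smul, mul_smul]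

theorem opTensor_modeSection (hr : 0 < r) (m : ℤ) (P : (Fin n → A) →ₗ[A] (Fin n → A))
    (L : circleFun r →ₗ[ℂ] circleFun r) {c : ℂ}
    (hL : L (fourierMode hr m) = c • fourierMode hr m) (v : Fin n → A) :
    opTensor n r P L (modeSection n A hr m v)
      = modeSection n A hr m (algebraMap ℂ A c • P v) := by
  change P v ⊗ₜ L (fourierMode hr m) = (algebraMap ℂ A c • P v) ⊗ₜ fourierMode hr m
  rw [hL, algebraMap_smul, TensorProduct.smul_tmul]

/-- The operator `T` acts on the `m`-th Fourier mode through the endomorphism `P`. -/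
structure ActsOnMode (hr : 0 < r) (T : Module.End A (NormalSections n r A)) (m : ℤ)
    (P : Module.End A (Fin n → A)) : Prop where
  coeff : ∀ x, sectionCoeff n r A m (T x) = P (sectionCoeff n r A m x)
  mode : ∀ v, T (modeSection n A hr m v) = modeSection n A hr m (P v)

namespace ActsOnMode

variable {hr : 0 < r} {T T' : Module.End A (NormalSections n r A)} {m : ℤ}
  {P P' : Module.End A (Fin n → A)}

theorem add (h : ActsOnMode hr T m P) (h' : ActsOnMode hr T' m P') :
    ActsOnMode hr (T + T') m (P + P') :=
  ⟨fun x => by simp only [LinearMap.add_apply, map_add, h.coeff, h'.coeff],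
    fun v => by simp only [LinearMap.add_apply, map_add, h.mode, h'.mode]⟩

theorem smul (h : ActsOnMode hr T m P) (a : A) : ActsOnMode hr (a • T) m (a • P) :=
  ⟨fun x => by simp only [LinearMap.smul_apply, map_smul, h.coeff],
    fun v => by simp only [LinearMap.smul_apply, map_smul, h.mode]⟩

theorem one : ActsOnMode hr (1 : Module.End A (NormalSections n r A)) m 1 :=
  ⟨fun _ => rfl, fun _ => rfl⟩

theorem neg (h : ActsOnMode hr T m P) : ActsOnMode hr (-T) m (-P) :=
  ⟨fun x => by simp only [LinearMap.neg_apply, map_neg, h.coeff],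
    fun v => by simp only [LinearMap.neg_apply, map_neg, h.mode]⟩

theorem sub (h : ActsOnMode hr T m P) (h' : ActsOnMode hr T' m P') :
    ActsOnMode hr (T - T') m (P - P') := by
  rw [sub_eq_add_neg T, sub_eq_add_neg P]
  exact h.add h'.neg

theorem pow (h : ActsOnMode hr T m P) (k : ℕ) : ActsOnMode hr (T ^ k) m (P ^ k) := by
  induction k with
  | zero => exact one
  | succ k ih =>
    refine ⟨fun x => ?_, fun v => ?_⟩
    · rw [pow_succ, pow_succ, Module.End.mul_apply, Module.End.mul_apply, ih.coeff, h.coeff]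
    · rw [pow_succ, pow_succ, Module.End.mul_apply, Module.End.mul_apply, h.mode, ih.mode]

end ActsOnMode

/-- On each mode `T - μ` is either nilpotent or invertible. The invertible modes cannot occur in a
vector killed by a power of `T - μ`, so the generalized eigenspace is the direct sum of the finitely
many modes in `J`, each a copy of the fibre. -/
theorem trace_eigenNil_pow (hr : 0 < r) {T : Module.End A (NormalSections n r A)} {μ : ℂ}
    {P : ℤ → Module.End A (Fin n → A)} (hP : ∀ m, ActsOnMode hr T m (P m)) {J : Finset ℤ}
    (hJ0 : 0 ∉ J) (hJ : ∀ m ∈ J, IsNilpotent (P m - algebraMap ℂ A μ • 1))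
    (hJ' : ∀ m, m ≠ 0 → m ∉ J → IsUnit (P m - algebraMap ℂ A μ • 1)) (j : ℕ) :
    LinearMap.trace A (eigen T μ) (eigenNil T μ ^ j)
      = ∑ m ∈ J, LinearMap.trace A (Fin n → A) ((algebraMap ℂ A μ⁻¹ • P m - 1) ^ j) := by
  have hmem : ∀ x, x ∈ eigen T μ ↔ ∃ k : ℕ, ((T - algebraMap ℂ A μ • 1) ^ k) x = 0 := fun x => by
    rw [eigen, Module.End.mem_maxGenEigenspace]
  have hD : ∀ m, ActsOnMode hr (T - algebraMap ℂ A μ • 1) m (P m - algebraMap ℂ A μ • 1) :=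
    fun m => (hP m).sub (ActsOnMode.one.smul _)
  have hne : ∀ m ∈ J, m ≠ 0 := fun m hm h0 => hJ0 (h0 ▸ hm)
  have hi : ∀ m ∈ J, ∀ v, modeSection n A hr m v ∈ eigen T μ := by
    intro m hm v
    obtain ⟨k, hk⟩ := hJ m hm
    exact (hmem _).2 ⟨k, by rw [((hD m).pow k).mode, hk, LinearMap.zero_apply, map_zero]⟩
  have hz : ∀ m, m ≠ 0 → m ∉ J → ∀ x ∈ eigen T μ, sectionCoeff n r A m x = 0 := by
    intro m hm0 hm x hx
    obtain ⟨k, hk⟩ := (hmem x).1 hx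
    have h1 := ((hD m).pow k).coeff x
    rw [hk, map_zero] at h1
    obtain ⟨u, hu⟩ := (hJ' m hm0 hm).pow k
    rw [← hu] at h1
    have h2 : (u⁻¹).1 (u.1 (sectionCoeff n r A m x)) = 0 := by rw [← h1, map_zero]
    rwa [← Module.End.mul_apply, Units.inv_mul] at h2
  let p : J → (eigen T μ →ₗ[A] (Fin n → A)) := fun m =>
    sectionCoeff n r A m ∘ₗ (eigen T μ).subtype
  let i : J → ((Fin n → A) →ₗ[A] eigen T μ) := fun m =>
    LinearMap.codRestrict (eigen T μ) (modeSection n A hr m) (hi m m.2)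
  have hsum : ∀ x : eigen T μ, ∑ m : J, i m (p m x) = x := by
    intro x
    refine Subtype.ext (sub_eq_zero.1 (eq_zero_of_sectionCoeff hr _ fun m hm => ?_))
    have hcoe : ((∑ m : J, i m (p m x) : eigen T μ) : NormalSections n r A)
        = ∑ m ∈ J, modeSection n A hr m (sectionCoeff n r A m x) := by
      rw [AddSubmonoidClass.coe_finsetSum]
      exact Finset.sum_coe_sort J fun m => modeSection n A hr m (sectionCoeff n r A m x)
    rw [hcoe, map_sub, map_sum, Finset.sum_congr rfl fun m' hm' =>
      sectionCoeff_modeSection hr m (hne m' hm') _, Finset.sum_ite_eq]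
    split_ifs with hmJ
    · exact sub_self _
    · rw [hz m hm hmJ x x.2, sub_zero]
  have hpi : ∀ (m m' : J) v, p m (i m' v) = if m = m' then v else 0 := by
    intro m m' v
    refine (sectionCoeff_modeSection hr m (hne m' m'.2) v).trans ?_
    simp only [Subtype.ext_iff]
  -- The trace is zero by convention on a module without a finite basis, so freeness and finiteness
  -- of the eigenspace must be established.
  let e : eigen T μ ≃ₗ[A] (J → Fin n → A) :=
    { LinearMap.pi p with
      invFun := fun w => ∑ m : J, i m (w m)
      left_inv := hsum
      right_inv := fun w => by
        funext m
        change p m (∑ m' : J, i m' (w m')) = w m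
        rw [map_sum]
        simp only [hpi]
        rw [Finset.sum_ite_eq, if_pos (Finset.mem_univ m)] }
  have : Module.Free A (eigen T μ) := Module.Free.of_equiv e.symm
  have : Module.Finite A (eigen T μ) := Module.Finite.equiv e.symm
  have hS : ∀ m : J, ActsOnMode hr ((algebraMap ℂ A μ⁻¹ • T - 1) ^ j) m
      ((algebraMap ℂ A μ⁻¹ • P m - 1) ^ j) := fun m => (((hP m).smul _).sub ActsOnMode.one).pow j
  have hN : ∀ x : eigen T μ, ((eigenNil T μ ^ j) x : NormalSections n r A)
      = ((algebraMap ℂ A μ⁻¹ • T - 1 : Module.End A (NormalSections n r A)) ^ j) x := by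
    intro x
    rw [eigenNil, Module.End.pow_restrict]
    rfl
  have hdec : eigenNil T μ ^ j
      = ∑ m : J, i m ∘ₗ (((algebraMap ℂ A μ⁻¹ • P m - 1) ^ j : Module.End A (Fin n → A)) ∘ₗ p m) := by
    refine LinearMap.ext fun x => ?_
    conv_lhs => rw [← hsum x, map_sum]
    rw [LinearMap.sum_apply]
    refine Finset.sum_congr rfl fun m _ => Subtype.ext ?_
    rw [hN]
    exact (hS m).mode _
  rw [hdec, map_sum, ← Finset.sum_coe_sort J fun m =>
    LinearMap.trace A (Fin n → A) ((algebraMap ℂ A μ⁻¹ • P m - 1) ^ j)]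
  refine Finset.sum_congr rfl fun m _ => ?_
  -- Cyclicity of the trace moves the computation from the eigenspace to the fibre.
  refine (LinearMap.trace_comp_comm' (R := A) (M := eigen T μ) (N := Fin n → A) (_ ∘ₗ p m) (i m)).trans ?_
  rw [LinearMap.comp_assoc]
  have : p m ∘ₗ i m = LinearMap.id := LinearMap.ext fun v => by
    rw [LinearMap.comp_apply, hpi, if_pos rfl]; rfl
  rw [this, LinearMap.comp_id]

end Modes

/-! ### Spectra and zeta derivatives of the kinetic operators -/

section KineticSpectrum

variable {A : Type*} [CommRing A] [Algebra ℂ A] {n : ℕ} {r : ℝ}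

theorem actsOnMode_ddt (hr : 0 < r) (m : ℤ) (P : Module.End A (Fin n → A)) :
    ActsOnMode hr (opTensor n r P (ddt r)) m (algebraMap ℂ A (modeFreq r m) • P) :=
  ⟨sectionCoeff_opTensor m P (ddt r) (modeCoeff_ddt hr m),
    opTensor_modeSection hr m P (ddt r) (ddt_fourierMode hr m)⟩

theorem actsOnMode_ddt_ddt (hr : 0 < r) (m : ℤ) (P : Module.End A (Fin n → A)) :
    ActsOnMode hr (opTensor n r P (ddt r ∘ₗ ddt r)) m
      (algebraMap ℂ A (modeFreq r m * modeFreq r m) • P) := by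
  refine ⟨sectionCoeff_opTensor m P _ fun f => ?_, opTensor_modeSection hr m P _ ?_⟩
  · rw [LinearMap.comp_apply, modeCoeff_ddt hr, modeCoeff_ddt hr, mul_assoc]
  · rw [LinearMap.comp_apply, ddt_fourierMode, map_smul, ddt_fourierMode, smul_smul]

omit [Algebra ℂ A] in
theorem neg_smul_end (a : A) (P : Module.End A (Fin n → A)) : -(a • P) = (-a) • P :=
  LinearMap.ext fun v => (neg_smul a (P v)).symm

omit [Algebra ℂ A] in
theorem sub_smul_end (a b : A) (P : Module.End A (Fin n → A)) : a • P - b • P = (a - b) • P :=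
  LinearMap.ext fun v => (sub_smul a b (P v)).symm

theorem actsOnMode_kineticBos (hr : 0 < r) (m : ℤ) (R : Matrix (Fin n) (Fin n) A) :
    ActsOnMode hr (kineticBos n r R) m
      (algebraMap ℂ A (((2 * Real.pi / r * m : ℝ) : ℂ) ^ 2) • 1
        - algebraMap ℂ A ((2 * Real.pi / r * m : ℝ) : ℂ) • R.mulVecLin) := by
  have h := (actsOnMode_ddt_ddt hr m (1 : Module.End A (Fin n → A))).neg.add
    ((actsOnMode_ddt hr m R.mulVecLin).smul (algebraMap ℂ A Complex.I))
  rw [smul_smul, ← map_mul, neg_smul_end, ← map_neg] at h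
  have h1 : -(modeFreq r m * modeFreq r m) = ((2 * Real.pi / r * m : ℝ) : ℂ) ^ 2 := by
    rw [modeFreq]
    linear_combination (-((2 * Real.pi / r * m : ℝ) : ℂ) ^ 2) * Complex.I_mul_I
  have h2 : Complex.I * modeFreq r m = -((2 * Real.pi / r * m : ℝ) : ℂ) := by
    rw [modeFreq]
    linear_combination ((2 * Real.pi / r * m : ℝ) : ℂ) * Complex.I_mul_I
  rw [h1, h2, map_neg, ← neg_smul_end, ← sub_eq_add_neg] at h
  exact h

theorem actsOnMode_kineticFer (hr : 0 < r) (m : ℤ) :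
    ActsOnMode hr (kineticFer n r : Module.End A (NormalSections n r A)) m
      (algebraMap ℂ A ((2 * Real.pi / r * m : ℝ) : ℂ) • 1) := by
  have h := ((actsOnMode_ddt hr m (1 : Module.End A (Fin n → A))).smul
    (algebraMap ℂ A Complex.I)).neg
  rw [smul_smul, ← map_mul, neg_smul_end, ← map_neg] at h
  have h2 : -(Complex.I * modeFreq r m) = ((2 * Real.pi / r * m : ℝ) : ℂ) := by
    rw [modeFreq]
    linear_combination -((2 * Real.pi / r * m : ℝ) : ℂ) * Complex.I_mul_I
  rw [h2] at h
  exact h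

theorem isUnit_algebraMap_smul_one {c : ℂ} (hc : c ≠ 0) :
    IsUnit (algebraMap ℂ A c • (1 : Module.End A (Fin n → A))) := by
  have h : IsUnit (algebraMap A (Module.End A (Fin n → A)) (algebraMap ℂ A c)) :=
    ((IsUnit.mk0 c hc).map (algebraMap ℂ A)).map _
  rwa [Algebra.algebraMap_eq_smul_one] at h

omit [Algebra ℂ A] in
theorem mulVecLin_pow (R : Matrix (Fin n) (Fin n) A) (j : ℕ) :
    (R.mulVecLin ^ j : Module.End A (Fin n → A)) = (R ^ j).mulVecLin := by
  rw [← Matrix.toLin'_apply', ← Matrix.toLin'_apply', Matrix.toLin'_pow]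

omit [Algebra ℂ A] in
theorem trace_mulVecLin (R : Matrix (Fin n) (Fin n) A) :
    LinearMap.trace A (Fin n → A) R.mulVecLin = R.trace := by
  rw [← Matrix.toLin'_apply', Matrix.trace_toLin'_eq]

/-- With `a` the frequency, `a⁻² (a² - aR) - 1 = -a⁻¹ R`. For other eigenvalues the operator minus
`μ` is a nonzero scalar plus a nilpotent, hence invertible. -/
theorem trace_eigenNil_kineticBos_pow (hr : 0 < r) {R : Matrix (Fin n) (Fin n) A}
    (hR : IsNilpotent R) {μ : ℂ} {J : Finset ℤ}
    (hJ : ∀ m : ℤ, m ∈ J ↔ m ≠ 0 ∧ ((2 * Real.pi / r * m : ℝ) : ℂ) ^ 2 = μ) (j : ℕ) :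
    LinearMap.trace A (eigen (kineticBos n r R) μ) (eigenNil (kineticBos n r R) μ ^ j)
      = ∑ m ∈ J, (-((2 * Real.pi / r * m : ℝ) : ℂ)⁻¹) ^ j • (R ^ j).trace := by
  have hnil : ∀ a : A, IsNilpotent (a • R.mulVecLin : Module.End A (Fin n → A)) := by
    intro a
    obtain ⟨N, hN⟩ := hR
    refine ⟨N, ?_⟩
    rw [smul_pow, mulVecLin_pow, hN, Matrix.mulVecLin_zero, smul_zero]
  rw [trace_eigenNil_pow hr (fun m => actsOnMode_kineticBos hr m R)
    (fun h => ((hJ 0).1 h).1 rfl) (J := J)]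
  · refine Finset.sum_congr rfl fun m hm => ?_
    obtain ⟨hm0, hm1⟩ := (hJ m).1 hm
    have ha : ((2 * Real.pi / r * m : ℝ) : ℂ) ≠ 0 := by
      have : (m : ℝ) ≠ 0 := by exact_mod_cast hm0
      exact_mod_cast mul_ne_zero (div_ne_zero Real.two_pi_pos.ne' hr.ne') this
    generalize ((2 * Real.pi / r * m : ℝ) : ℂ) = a at ha hm1 ⊢
    subst hm1
    have h1 : algebraMap ℂ A (a ^ 2)⁻¹ • (algebraMap ℂ A (a ^ 2) • (1 : Module.End A (Fin n → A))
        - algebraMap ℂ A a • R.mulVecLin) - 1 = algebraMap ℂ A (-a⁻¹) • R.mulVecLin := by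
      rw [smul_sub, smul_smul, smul_smul, ← map_mul, ← map_mul, inv_mul_cancel₀ (pow_ne_zero 2 ha),
        map_one, one_smul, sub_sub_cancel_left, neg_smul_end, ← map_neg]
      congr 3
      field_simp
    rw [h1, smul_pow, mulVecLin_pow, map_smul, trace_mulVecLin, ← map_pow, algebraMap_smul]
  · intro m hm
    rw [((hJ m).1 hm).2, sub_sub_cancel_left, neg_smul_end]
    exact hnil _
  · intro m hm0 hm
    have hne : ((2 * Real.pi / r * m : ℝ) : ℂ) ^ 2 - μ ≠ 0 := fun h =>
      hm ((hJ m).2 ⟨hm0, sub_eq_zero.1 h⟩)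
    rw [sub_right_comm, sub_smul_end, ← map_sub, sub_eq_add_neg, neg_smul_end]
    refine (hnil _).isUnit_add_left_of_commute (isUnit_algebraMap_smul_one hne) ?_
    exact ((Commute.one_right _).smul_right _)

theorem trace_eigenNil_kineticFer_pow (hr : 0 < r) {μ : ℂ} {J : Finset ℤ}
    (hJ : ∀ m : ℤ, m ∈ J ↔ m ≠ 0 ∧ ((2 * Real.pi / r * m : ℝ) : ℂ) = μ) (j : ℕ) :
    LinearMap.trace A _ (eigenNil (kineticFer n r : Module.End A (NormalSections n r A)) μ ^ j)
      = ∑ _m ∈ J, if j = 0 then (n : A) else 0 := by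
  rw [trace_eigenNil_pow hr (fun m => actsOnMode_kineticFer hr m)
    (fun h => ((hJ 0).1 h).1 rfl) (J := J)]
  · refine Finset.sum_congr rfl fun m hm => ?_
    obtain ⟨hm0, hm1⟩ := (hJ m).1 hm
    have ha : ((2 * Real.pi / r * m : ℝ) : ℂ) ≠ 0 := by
      have : (m : ℝ) ≠ 0 := by exact_mod_cast hm0
      exact_mod_cast mul_ne_zero (div_ne_zero Real.two_pi_pos.ne' hr.ne') this
    rw [hm1] at ha ⊢
    rw [smul_smul, ← map_mul, inv_mul_cancel₀ ha, map_one, one_smul, sub_self]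
    split_ifs with hj
    · have h1 : (1 : Module.End A (Fin n → A)) = (1 : Matrix (Fin n) (Fin n) A).mulVecLin :=
        Matrix.mulVecLin_one.symm
      rw [hj, pow_zero, h1, trace_mulVecLin]
      simp
    · rw [zero_pow hj, map_zero]
  · intro m hm
    rw [((hJ m).1 hm).2, sub_self]
    exact IsNilpotent.zero
  · intro m hm0 hm
    have hne : ((2 * Real.pi / r * m : ℝ) : ℂ) - μ ≠ 0 := fun h =>
      hm ((hJ m).2 ⟨hm0, sub_eq_zero.1 h⟩)
    rw [sub_smul_end, ← map_sub]
    exact isUnit_algebraMap_smul_one hne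

theorem zetaTerm_eq_sum {M : Type*} [AddCommGroup M] [Module A M] {T : Module.End A M} {μ : ℂ}
    {N : ℕ} {t : ℕ → A} (ht : ∀ j, LinearMap.trace A (eigen T μ) (eigenNil T μ ^ j) = t j)
    (hN : ∀ j, N ≤ j → t j = 0) (s : ℂ) :
    zetaTerm T s μ = (μ ^ (-s)) • ∑ j ∈ Finset.range N, Ring.choose (-s) j • t j := by
  rw [zetaTerm]
  simp only [ht]
  rw [finsum_eq_sum_of_support_subset]
  intro j hj
  by_contra h
  refine hj ?_
  beta_reduce
  rw [hN j (by simpa using h), smul_zero]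

/-- The modes `±(k+1)` have the same eigenvalue and opposite nilpotent parts, whence the factor `1 +
(-1)^j`. It vanishes at `j = 1`, as `hasZetaDeriv_of_spectrum` requires. -/
theorem hasZetaDeriv_kineticBos (hr : 0 < r) {R : Matrix (Fin n) (Fin n) A} {N : ℕ}
    (hR : R ^ N = 0) :
    HasZetaDeriv (kineticBos n r R) Set.univ (∑ j ∈ Finset.range N,
      deriv (zetaCoeff (2 * Real.pi / r) 2 j) 0 • ((1 + (-1) ^ j : ℂ) • (R ^ j).trace)) := by
  have hc : 0 < 2 * Real.pi / r := div_pos Real.two_pi_pos hr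
  refine hasZetaDeriv_of_spectrum hc two_ne_zero (by simp) (fun _ => Set.mem_univ _)
    (fun k s => ?_) (fun μ _ hμ s => ?_)
  · have hk : (k + 1 : ℤ) ≠ -(k + 1 : ℤ) := by omega
    have hJ : ∀ m : ℤ, m ∈ ({(k + 1 : ℤ), -(k + 1 : ℤ)} : Finset ℤ) ↔
        m ≠ 0 ∧ ((2 * Real.pi / r * m : ℝ) : ℂ) ^ 2 = ((2 * Real.pi / r * (k + 1) : ℝ) : ℂ) ^ 2 := by
      intro m
      have : ((2 * Real.pi / r * m : ℝ) : ℂ) ^ 2 = ((2 * Real.pi / r * (k + 1) : ℝ) : ℂ) ^ 2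
          ↔ (m : ℝ) ^ 2 = (k + 1) ^ 2 := by
        rw [← Complex.ofReal_pow, ← Complex.ofReal_pow, Complex.ofReal_inj, mul_pow, mul_pow]
        exact mul_right_inj' (pow_ne_zero 2 hc.ne')
      rw [this, sq_eq_sq_iff_eq_or_eq_neg, Finset.mem_insert, Finset.mem_singleton]
      norm_cast
      omega
    refine zetaTerm_eq_sum (fun j => ?_) (fun j hj => ?_) s
    · rw [trace_eigenNil_kineticBos_pow hr ⟨N, hR⟩ hJ, Finset.sum_pair hk]
      have hb : ((2 * Real.pi / r * ((-(k + 1) : ℤ) : ℝ) : ℝ) : ℂ)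
          = -((2 * Real.pi / r * (k + 1) : ℝ) : ℂ) := by push_cast; ring
      have hb' : ((2 * Real.pi / r * ((k + 1 : ℤ) : ℝ) : ℝ) : ℂ)
          = ((2 * Real.pi / r * (k + 1) : ℝ) : ℂ) := by push_cast; ring
      rw [hb, hb']
      generalize ((2 * Real.pi / r * (k + 1) : ℝ) : ℂ) = b
      rw [← add_smul, smul_smul, inv_neg, neg_neg, neg_pow b⁻¹, inv_pow]
      congr 1
      ring
    · rw [pow_eq_zero_of_le hj hR]
      simp
  · have hJ : ∀ m : ℤ, m ∈ (∅ : Finset ℤ) ↔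
        m ≠ 0 ∧ ((2 * Real.pi / r * m : ℝ) : ℂ) ^ 2 = μ := by
      intro m
      simp only [Finset.notMem_empty, false_iff, not_and]
      intro hm h
      obtain ⟨k, rfl | rfl⟩ := Int.eq_nat_or_neg m
      · obtain ⟨k, rfl⟩ := Nat.exists_eq_succ_of_ne_zero (by simpa using hm)
        exact hμ k (by rw [← h]; push_cast; rfl)
      · obtain ⟨k, rfl⟩ := Nat.exists_eq_succ_of_ne_zero (by simpa using hm)
        exact hμ k (by rw [← h]; push_cast; ring)
    have := zetaTerm_eq_sum (N := 0) (trace_eigenNil_kineticBos_pow hr ⟨N, hR⟩ hJ) (by simp) s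
    simpa using this

/-- The value is irrelevant, because the pfaffian is common to both super determinants and cancels.
-/
theorem exists_hasZetaDeriv_kineticFer (hr : 0 < r) :
    ∃ z : A, HasZetaDeriv (kineticFer n r : Module.End A (NormalSections n r A))
      {μ | 0 < μ.re} z := by
  have hc : 0 < 2 * Real.pi / r := div_pos Real.two_pi_pos hr
  refine ⟨_, hasZetaDeriv_of_spectrum (N := 1) (a := fun j => if j = 0 then (n : A) else 0) hc
    one_ne_zero (by simp) (fun k => ?_) (fun k s => ?_) (fun μ h0 hμ s => ?_)⟩
  · rw [pow_one, Set.mem_ofPred_eq, Complex.ofReal_re]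
    positivity
  · rw [pow_one]
    have hJ : ∀ m : ℤ, m ∈ ({(k + 1 : ℤ)} : Finset ℤ) ↔
        m ≠ 0 ∧ ((2 * Real.pi / r * m : ℝ) : ℂ) = ((2 * Real.pi / r * (k + 1) : ℝ) : ℂ) := by
      intro m
      rw [Complex.ofReal_inj, mul_right_inj' hc.ne', Finset.mem_singleton]
      norm_cast
      omega
    refine zetaTerm_eq_sum (fun j => ?_) (fun j hj => ?_) s
    · rw [trace_eigenNil_kineticFer_pow hr hJ, Finset.sum_singleton]
      split_ifs with hj
      · rw [hj, pow_zero, inv_one, one_smul]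
      · rw [smul_zero]
    · rw [if_neg (by omega), smul_zero]
  · have hJ : ∀ m : ℤ, m ∈ (∅ : Finset ℤ) ↔ m ≠ 0 ∧ ((2 * Real.pi / r * m : ℝ) : ℂ) = μ := by
      intro m
      simp only [Finset.notMem_empty, false_iff, not_and]
      intro hm h
      rw [Set.mem_ofPred_eq, ← h, Complex.ofReal_re, mul_pos_iff_of_pos_left hc] at h0
      obtain ⟨k, rfl⟩ := Int.eq_ofNat_of_zero_le (a := m) (by exact_mod_cast h0.le)
      obtain ⟨k, rfl⟩ := Nat.exists_eq_succ_of_ne_zero (by simpa using hm)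
      exact hμ k (by rw [← h]; push_cast; ring)
    have := zetaTerm_eq_sum (N := 0) (trace_eigenNil_kineticFer_pow (n := n) (A := A) hr hJ)
      (by simp) s
    simpa using this

theorem kineticBosTrivial_eq :
    (kineticBosTrivial n r : Module.End A (NormalSections n r A)) = kineticBos n r 0 := by
  rw [kineticBosTrivial, kineticBos, Matrix.mulVecLin_zero]
  have : opTensor n r (0 : (Fin n → A) →ₗ[A] (Fin n → A)) (ddt r) = 0 := by
    refine LinearMap.ext fun x => ?_
    induction x using TensorProduct.induction_on with
    | zero => simp
    | add x y hx hy => simp only [map_add, hx, hy]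
    | tmul v f => exact TensorProduct.zero_tmul _ _
  rw [this, smul_zero, add_zero]

end KineticSpectrum

/-! ### The relative super determinant as an exponential -/

section RelativeDeterminant

variable {V : Type*} [AddCommGroup V] [Module ℂ V] [FiniteDimensional ℂ V]
  {M : Type*} [AddCommGroup M] [Module (evenPart V) M]
  {M' : Type*} [AddCommGroup M'] [Module (evenPart V) M']

theorem gexp_mul_gexp_neg (a : evenPart V) : gexp V a * gexp V (-a) = 1 := by
  rw [← gexp_add, add_neg_cancel, gexp_zero]

theorem isZetaSdet_iff {bos : Module.End (evenPart V) M} {fer : Module.End (evenPart V) M'}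
    {z w : evenPart V} (hz : HasZetaDeriv bos Set.univ z) (hw : HasZetaDeriv fer {μ | 0 < μ.re} w)
    (d : evenPart V) :
    IsZetaSdet bos fer d ↔ d = gexp V (-w) * gexp V ((1 / 2 : ℂ) • z) := by
  constructor
  · rintro ⟨_, _, ⟨w', hw', rfl⟩, ⟨z', hz', rfl⟩, -, h⟩
    rw [← hw.unique hw', ← hz.unique hz'] at h
    rw [← h, mul_assoc, mul_comm (gexp V (-_)), gexp_mul_gexp_neg, mul_one]
  · rintro rfl
    refine ⟨_, _, ⟨w, hw, rfl⟩, ⟨z, hz, rfl⟩, isUnit_gexp _, ?_⟩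
    rw [mul_assoc, gexp_mul_gexp_neg, mul_one]

theorem relativeSdet_iff {bos bos' : Module.End (evenPart V) M}
    {fer : Module.End (evenPart V) M'} {z z' w : evenPart V} (hz : HasZetaDeriv bos Set.univ z)
    (hz' : HasZetaDeriv bos' Set.univ z') (hw : HasZetaDeriv fer {μ | 0 < μ.re} w)
    (d : evenPart V) :
    (∃ d₁ d₂ : evenPart V, IsZetaSdet bos fer d₁ ∧ IsZetaSdet bos' fer d₂ ∧ IsUnit d₂ ∧ d * d₂ = d₁)
      ↔ d = gexp V ((1 / 2 : ℂ) • (z - z')) := by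
  simp only [isZetaSdet_iff hz hw, isZetaSdet_iff hz' hw]
  have hu : IsUnit (gexp V (-w) * gexp V ((1 / 2 : ℂ) • z')) := (isUnit_gexp _).mul (isUnit_gexp _)
  have he : gexp V ((1 / 2 : ℂ) • (z - z')) * (gexp V (-w) * gexp V ((1 / 2 : ℂ) • z'))
      = gexp V (-w) * gexp V ((1 / 2 : ℂ) • z) := by
    rw [mul_left_comm, ← gexp_add, ← smul_add, sub_add_cancel]
  constructor
  · rintro ⟨_, _, rfl, rfl, -, h⟩
    exact hu.mul_right_cancel (h.trans he.symm)
  · rintro rfl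
    exact ⟨_, _, rfl, rfl, hu, he⟩

end RelativeDeterminant

/-! ### Summing the traces -/

section TraceSum

/-- Up to index `2n` only even indices contribute, and the indices above `n` add nothing. -/
theorem sum_range_even {A : Type*} [AddCommMonoid A] {n : ℕ} {g : ℕ → A}
    (hodd : ∀ m, g (2 * m + 1) = 0) (hbig : ∀ j, n < j → g j = 0) :
    ∑ j ∈ Finset.range n, g (j + 1) = ∑ m ∈ Finset.range n, g (2 * (m + 1)) := by
  have h1 : ∀ k, ∑ j ∈ Finset.range (2 * k), g (j + 1) = ∑ m ∈ Finset.range k, g (2 * (m + 1)) := by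
    intro k
    induction k with
    | zero => rfl
    | succ k ih =>
      rw [show 2 * (k + 1) = 2 * k + 1 + 1 by ring, Finset.sum_range_succ, Finset.sum_range_succ,
        Finset.sum_range_succ, ih, hodd, add_zero]
      rfl
  rw [← h1]
  refine Finset.sum_subset (fun j hj => ?_) fun j _ hj => hbig _ ?_
  · simp only [Finset.mem_range] at hj ⊢
    omega
  · simp only [Finset.mem_range] at hj
    omega

variable {A : Type*} [CommRing A] [Algebra ℂ A] {n : ℕ}

/-- The derivatives at `0` of the zeta functions of the bosonic operators with curvature `-W` and
`0` differ by the exponent of the rescaled `Â`-form. -/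
theorem half_sub_zetaDeriv {W : Matrix (Fin n) (Fin n) A} {I : Ideal A} (hI : I ^ (n + 1) = ⊥)
    (hW : ∀ i j, W i j ∈ I) {r : ℝ} (hr : 0 < r) :
    (1 / 2 : ℂ) • ((∑ j ∈ Finset.range (n + 1), deriv (zetaCoeff (2 * Real.pi / r) 2 j) 0 •
        ((1 + (-1) ^ j : ℂ) • ((-W) ^ j).trace)) -
      ∑ j ∈ Finset.range (n + 1), deriv (zetaCoeff (2 * Real.pi / r) 2 j) 0 •
        ((1 + (-1) ^ j : ℂ) • ((0 : Matrix (Fin n) (Fin n) A) ^ j).trace))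
      = ∑ m ∈ Finset.range n, (riemannZeta (2 * (m + 1 : ℕ)) / (2 * (m + 1 : ℕ))
      * (r / (2 * Real.pi) : ℂ) ^ (2 * (m + 1))) • (W ^ (2 * (m + 1))).trace := by
  have hc : 0 < 2 * Real.pi / r := div_pos Real.two_pi_pos hr
  -- The `j = 0` term depends only on the rank and is the same for both operators.
  rw [← Finset.sum_sub_distrib, Finset.sum_range_succ', pow_zero, pow_zero, pow_zero, sub_self,
    add_zero,
    Finset.smul_sum]
  set g : ℕ → A := fun j => (1 / 2 : ℂ) • (deriv (zetaCoeff (2 * Real.pi / r) 2 j) 0 •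
    ((1 + (-1) ^ j : ℂ) • ((-W) ^ j).trace)) with hg
  have h1 : ∑ j ∈ Finset.range n, g (j + 1) = ∑ m ∈ Finset.range n, g (2 * (m + 1)) := by
    refine sum_range_even (fun m => ?_) fun j hj => ?_
    · have : (1 + (-1) ^ (2 * m + 1) : ℂ) = 0 := by rw [pow_succ, pow_mul]; simp
      simp only [hg]
      rw [this, zero_smul, smul_zero, smul_zero]
    · obtain ⟨k, rfl⟩ := Nat.exists_eq_succ_of_ne_zero (by omega : j ≠ 0)
      have hm := trace_pow_mem (W := -W) (fun i j => neg_mem (hW i j)) k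
      have h0 := Ideal.pow_le_pow_right (show n + 1 ≤ k + 1 from hj) hm
      rw [hI, Ideal.mem_bot] at h0
      simp only [hg]
      rw [Nat.succ_eq_add_one, h0, smul_zero, smul_zero, smul_zero]
  refine Eq.trans (Finset.sum_congr rfl fun j _ => ?_) (h1.trans (Finset.sum_congr rfl fun m _ => ?_))
  · have : ((0 : Matrix (Fin n) (Fin n) A) ^ (j + 1)).trace = 0 := by
      rw [zero_pow (Nat.succ_ne_zero j), Matrix.trace_zero]
    rw [this, smul_zero, smul_zero, sub_zero]
  · have he : (-1 : ℂ) ^ (2 * (m + 1)) = 1 := by rw [pow_mul]; simp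
    have hw : (-W) ^ (2 * (m + 1)) = W ^ (2 * (m + 1)) := Even.neg_pow (even_two_mul _) W
    simp only [hg]
    rw [deriv_zetaCoeff hc 2 (by omega) (by omega), hw, he, smul_smul, smul_smul, ← inv_pow]
    congr 1
    push_cast
    rw [inv_div]
    ring

end TraceSum

/-! ### Equality of the relative super determinant and the rescaled `Â`-form -/

section Main

variable {n : ℕ} {X : Type*} [TopologicalSpace X] [T2Space X]
  [ChartedSpace (EuclideanSpace ℝ (Fin n)) X]
  [IsManifold (𝓡 n) ∞ X]
  [RiemannianBundle (fun x : X => TangentSpace (𝓡 n) x)]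
  [IsContMDiffRiemannianBundle (𝓡 n) ∞ (EuclideanSpace ℝ (Fin n))
      (fun x : X => TangentSpace (𝓡 n) x)]
  {cov : CovariantDerivative (𝓡 n) (EuclideanSpace ℝ (Fin n))
      (fun x : X => TangentSpace (𝓡 n) x)}

/-- The relative super determinant is the rescaled `Â`-form. -/
theorem isRelativeSdet_iff (hcov : IsLeviCivita cov) {r : ℝ} (hr : 0 < r) (x : X)
    (d : evenPart (CoT n x)) : IsRelativeSdet cov r x d ↔
      d = evenScale (CoT n x) ((Real.sqrt (2 * Real.pi * r) : ℝ) : ℂ) (aHatForm cov x) := by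
  have hI := soulIdeal_coT_pow (n := n) x
  have hW := curvatureForm_mem_soulIdeal cov x
  have hnil : (-curvatureForm cov x) ^ (n + 1) = 0 := by
    refine Matrix.ext fun i j => ?_
    have := matrix_pow_mem (W := -curvatureForm cov x) (fun i j => neg_mem (hW i j)) n i j
    rwa [hI, Ideal.mem_bot] at this
  obtain ⟨w, hw⟩ := exists_hasZetaDeriv_kineticFer (A := evenPart (CoT n x)) (n := n) hr
  have h0 := hasZetaDeriv_kineticBos (A := evenPart (CoT n x)) (n := n) hr (R := 0) (N := n + 1)
    (zero_pow (Nat.succ_ne_zero n))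
  rw [← kineticBosTrivial_eq] at h0
  refine (relativeSdet_iff (hasZetaDeriv_kineticBos hr hnil) h0 hw d).trans ?_
  rw [half_sub_zetaDeriv hI hW hr, evenScale_aHatForm hcov x hr, gexp_eq_of_mem hI]
  -- The exponent has no body, so its exponential carries no numerical factor.
  refine Ideal.sum_mem _ fun m _ => Submodule.smul_of_tower_mem _ _ ?_
  exact Ideal.pow_le_self (by omega) (trace_pow_mem hW (2 * m + 1))

end Main

end ClassicalVacua

end

theorem mainTheorem6 (n : ℕ) (X : Type*) [TopologicalSpace X] [T2Space X] [CompactSpace X]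
    [ChartedSpace (EuclideanSpace ℝ (Fin n)) X] [IsManifold (𝓡 n) ∞ X]
    [RiemannianBundle (fun x : X => TangentSpace (𝓡 n) x)]
    [IsContMDiffRiemannianBundle (𝓡 n) ∞ (EuclideanSpace ℝ (Fin n))
      (fun x : X => TangentSpace (𝓡 n) x)]
    (cov : CovariantDerivative (𝓡 n) (EuclideanSpace ℝ (Fin n))
      (fun x : X => TangentSpace (𝓡 n) x))
    (hcov : IsLeviCivita cov) :
    ∃ f : ℝ → (x : X) → evenPart (CoT n x),
      (∀ r : ℝ, 0 < r → ∀ (x : X) (d : evenPart (CoT n x)),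
        IsRelativeSdet cov r x d ↔ d = f r x) ∧
      IsSupersymmetric n (fun r x => (f r x : ExteriorAlgebra ℂ (CoT n x))) ∧
      (∀ r : ℝ, 0 < r → ∀ x : X, (f r x : ExteriorAlgebra ℂ (CoT n x)) =
        degScale (CoT n x) ((Real.sqrt (2 * Real.pi * r) : ℝ) : ℂ) (aHatForm cov x)) ∧
      ∃ hA : (fun x => (aHatForm cov x : ExteriorAlgebra ℂ (CoT n x))) ∈ closedEvenForms n X,
        Represents n (fun r x => (f r x : ExteriorAlgebra ℂ (CoT n x)))
          (Submodule.Quotient.mk ⟨_, hA⟩) := by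
  have hA : (fun x => (aHatForm cov x : ExteriorAlgebra ℂ (CoT n x))) ∈ closedEvenForms n X :=
    ⟨aHatForm_closed hcov, fun x => (aHatForm cov x).2⟩
  exact ⟨fun r x => evenScale (CoT n x) ((Real.sqrt (2 * Real.pi * r) : ℝ) : ℂ) (aHatForm cov x),
    fun r hr x d => isRelativeSdet_iff hcov hr x d,
    isSupersymmetric_of_closed hA.1 hA.2 Real.two_pi_pos fun r _ x => coe_evenScale _ _,
    fun r _ x => coe_evenScale _ _, hA, represents_of_closed hA fun r _ x => coe_evenScale _ _⟩
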